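/- Let $M$ be a smooth (Hausdorff, $\sigma$-compact) $m$-dimensional manifold and $E\to M$ a smooth vector bundle of rank $n$. A skew algebroid structure on $E$ is a skew-symmetric $\mathbb R$-bilinear bracket $[\cdot,\cdot]$ on the space $\mathrm{Sec}(E)$ of smooth sections together with a vector bundle morphism $\rho:E\to TM$ over the identity such that $[X,fY]=\rho(X)(f)\,Y+f[X,Y]$ for $X,Y\in\mathrm{Sec}(E)$, $f\in C^\infty(M)$ (equivalently, a linear bivector field $\Pi$ on $E^*$; no Jacobi identity is assumed). Let $\mathcal A(E^*)=\bigoplus_k\mathcal A^k(E^*)$, $\mathcal A^k(E^*)=\mathrm{Sec}(\wedge^kE^*)$, be the algebra of functions on the supermanifold $E[1]$, and let the de Rham vector field $d^\Pi$ on $E[1]$ be the degree-1 operator on $\mathcal A(E^*)$ given by Cartan's formula $$(d^\Pi\alpha)(X_0,\dots,X_k)=\sum_i(-1)^i\rho(X_i)\bigl(\alpha(\dots,\widehat{X_i},\dots)\bigr)+\sum_{i<j}(-1)^{i+j}\alpha([X_i,X_j],\dots,\widehat{X_i},\dots,\widehat{X_j},\dots).$$ Let $L^E=\wedge^nE\otimes\wedge^mT^*M$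 with the connection $\nabla_X(Y\otimes\mu)=\mathcal L_XY\otimes\mu+Y\otimes\mathcal L_{\rho(X)}\mu$, where $\mathcal L_X(Y_1\wedge\dots\wedge Y_n)=\sum_iY_1\wedge\dots\wedge[X,Y_i]\wedge\dots\wedge Y_n$, and let $|L^E|=L^E/\mathbb Z_2$. The modular form of a nowhere-vanishing section $|\sigma|$ of $|L^E|$ is the $\varphi_{|\sigma|}\in\mathcal A^1(E^*)$ with $\nabla_X\sigma=\langle X,\varphi_{|\sigma|}\rangle\,\sigma$ for all $X$ and all local representatives $\sigma$ of $|\sigma|$; the modular class $\mathrm{mod}(E)$ is the class of $\varphi_{|\sigma|}$ in $\mathcal A^1(E^*)/d^\Pi\mathcal A^0(E^*)$ for some nowhere-vanishing section $|\sigma|$. A local section $\sigma=e_n\wedge\dots\wedge e_1\otimes\mu$ of $L^E$ defines the operator $S(\sigma):f\mapsto(i_{e_n}\cdots i_{e_1}f)\,\mu$ from superfunctions to $m$-forms (only the component of $f$ in $\mathcal A^n(E^*)$ contributes), which represents a local section of degree $n$ mod $2$ of the Berezinian sheaf of $E[1]$. Here two operators represent the same Berezinian section over a small open set $U\subset M$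 if their values on each superfunction with compact support in $U$ have the same integral. For a nowhere-vanishing section $|\sigma|$ of $|L^E|$, the local Berezinian volumes $s=S(\sigma)$, $\sigma$ running over the local representatives of $|\sigma|$, form a Berezinian $1$-density $|s|=S(|\sigma|)$, and the superdivergence $\mathrm{div}_{|s|}(X)$ of a vector field $X$ of degree $|X|$ on $E[1]$ is the superfunction with $\mathcal L_Xs=(-1)^{|X||s|}\,s\cdot\mathrm{div}_{|s|}(X)$ for all these $s$, where $\mathcal L_Xs=-(-1)^{|X||s|}\,s\circ X$ and $(s\cdot g)(f)=s(gf)$. Theorem. Let $E$ be a skew algebroid. Then $\mathrm{mod}(E)$ is well defined: nowhere-vanishing sections of $|L^E|$ with a modular form exist, and all modular forms have the same class. For every nowhere-vanishing section $|\sigma|$ of $|L^E|$, with $|s|=S(|\sigma|)$, the superdivergence $\mathrm{div}_{|s|}(d^\Pi)$ exists, is unique, is homogeneous of degree $1$, and, as an element of $\mathcal A^1(E^*)$, represents the modular class $\mathrm{mod}(E)$. -/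

import Mathlib

open Bundle Manifold Function
open scoped Manifold ContDiff Topology TensorProduct

set_option linter.unusedSectionVars false

noncomputable section

namespace SkewAlg

section Forms

variable (m n : ℕ) {M : Type*} [TopologicalSpace M] [ChartedSpace (EuclideanSpace ℝ (Fin m)) M]
  (E : M → Type*) [∀ x, AddCommGroup (E x)] [∀ x, Module ℝ (E x)] [∀ x, TopologicalSpace (E x)]
  [TopologicalSpace (TotalSpace (EuclideanSpace ℝ (Fin n)) E)]
  [FiberBundle (EuclideanSpace ℝ (Fin n)) E]

/-- Smooth global sections of a rank-`n` vector bundle `E` over an `m`-dimensional manifold. -/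
abbrev Sec : Type _ := Cₛ^∞⟮𝓡 m; EuclideanSpace ℝ (Fin n), E⟯

/-- Smooth real functions on an `m`-dimensional manifold. -/
abbrev Fct (M : Type*) [TopologicalSpace M] [ChartedSpace (EuclideanSpace ℝ (Fin m)) M] : Type _ :=
  C^∞⟮𝓡 m, M; ℝ⟯

/-- The space of smooth sections of the `k`-th exterior power of the dual bundle of `E`: families of
alternating `k`-forms on the fibres whose values on smooth sections are smooth. -/
def formSpace (k : ℕ) : Submodule ℝ (∀ x, E x [⋀^Fin k]→ₗ[ℝ] ℝ) where
  carrier := {α | ∀ X : Fin k → Sec m n E,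
    ContMDiff (𝓡 m) 𝓘(ℝ, ℝ) ∞ fun x => α x fun i => X i x}
  add_mem' ha hb X := (ha X).add (hb X)
  zero_mem' _ := contMDiff_const
  smul_mem' _ _ ha X := contMDiff_const.mul (ha X)

/-- `Form m n E k` is the space `𝒜ᵏ(E*)`. -/
abbrev Form (k : ℕ) : Type _ := formSpace m n E k

variable {m n E}

variable [VectorBundle ℝ (EuclideanSpace ℝ (Fin n)) E]

/-- The product of a smooth function and a section. -/
def fsmul (f : Fct m M) (X : Sec m n E) : Sec m n E :=
  ⟨fun x => f x • X x, f.contMDiff.smul_section X.contMDiff⟩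

theorem fsmul_apply (f : Fct m M) (X : Sec m n E) (x : M) : fsmul f X x = f x • X x := rfl

theorem sec_update {k : ℕ} (X : Fin k → Sec m n E) (i : Fin k) (Z : Sec m n E) (x : M) :
    (fun j => update X i Z j x) = update (fun j => X j x) i (Z x) := by
  funext j
  rcases eq_or_ne j i with rfl | h
  · simp
  · simp [h]

/-- The values of a form on global sections. -/
def evalSec {k : ℕ} (α : Form m n E k) : Sec m n E [⋀^Fin k]→ₗ[ℝ] Fct m M where
  toFun X := ⟨fun x => α.1 x fun i => X i x, α.2 X⟩
  map_update_add' X i a b := by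
    rename_i inst
    obtain rfl : inst = instDecidableEqFin k := Subsingleton.elim _ _
    ext x
    change (α.1 x fun j => update X i (a + b) j x) =
      (α.1 x fun j => update X i a j x) + α.1 x fun j => update X i b j x
    simp only [sec_update]
    exact (α.1 x).map_update_add (fun j => X j x) i (a x) (b x)
  map_update_smul' X i c a := by
    rename_i inst
    obtain rfl : inst = instDecidableEqFin k := Subsingleton.elim _ _
    ext x
    change (α.1 x fun j => update X i (c • a) j x) = c * α.1 x fun j => update X i a j x
    simp only [sec_update]
    exact (α.1 x).map_update_smul (fun j => X j x) i c (a x)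
  map_eq_zero_of_eq' X i j h hij := by
    ext x
    exact (α.1 x).map_eq_zero_of_eq _ (by simp [h]) hij

theorem evalSec_apply {k : ℕ} (α : Form m n E k) (X : Fin k → Sec m n E) (x : M) :
    evalSec α X x = α.1 x fun i => X i x := rfl

variable [IsManifold (𝓡 m) ∞ M] [ContMDiffVectorBundle ∞ (EuclideanSpace ℝ (Fin n)) E (𝓡 m)]
  [T2Space M]

theorem exists_bump {u : Set M} {x : M} (hu : u ∈ 𝓝 x) :
    ∃ f : Fct m M, tsupport f ⊆ u ∧ f x = 1 := by
  obtain ⟨f, -, hf⟩ := (SmoothBumpFunction.nhds_basis_tsupport (I := 𝓡 m) x).mem_iff.1 hu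
  exact ⟨⟨f, f.contMDiff⟩, hf, f.eq_one⟩

theorem exists_sec {u : Set M} (hu : IsOpen u) {s : ∀ x, E x}
    (hs : ContMDiffOn (𝓡 m) ((𝓡 m).prod 𝓘(ℝ, EuclideanSpace ℝ (Fin n))) ∞
      (fun x => (⟨x, s x⟩ : TotalSpace (EuclideanSpace ℝ (Fin n)) E)) u)
    (f : Fct m M) (hf : tsupport f ⊆ u) : ∃ X : Sec m n E, ∀ x, X x = f x • s x :=
  ⟨⟨fun x => f x • s x,
    ContMDiffOn.smul_section_of_tsupport (f.contMDiff.contMDiffOn) hu hf hs⟩, fun _ => rfl⟩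

theorem exists_sec_eq (x : M) (v : E x) : ∃ X : Sec m n E, X x = v := by
  obtain ⟨s, hs, hv⟩ := FiberBundle.exists_contMDiffOn_extend (k := ∞) (𝓡 m) (EuclideanSpace ℝ (Fin n)) v
  obtain ⟨u, hus, hu, hxu⟩ := mem_nhds_iff.1 hs
  obtain ⟨f, hf, hfx⟩ := exists_bump (m := m) (hu.mem_nhds hxu)
  obtain ⟨X, hX⟩ := exists_sec hu (hv.mono hus) f hf
  exact ⟨X, by simp [hX, hfx]⟩

/-- A linear extension of vectors at `x` to global sections. -/
def extSec (x : M) : E x →ₗ[ℝ] Sec m n E :=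
  (Module.Basis.ofVectorSpace ℝ (E x)).constr ℝ fun i =>
    (exists_sec_eq (m := m) (n := n) x (Module.Basis.ofVectorSpace ℝ (E x) i)).choose

theorem extSec_apply_self (x : M) (v : E x) : extSec (m := m) (n := n) x v x = v := by
  let ev : Sec m n E →ₗ[ℝ] E x :=
    { toFun := fun X => X x, map_add' := fun _ _ => rfl, map_smul' := fun _ _ => rfl }
  have : ev ∘ₗ extSec x = LinearMap.id := by
    refine (Module.Basis.ofVectorSpace ℝ (E x)).ext fun i => ?_
    simp only [extSec, LinearMap.comp_apply, Module.Basis.constr_basis, LinearMap.id_apply]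
    exact (exists_sec_eq (m := m) (n := n) x (Module.Basis.ofVectorSpace ℝ (E x) i)).choose_spec
  exact LinearMap.congr_fun this v

/-- An alternating map on sections that is linear over smooth functions in every slot. -/
def IsTensorial {k : ℕ} (D : Sec m n E [⋀^Fin k]→ₗ[ℝ] Fct m M) : Prop :=
  ∀ (X : Fin k → Sec m n E) (i : Fin k) (f : Fct m M) (a : Sec m n E),
    D (update X i (fsmul f a)) = f * D (update X i a)

theorem IsTensorial.eq_zero {k : ℕ} {D : Sec m n E [⋀^Fin k]→ₗ[ℝ] Fct m M} (h : IsTensorial D)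
    (X : Fin k → Sec m n E) (i : Fin k) (Z : Sec m n E) (x : M) (hZ : Z x = 0) :
    D (update X i Z) x = 0 := by
  let t := trivializationAt (EuclideanSpace ℝ (Fin n)) E x
  have hx : x ∈ t.baseSet := FiberBundle.mem_baseSet_trivializationAt _ E x
  let b := (EuclideanSpace.basisFun (Fin n) ℝ).toBasis
  obtain ⟨f, hf, hfx⟩ := exists_bump (m := m) (t.open_baseSet.mem_nhds hx)
  have h1 : ∀ j, ∃ S : Sec m n E, ∀ y, S y = f y • t.localFrame b j y := fun j =>
    exists_sec t.open_baseSet (t.contMDiffOn_localFrame_baseSet ∞ b j) f hf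
  have h2 : ∀ j, ∃ c : Fct m M, ∀ y, c y = f y * t.localFrameCoeff (𝓡 m) b j y (Z y) := fun j => by
    have hc := contMDiffOn_baseSet_localFrameCoeff (I := 𝓡 m) (e := t) b (k := ∞)
      (Z.contMDiff.contMDiffOn) j
    refine ⟨⟨fun y => f y * t.localFrameCoeff (𝓡 m) b j y (Z y), ?_⟩, fun _ => rfl⟩
    refine contMDiff_of_tsupport fun y hy => ?_
    have hy' : y ∈ t.baseSet := hf (tsupport_mul_subset_left hy)
    exact (f.contMDiff y).mul ((hc y hy').contMDiffAt (t.open_baseSet.mem_nhds hy'))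
  choose S hS using h1
  choose c hc using h2
  have key : fsmul f (fsmul f Z) = ∑ j, fsmul (c j) (S j) := by
    ext y
    have e1 : (∑ j, fsmul (c j) (S j)) y = ∑ j, fsmul (c j) (S j) y := by
      let ev : Sec m n E →+ E y :=
        { toFun := fun X => X y, map_zero' := rfl, map_add' := fun _ _ => rfl }
      exact map_sum ev _ _
    rw [e1]
    simp only [fsmul_apply, hc, hS]
    by_cases hy : y ∈ t.baseSet
    · conv_lhs => rw [t.eq_sum_localFrameCoeff_smul (I := 𝓡 m) (s := Z) (b := b) hy]
      simp only [Finset.smul_sum, smul_smul]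
      refine Finset.sum_congr rfl fun j _ => ?_
      congr 1
      ring
    · have : f y = 0 := image_eq_zero_of_notMem_tsupport fun h => hy (hf h)
      simp [this]
  have e2 : D (update X i (fsmul f (fsmul f Z))) x = D (update X i Z) x := by
    rw [h, h]; simp [hfx]
  rw [← e2, key, D.map_update_sum]
  have e3 : ∀ j, D (update X i (fsmul (c j) (S j))) x = 0 := fun j => by
    rw [h]; simp [hc, hZ]
  let ev : Fct m M →+ ℝ :=
    { toFun := fun X => X x, map_zero' := rfl, map_add' := fun _ _ => rfl }
  change ev (∑ j, D (update X i (fsmul (c j) (S j)))) = 0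
  rw [map_sum]
  exact Finset.sum_eq_zero fun j _ => e3 j

theorem IsTensorial.congr {k : ℕ} {D : Sec m n E [⋀^Fin k]→ₗ[ℝ] Fct m M} (h : IsTensorial D)
    (X Y : Fin k → Sec m n E) (x : M) (hXY : ∀ i, X i x = Y i x) : D X x = D Y x := by
  have key : ∀ s : Finset (Fin k), D (s.piecewise X Y) x = D Y x := by
    intro s
    induction s using Finset.induction_on with
    | empty => simp
    | insert i s hi ih =>
      rw [← ih, Finset.piecewise_insert]
      have e : X i = (X i - Y i) + Y i := by abel
      have e2 : update (s.piecewise X Y) i (Y i) = s.piecewise X Y := by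
        rw [update_eq_self_iff, Finset.piecewise_eq_of_notMem _ _ _ hi]
      rw [e, D.map_update_add, e2]
      have := h.eq_zero (s.piecewise X Y) i (X i - Y i) x (by simp [hXY])
      change D (update (s.piecewise X Y) i (X i - Y i)) x + _ = _
      rw [this, zero_add]
  simpa using key Finset.univ

/-- The form defined by a tensorial alternating map on sections, through
`(formOf D) x (X₁ x, …, X_k x) = D (X₁, …, X_k) x`. -/
def formOf {k : ℕ} (D : Sec m n E [⋀^Fin k]→ₗ[ℝ] Fct m M) (h : IsTensorial D) : Form m n E k :=
  ⟨fun x =>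
    (({ toFun := fun f => f x, map_add' := fun _ _ => rfl, map_smul' := fun _ _ => rfl } :
        Fct m M →ₗ[ℝ] ℝ).compAlternatingMap D).compLinearMap (extSec x),
    fun X => (D X).contMDiff.congr fun x => h.congr _ _ x fun i => extSec_apply_self x (X i x)⟩

theorem formOf_apply {k : ℕ} (D : Sec m n E [⋀^Fin k]→ₗ[ℝ] Fct m M) (h : IsTensorial D)
    (X : Fin k → Sec m n E) (x : M) : (formOf D h).1 x (fun i => X i x) = D X x :=
  h.congr _ _ x fun i => extSec_apply_self x (X i x)

theorem evalSec_formOf {k : ℕ} (D : Sec m n E [⋀^Fin k]→ₗ[ℝ] Fct m M) (h : IsTensorial D) :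
    evalSec (formOf D h) = D := by
  ext X x
  exact formOf_apply D h X x

theorem evalSec_injective {k : ℕ} {α β : Form m n E k} (h : evalSec α = evalSec β) : α = β := by
  ext x v
  have := congrArg (fun D => D (fun i => extSec (m := m) (n := n) x (v i)) x) h
  simpa [evalSec_apply, extSec_apply_self] using this

end Forms

section Algebroid

variable (m n : ℕ) {M : Type*} [TopologicalSpace M] [ChartedSpace (EuclideanSpace ℝ (Fin m)) M]
  [IsManifold (𝓡 m) ∞ M]
  (E : M → Type*) [∀ x, AddCommGroup (E x)] [∀ x, Module ℝ (E x)] [∀ x, TopologicalSpace (E x)]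
  [TopologicalSpace (TotalSpace (EuclideanSpace ℝ (Fin n)) E)]
  [FiberBundle (EuclideanSpace ℝ (Fin n)) E] [VectorBundle ℝ (EuclideanSpace ℝ (Fin n)) E]

/-- A skew algebroid structure on the vector bundle `E`: a skew-symmetric `ℝ`-bilinear bracket of
sections and a smooth vector bundle morphism `ρ : E → TM` over the identity with
`[X, f Y] = ρ(X)(f) Y + f [X, Y]`. No Jacobi identity is required. -/
structure SkewAlgebroid where
  bracket : Sec m n E →ₗ[ℝ] Sec m n E →ₗ[ℝ] Sec m n E
  bracket_skew : ∀ X Y, bracket X Y = -bracket Y X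
  anchor : ∀ x, E x →ₗ[ℝ] TangentSpace (𝓡 m) x
  anchor_smooth : ContMDiff ((𝓡 m).prod 𝓘(ℝ, EuclideanSpace ℝ (Fin n))) (𝓡 m).tangent ∞
    fun p : TotalSpace (EuclideanSpace ℝ (Fin n)) E =>
      (⟨p.1, anchor p.1 p.2⟩ : TangentBundle (𝓡 m) M)
  leibniz : ∀ (X Y : Sec m n E) (f : Fct m M) (x : M),
    bracket X (fsmul f Y) x =
      mvfderiv (𝓡 m) f x (anchor x (X x)) • Y x + f x • bracket X Y x

variable {m n E}

/-- The directional derivative `V(f)` of a smooth function along a vector field. -/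
def dirDeriv (V : Sec m m (TangentSpace (𝓡 m) : M → Type _)) (f : Fct m M) : Fct m M :=
  ⟨fun x => mvfderiv (𝓡 m) f x (V x), by
    have h1 := (f.contMDiff.contMDiff_tangentMap (m := ∞) le_rfl).comp V.contMDiff
    exact (contMDiff_snd_tangentBundle_modelSpace ℝ 𝓘(ℝ, ℝ)).comp h1⟩

theorem dirDeriv_apply (V : Sec m m (TangentSpace (𝓡 m) : M → Type _)) (f : Fct m M) (x : M) :
    dirDeriv V f x = mvfderiv (𝓡 m) f x (V x) := rfl

theorem fct_mdiff (f : Fct m M) (x : M) : MDifferentiableAt (𝓡 m) 𝓘(ℝ, ℝ) f x :=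
  f.contMDiff.mdifferentiableAt (by simp)

namespace SkewAlgebroid

variable (A : SkewAlgebroid m n E)

/-- The vector field `ρ(X)`. -/
def anchorSec (X : Sec m n E) : Sec m m (TangentSpace (𝓡 m) : M → Type _) :=
  ⟨fun x => A.anchor x (X x), A.anchor_smooth.comp X.contMDiff⟩

/-- The derivation `f ↦ ρ(X)(f)`, linear in `X`. -/
def rho : Sec m n E →ₗ[ℝ] Fct m M →ₗ[ℝ] Fct m M :=
  LinearMap.mk₂ ℝ (fun X f => dirDeriv (A.anchorSec X) f)
    (fun X Y f => by
      ext x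
      change mvfderiv (𝓡 m) f x (A.anchor x (X x + Y x)) = _
      rw [map_add, map_add]; rfl)
    (fun c X f => by
      ext x
      change mvfderiv (𝓡 m) f x (A.anchor x (c • X x)) = _
      rw [map_smul, map_smul]; rfl)
    (fun X f g => by
      ext x
      change mvfderiv (𝓡 m) (⇑f + ⇑g) x _ = _
      rw [mvfderiv_add (fct_mdiff f x) (fct_mdiff g x)]; rfl)
    (fun c X f => by
      ext x
      change mvfderiv (𝓡 m) ((fun _ : M => c) * ⇑f) x _ = _
      rw [mvfderiv_mul mdifferentiableAt_const (fct_mdiff f x), mvfderiv_const]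
      simp only [smul_zero, add_zero]
      rfl)

theorem rho_apply (X : Sec m n E) (f : Fct m M) (x : M) :
    A.rho X f x = mvfderiv (𝓡 m) f x (A.anchor x (X x)) := rfl

theorem rho_mul (X : Sec m n E) (f g : Fct m M) :
    A.rho X (f * g) = A.rho X f * g + f * A.rho X g := by
  ext x
  change mvfderiv (𝓡 m) (⇑f * ⇑g) x _ = A.rho X f x * g x + f x * A.rho X g x
  rw [mvfderiv_mul (fct_mdiff f x) (fct_mdiff g x)]
  change f x * A.rho X g x + g x * A.rho X f x = _
  ring

theorem rho_fsmul (X : Sec m n E) (f g : Fct m M) : A.rho (fsmul f X) g = f * A.rho X g := by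
  ext x
  change mvfderiv (𝓡 m) g x (A.anchor x (f x • X x)) = f x * A.rho X g x
  rw [map_smul, map_smul]; rfl

theorem bracket_fsmul (X Y : Sec m n E) (f : Fct m M) :
    A.bracket X (fsmul f Y) = fsmul (A.rho X f) Y + fsmul f (A.bracket X Y) := by
  ext x
  exact A.leibniz X Y f x

theorem bracket_fsmul_left (X Y : Sec m n E) (f : Fct m M) :
    A.bracket (fsmul f X) Y = fsmul f (A.bracket X Y) - fsmul (A.rho Y f) X := by
  rw [A.bracket_skew, A.bracket_fsmul, A.bracket_skew Y X]
  ext x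
  change -((A.rho Y f x) • X x + f x • -(A.bracket X Y x)) =
    f x • A.bracket X Y x - A.rho Y f x • X x
  rw [smul_neg]; abel

end SkewAlgebroid

/-- For an alternating map `D` and a linear operator `L`, the alternating map
`(Z₁, …, Z_k) ↦ ∑ⱼ D (Z₁, …, L Zⱼ, …, Z_k)`. -/
def substSum {S N : Type*} [AddCommGroup S] [Module ℝ S] [AddCommGroup N] [Module ℝ N] {k : ℕ}
    (L : S →ₗ[ℝ] S) (D : S [⋀^Fin k]→ₗ[ℝ] N) : S [⋀^Fin k]→ₗ[ℝ] N :=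
  { (∑ j, D.toMultilinearMap.compLinearMap fun i => if i = j then L else LinearMap.id) with
    map_eq_zero_of_eq' := by
      intro Z a b hab hne
      have e : ∀ j, (fun i => (if i = j then L else LinearMap.id) (Z i)) = update Z j (L (Z j)) :=
        fun j => by
          funext i
          rcases eq_or_ne i j with rfl | h
          · simp
          · simp [h]
      change (∑ j, D.toMultilinearMap.compLinearMap
        fun i => if i = j then L else LinearMap.id) Z = 0
      simp only [sum_apply, MultilinearMap.compLinearMap_apply, e]
      rw [Fintype.sum_eq_add a b hne]
      · have : update Z b (L (Z b)) = update Z a (L (Z a)) ∘ Equiv.swap a b := by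
          rw [hab]
          funext i
          simp only [comp_apply, update_apply]
          rcases eq_or_ne i b with rfl | hb
          · simp
          · rcases eq_or_ne i a with rfl | ha
            · simp [hne.symm, hne, hab]
            · simp [Equiv.swap_apply_of_ne_of_ne ha hb, ha, hb]
        rw [this]
        exact D.map_add_swap _ hne
      · intro j hj
        exact D.map_eq_zero_of_eq _ (by simp [hj.1.symm, hj.2.symm, hab]) hne }

theorem substSum_apply {S N : Type*} [AddCommGroup S] [Module ℝ S] [AddCommGroup N] [Module ℝ N]
    {k : ℕ} (L : S →ₗ[ℝ] S) (D : S [⋀^Fin k]→ₗ[ℝ] N) (Z : Fin k → S) :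
    substSum L D Z = ∑ j, D (update Z j (L (Z j))) := by
  change (∑ j, D.toMultilinearMap.compLinearMap fun i => if i = j then L else LinearMap.id) Z = _
  simp only [sum_apply, MultilinearMap.compLinearMap_apply]
  refine Finset.sum_congr rfl fun j _ => congrArg D ?_
  funext i
  rcases eq_or_ne i j with rfl | h
  · simp
  · simp [h]

theorem evalSec_tensorial {k : ℕ} (α : Form m n E k) : IsTensorial (evalSec α) := by
  intro X i f a
  ext x
  change (α.1 x fun j => update X i (fsmul f a) j x) = f x * α.1 x fun j => update X i a j x
  simp only [sec_update, fsmul_apply]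
  exact (α.1 x).map_update_smul _ _ _ _

namespace SkewAlgebroid

variable (A : SkewAlgebroid m n E)

/-- The Lie derivative of a form on sections:
`(ℒ_X α)(Z₁, …, Z_k) = ρ(X)(α(Z₁, …, Z_k)) - ∑ⱼ α(Z₁, …, [X, Zⱼ], …, Z_k)`. -/
def lieAlt {k : ℕ} (X : Sec m n E) (α : Form m n E k) : Sec m n E [⋀^Fin k]→ₗ[ℝ] Fct m M :=
  (A.rho X).compAlternatingMap (evalSec α) - substSum (A.bracket X) (evalSec α)

theorem lieAlt_apply {k : ℕ} (X : Sec m n E) (α : Form m n E k) (Z : Fin k → Sec m n E) :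
    A.lieAlt X α Z =
      A.rho X (evalSec α Z) - ∑ j, evalSec α (update Z j (A.bracket X (Z j))) := by
  rw [lieAlt, AlternatingMap.sub_apply, substSum_apply]; rfl

theorem lieAlt_tensorial {k : ℕ} (X : Sec m n E) (α : Form m n E k) :
    IsTensorial (A.lieAlt X α) := by
  intro Z i f a
  have hα := evalSec_tensorial α
  rw [lieAlt_apply, lieAlt_apply, hα, rho_mul, mul_sub]
  rw [← Finset.add_sum_erase _ _ (Finset.mem_univ i),
    ← Finset.add_sum_erase Finset.univ
      (fun j => evalSec α (update (update Z i a) j (A.bracket X (update Z i a j))))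
      (Finset.mem_univ i)]
  have h2 : ∀ j ∈ Finset.univ.erase i,
      evalSec α (update (update Z i (fsmul f a)) j (A.bracket X (update Z i (fsmul f a) j))) =
        f * evalSec α (update (update Z i a) j (A.bracket X (update Z i a j))) := by
    intro j hj
    have hj : j ≠ i := Finset.ne_of_mem_erase hj
    rw [update_of_ne hj, update_of_ne hj, update_comm hj.symm, hα, update_comm hj.symm]
  rw [Finset.sum_congr rfl h2, ← Finset.mul_sum]
  simp only [update_self, update_idem]
  rw [bracket_fsmul, AlternatingMap.map_update_add, hα, hα]
  ring

/-- The operator `X ↦ ρ(X)(α(·)) - ½ ∑ⱼ α(·, …, [X, ·ⱼ], …, ·)`. -/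
def preCartan {k : ℕ} (α : Form m n E k) :
    Sec m n E →ₗ[ℝ] Sec m n E [⋀^Fin k]→ₗ[ℝ] Fct m M where
  toFun X := (A.rho X).compAlternatingMap (evalSec α) -
    (1 / 2 : ℝ) • substSum (A.bracket X) (evalSec α)
  map_add' X Y := by
    ext1 Z
    have : ∀ j, evalSec α (update Z j (A.bracket (X + Y) (Z j))) =
        evalSec α (update Z j (A.bracket X (Z j))) +
        evalSec α (update Z j (A.bracket Y (Z j))) := fun j => by
      rw [map_add, LinearMap.add_apply, AlternatingMap.map_update_add]
    simp only [AlternatingMap.sub_apply, AlternatingMap.smul_apply, AlternatingMap.add_apply,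
      substSum_apply, this, LinearMap.compAlternatingMap_apply]
    rw [Finset.sum_add_distrib, smul_add, map_add, LinearMap.add_apply]
    abel
  map_smul' c X := by
    ext1 Z
    have : ∀ j, evalSec α (update Z j (A.bracket (c • X) (Z j))) =
        c • evalSec α (update Z j (A.bracket X (Z j))) := fun j => by
      rw [map_smul, LinearMap.smul_apply, AlternatingMap.map_update_smul]
    simp only [AlternatingMap.sub_apply, AlternatingMap.smul_apply, RingHom.id_apply,
      substSum_apply, this, LinearMap.compAlternatingMap_apply]
    rw [← Finset.smul_sum, map_smul, LinearMap.smul_apply, smul_comm, smul_sub]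

theorem preCartan_apply {k : ℕ} (α : Form m n E k) (X : Sec m n E) (Z : Fin k → Sec m n E) :
    A.preCartan α X Z = A.rho X (evalSec α Z) -
      (1 / 2 : ℝ) • ∑ j, evalSec α (update Z j (A.bracket X (Z j))) := by
  rw [← substSum_apply]; rfl

/-- Cartan's formula for the de Rham derivative,
`(dα)(X₀, …, X_k) = ∑ᵢ (-1)ⁱ (ρ(Xᵢ)(α(…, X̂ᵢ, …)) - ½ ∑_{j ≠ i} α(…, X̂ᵢ, …, [Xᵢ, Xⱼ], …))`,
with `[Xᵢ, Xⱼ]` in the place of `Xⱼ`. Moving `[Xᵢ, Xⱼ]` to the front turns the terms of `(i, j)` and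
of `(j, i)` into the same term `½ (-1)^(i+j) α([Xᵢ, Xⱼ], …, X̂ᵢ, …, X̂ⱼ, …)` of the usual formula. -/
def cartanAlt {k : ℕ} (α : Form m n E k) : Sec m n E [⋀^Fin (k + 1)]→ₗ[ℝ] Fct m M :=
  AlternatingMap.alternatizeUncurryFin (A.preCartan α)

theorem cartanAlt_apply {k : ℕ} (α : Form m n E k) (X : Fin (k + 1) → Sec m n E) :
    A.cartanAlt α X = ∑ i : Fin (k + 1), (-1) ^ (i : ℕ) •
      (A.rho (X i) (evalSec α (i.removeNth X)) - (1 / 2 : ℝ) •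
        ∑ j, evalSec α (update (i.removeNth X) j (A.bracket (X i) (i.removeNth X j)))) := by
  simp only [cartanAlt, AlternatingMap.alternatizeUncurryFin_apply, preCartan_apply]

theorem cartanAlt_cons {k : ℕ} (α : Form m n E k) (f : Fct m M) (a : Sec m n E)
    (v : Fin k → Sec m n E) :
    A.cartanAlt α (Fin.cons (fsmul f a) v : Fin (k + 1) → Sec m n E) =
      f * A.cartanAlt α (Fin.cons a v : Fin (k + 1) → Sec m n E) := by
  have hα := evalSec_tensorial α
  rw [cartanAlt, AlternatingMap.alternatizeUncurryFin_apply,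
    AlternatingMap.alternatizeUncurryFin_apply, Fin.sum_univ_succ, Fin.sum_univ_succ]
  have r0 : ∀ b : Sec m n E, Fin.removeNth 0 (Fin.cons b v : Fin (k + 1) → Sec m n E) = v :=
    fun b => Fin.removeNth_zero _
  simp only [r0, Fin.cons_zero, Fin.cons_succ, Fin.val_zero, pow_zero, one_smul]
  have h0 : A.preCartan α (fsmul f a) v = f * A.preCartan α a v +
      (1 / 2 : ℝ) • ∑ j, A.rho (v j) f * evalSec α (update v j a) := by
    have : ∀ j, evalSec α (update v j (A.bracket (fsmul f a) (v j))) =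
        f * evalSec α (update v j (A.bracket a (v j))) -
          A.rho (v j) f * evalSec α (update v j a) := fun j => by
      rw [bracket_fsmul_left, AlternatingMap.map_update_sub, hα, hα]
    rw [preCartan_apply, preCartan_apply, rho_fsmul]
    simp only [this]
    rw [Finset.sum_sub_distrib, ← Finset.mul_sum, smul_sub, mul_sub, mul_smul_comm]
    abel
  rw [h0]
  cases k with
  | zero => simp
  | succ k =>
    have r1 : ∀ (b : Sec m n E) (i : Fin (k + 1)),
        Fin.removeNth i.succ (Fin.cons b v : Fin (k + 2) → Sec m n E) =
          Fin.cons b (i.removeNth v) := fun b i => by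
      funext j
      refine Fin.cases ?_ (fun j => ?_) j
      · simp [Fin.removeNth]
      · simp [Fin.removeNth]
    have h1 : ∀ (b : Sec m n E) (w : Fin k → Sec m n E),
        A.preCartan α b (Fin.cons (fsmul f a) w : Fin (k + 1) → Sec m n E) =
          f * A.preCartan α b (Fin.cons a w : Fin (k + 1) → Sec m n E) +
            (1 / 2 : ℝ) • (A.rho b f * evalSec α (Fin.cons a w : Fin (k + 1) → Sec m n E)) := by
      intro b w
      have c0 : ∀ p q : Sec m n E, update (Fin.cons p w : Fin (k + 1) → Sec m n E) 0 q =
          Fin.cons q w := fun p q => Fin.update_cons_zero _ _ _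
      have hc : ∀ w : Fin k → Sec m n E,
          evalSec α (Fin.cons (fsmul f a) w : Fin (k + 1) → Sec m n E) =
            f * evalSec α (Fin.cons a w : Fin (k + 1) → Sec m n E) := fun w => by
        have := hα (Fin.cons a w : Fin (k + 1) → Sec m n E) 0 f a
        simpa only [Fin.update_cons_zero] using this
      have hb : evalSec α (Fin.cons (A.bracket b (fsmul f a)) w : Fin (k + 1) → Sec m n E) =
          A.rho b f * evalSec α (Fin.cons a w : Fin (k + 1) → Sec m n E) +
            f * evalSec α (Fin.cons (A.bracket b a) w : Fin (k + 1) → Sec m n E) := by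
        rw [bracket_fsmul, ← c0 a, AlternatingMap.map_update_add, hα, hα, c0, c0]
      rw [preCartan_apply, preCartan_apply, Fin.sum_univ_succ, Fin.sum_univ_succ]
      simp only [Fin.cons_zero, Fin.cons_succ, Fin.update_cons_zero, ← Fin.cons_update, hc, hb,
        rho_mul]
      rw [← Finset.mul_sum]
      simp only [smul_add, mul_sub, mul_add, mul_smul_comm]
      have h2 : A.rho b f * evalSec α (Fin.cons a w : Fin (k + 1) → Sec m n E) =
          (1 / 2 : ℝ) • (A.rho b f * evalSec α (Fin.cons a w : Fin (k + 1) → Sec m n E)) +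
          (1 / 2 : ℝ) • (A.rho b f * evalSec α (Fin.cons a w : Fin (k + 1) → Sec m n E)) := by
        rw [← add_smul]; norm_num
      nth_rewrite 1 [h2]
      abel
    have h3 : ∀ j, evalSec α (update v j a) =
        (-1) ^ (j : ℕ) • evalSec α (Fin.cons a (j.removeNth v) : Fin (k + 1) → Sec m n E) := by
      intro j
      rw [← Fin.insertNth_removeNth, AlternatingMap.map_insertNth]
      rfl
    simp only [r1, h1, h3, Fin.val_succ, smul_add, Finset.sum_add_distrib, mul_add,
      Finset.mul_sum, mul_smul_comm, Finset.smul_sum]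
    have h4 : ∀ j : Fin (k + 1), (-1) ^ ((j : ℕ) + 1) • (1 / 2 : ℝ) •
        (A.rho (v j) f * evalSec α (Fin.cons a (j.removeNth v) : Fin (k + 1) → Sec m n E)) =
        -((1 / 2 : ℝ) • (-1) ^ (j : ℕ) •
        (A.rho (v j) f * evalSec α (Fin.cons a (j.removeNth v) : Fin (k + 1) → Sec m n E))) := by
      intro j
      rw [pow_succ, smul_comm (1 / 2 : ℝ)]
      simp
    simp only [h4, Finset.sum_neg_distrib]
    abel

theorem cartanAlt_tensorial {k : ℕ} (α : Form m n E k) : IsTensorial (A.cartanAlt α) := by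
  have h0 : ∀ (Y : Fin (k + 1) → Sec m n E) (f : Fct m M) (a : Sec m n E),
      A.cartanAlt α (update Y 0 (fsmul f a)) = f * A.cartanAlt α (update Y 0 a) := by
    intro Y f a
    have e : ∀ b, update Y 0 b = Fin.cons b (Fin.tail Y) := fun b => by
      rw [← Fin.cons_self_tail Y, Fin.update_cons_zero, Fin.tail_cons]
    rw [e, e, cartanAlt_cons]
  intro X i f a
  rcases eq_or_ne i 0 with rfl | hi
  · exact h0 X f a
  · have e : ∀ b, update X i b = update (X ∘ Equiv.swap i 0) 0 b ∘ Equiv.swap i 0 := by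
      intro b
      funext j
      simp only [comp_apply, update_apply]
      rcases eq_or_ne j i with rfl | hj
      · simp
      · have : Equiv.swap i 0 j ≠ 0 := fun h => hj (by
          rw [Equiv.swap_apply_eq_iff] at h; simpa using h)
        simp [hj, this]
    rw [e, e, AlternatingMap.map_swap _ _ hi, AlternatingMap.map_swap _ _ hi, h0, mul_neg]

variable [ContMDiffVectorBundle ∞ (EuclideanSpace ℝ (Fin n)) E (𝓡 m)] [T2Space M]

/-- The Lie derivative `ℒ_X α` of a form `α` along a section `X`. -/
def lieForm {k : ℕ} (X : Sec m n E) (α : Form m n E k) : Form m n E k :=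
  formOf (A.lieAlt X α) (A.lieAlt_tensorial X α)

/-- The de Rham derivative `d : 𝒜ᵏ(E*) → 𝒜ᵏ⁺¹(E*)` of a skew algebroid, by Cartan's formula. -/
def deRham (k : ℕ) : Form m n E k →ₗ[ℝ] Form m n E (k + 1) where
  toFun α := formOf (A.cartanAlt α) (A.cartanAlt_tensorial α)
  map_add' α β := by
    apply evalSec_injective
    ext1 X
    have hs : ∀ {l : ℕ} (γ δ : Form m n E l) (Z), evalSec (γ + δ) Z = evalSec γ Z + evalSec δ Z :=
      fun _ _ _ => rfl
    rw [hs]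
    simp only [evalSec_formOf, cartanAlt_apply, hs]
    rw [← Finset.sum_add_distrib]
    refine Finset.sum_congr rfl fun i _ => ?_
    rw [← smul_add, map_add, Finset.sum_add_distrib, smul_add]
    congr 1
    abel
  map_smul' c α := by
    apply evalSec_injective
    ext1 X
    have hs : ∀ {l : ℕ} (γ : Form m n E l) (Z), evalSec (c • γ) Z = c • evalSec γ Z :=
      fun _ _ => rfl
    rw [RingHom.id_apply, hs]
    simp only [evalSec_formOf, cartanAlt_apply, hs]
    rw [Finset.smul_sum]
    refine Finset.sum_congr rfl fun i _ => ?_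
    rw [map_smul, ← Finset.smul_sum, smul_comm (1 / 2 : ℝ) c, ← smul_sub, smul_comm]

end SkewAlgebroid
end Algebroid

section Tangent

variable (m : ℕ) (M : Type*) [TopologicalSpace M] [ChartedSpace (EuclideanSpace ℝ (Fin m)) M]
  [IsManifold (𝓡 m) ∞ M]

/-- Vector fields on `M`. -/
abbrev VecField : Type _ := Sec m m (TangentSpace (𝓡 m) : M → Type _)

/-- Differential `k`-forms on `M`. -/
abbrev DForm (k : ℕ) : Type _ := Form m m (TangentSpace (𝓡 m) : M → Type _) k

variable {m M}

theorem vecField_mdiff (V : VecField m M) (x : M) :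
    MDifferentiableAt (𝓡 m) (𝓡 m).tangent (fun y => (⟨y, V y⟩ : TangentBundle (𝓡 m) M)) x :=
  V.contMDiff.mdifferentiableAt (by simp)

variable (m M)

/-- The tangent bundle with the Lie bracket of vector fields and the identity as anchor. -/
def tangentAlgebroid : SkewAlgebroid m m (TangentSpace (𝓡 m) : M → Type _) where
  bracket := LinearMap.mk₂ ℝ
    (fun V W => ⟨VectorField.mlieBracket (𝓡 m) V W,
      haveI : IsManifold (𝓡 m) (((⊤ : ℕ∞) : WithTop ℕ∞) + 1) M := ‹IsManifold (𝓡 m) ∞ M›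
      haveI : IsManifold (𝓡 m) (minSmoothness ℝ 2) M := by
        rw [minSmoothness_of_isRCLikeNormedField]; infer_instance
      ContDiff.mlieBracket_vectorField (m := ⊤) (n := ⊤) V.contMDiff W.contMDiff (by simp)⟩)
    (fun V V' W => by
      ext1 x
      exact VectorField.mlieBracket_add_left (vecField_mdiff V x) (vecField_mdiff V' x))
    (fun c V W => by
      ext1 x
      exact VectorField.mlieBracket_const_smul_left (vecField_mdiff V x))
    (fun V W W' => by
      ext1 x
      exact VectorField.mlieBracket_add_right (vecField_mdiff W x) (vecField_mdiff W' x))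
    (fun c V W => by
      ext1 x
      exact VectorField.mlieBracket_const_smul_right (vecField_mdiff W x))
  bracket_skew V W := by
    ext1 x
    exact VectorField.mlieBracket_swap_apply
  anchor x := LinearMap.id
  anchor_smooth := contMDiff_id
  leibniz V W f x :=
    VectorField.mlieBracket_smul_right (V := V) (fct_mdiff f x) (vecField_mdiff W x)

end Tangent

section Super

variable (m n : ℕ) {M : Type*} [TopologicalSpace M] [ChartedSpace (EuclideanSpace ℝ (Fin m)) M]
  [IsManifold (𝓡 m) ∞ M]
  (E : M → Type*) [∀ x, AddCommGroup (E x)] [∀ x, Module ℝ (E x)] [∀ x, TopologicalSpace (E x)]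
  [TopologicalSpace (TotalSpace (EuclideanSpace ℝ (Fin n)) E)]
  [FiberBundle (EuclideanSpace ℝ (Fin n)) E]

/-- The algebra `𝒜(E*) = ⨁ₖ 𝒜ᵏ(E*)` of functions on the supermanifold `E[1]`, as the families of
homogeneous components (`𝒜ᵏ(E*) = 0` for `k > n`, so the direct sum is a direct product). -/
abbrev SuperFn : Type _ := ∀ k : ℕ, Form m n E k

variable {m n E}

/-- The superfunction with a single homogeneous component. -/
def ofDegree (k : ℕ) (α : Form m n E k) : SuperFn m n E := Pi.single k α

/-- The wedge product of alternating forms on a vector space, normalized by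
`(α ∧ β)(v, w) = α(v) β(w) - α(w) β(v)` for `1`-forms. -/
def wedgeAlt {V : Type*} [AddCommGroup V] [Module ℝ V] {k l p : ℕ} (h : k + l = p)
    (a : V [⋀^Fin k]→ₗ[ℝ] ℝ) (b : V [⋀^Fin l]→ₗ[ℝ] ℝ) : V [⋀^Fin p]→ₗ[ℝ] ℝ :=
  ((LinearMap.mul' ℝ ℝ).compAlternatingMap (a.domCoprod b)).domDomCongr
    (finSumFinEquiv.trans (finCongr h))

/-- The wedge product of forms. -/
def wedge {k l p : ℕ} (h : k + l = p) (α : Form m n E k) (β : Form m n E l) : Form m n E p :=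
  ⟨fun x => wedgeAlt h (α.1 x) (β.1 x), fun X => by
    have e : ∀ x, wedgeAlt h (α.1 x) (β.1 x) (fun i => X i x) =
        ∑ σ : Equiv.Perm.ModSumCongr (Fin k) (Fin l), LinearMap.mul' ℝ ℝ
          (AlternatingMap.domCoprod.summand (α.1 x) (β.1 x) σ
            fun i => X (finCongr h (finSumFinEquiv i)) x) := by
      intro x
      rw [← map_sum, ← sum_apply]
      rfl
    simp only [e]
    refine contMDiff_finsetSum fun σ _ => ?_
    induction σ using Quotient.inductionOn' with
    | h σ =>
      simp only [AlternatingMap.domCoprod.summand_mk'']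
      have hs := (contMDiff_const (c := (((Equiv.Perm.sign σ : ℤˣ) : ℤ) : ℝ)) (I := 𝓡 m)
        (I' := 𝓘(ℝ, ℝ)) (n := ∞) (M := M)).mul
        ((α.2 fun i => X (finCongr h (finSumFinEquiv (σ (Sum.inl i))))).mul
          (β.2 fun i => X (finCongr h (finSumFinEquiv (σ (Sum.inr i))))))
      refine hs.congr fun x => ?_
      rw [Units.smul_def, smul_apply, map_zsmul, zsmul_eq_mul]
      rfl⟩

/-- The product of superfunctions. -/
def superMul (g f : SuperFn m n E) : SuperFn m n E := fun p =>
  ∑ q ∈ (Finset.HasAntidiagonal.antidiagonal p).attach,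
    wedge (Finset.HasAntidiagonal.mem_antidiagonal.1 q.2) (g q.1.1) (f q.1.2)

variable (m n E) in
/-- The fibre at `x` of the line bundle `L^E = ⋀ⁿ E ⊗ ⋀ᵐ T*M`. -/
abbrev LFib (x : M) : Type _ := (⋀[ℝ]^n (E x)) ⊗[ℝ] (TangentSpace (𝓡 m) x [⋀^Fin m]→ₗ[ℝ] ℝ)

/-- The section `(Y₁ ∧ … ∧ Yₙ) ⊗ μ` of `L^E`. -/
def decomp (Y : Fin n → Sec m n E) (μ : DForm m M m) (x : M) : LFib m n E x :=
  exteriorPower.ιMulti ℝ n (fun i => Y i x) ⊗ₜ[ℝ] μ.1 x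

/-- Smoothness of a section of `L^E` over the open set `U`. As `L^E` is a line bundle, a section is
smooth if and only if near every point it is of the form `(Y₁ ∧ … ∧ Yₙ) ⊗ μ` with smooth factors,
and by a cut-off these factors can be taken globally defined. -/
def IsSmoothL (U : Set M) (σ : ∀ x, LFib m n E x) : Prop :=
  ∀ x ∈ U, ∃ (Y : Fin n → Sec m n E) (μ : DForm m M m), ∀ᶠ y in 𝓝 x, σ y = decomp Y μ y

/-- Two vectors are identified if they agree up to sign. -/
def absSetoid (L : Type*) [AddCommGroup L] : Setoid L where
  r a b := a = b ∨ a = -b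
  iseqv := by
    refine ⟨fun a => Or.inl rfl, ?_, ?_⟩
    · rintro a b (h | h)
      · exact Or.inl h.symm
      · exact Or.inr (by rw [h, neg_neg])
    · rintro a b c (rfl | rfl) (rfl | rfl)
      · exact Or.inl rfl
      · exact Or.inr rfl
      · exact Or.inr rfl
      · exact Or.inl (neg_neg _)

/-- The quotient `|L| = L / ℤ₂`. -/
def Abs (L : Type*) [AddCommGroup L] : Type _ := Quotient (absSetoid L)

/-- The class `|a|` of a vector up to sign. -/
def Abs.mk {L : Type*} [AddCommGroup L] (a : L) : Abs L := Quotient.mk (absSetoid L) a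

variable (m n E) in
/-- A nowhere-vanishing section `|σ|` of `|L^E|`: a section that is represented near every point by
a smooth local section of `L^E`, unique up to sign, and has no zeros. -/
structure AbsSection where
  toFun : ∀ x, Abs (LFib m n E x)
  smooth : ∀ x, ∃ (U : Set M) (σ : ∀ y, LFib m n E y), IsOpen U ∧ x ∈ U ∧ IsSmoothL U σ ∧
    ∀ y ∈ U, toFun y = Abs.mk (σ y)
  ne_zero : ∀ x, toFun x ≠ Abs.mk 0

/-- `σ` is a smooth local representative over `U` of the section `|σ|` of `|L^E|`. -/
def AbsSection.IsRep (s : AbsSection m n E) (U : Set M) (σ : ∀ x, LFib m n E x) : Prop :=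
  IsSmoothL U σ ∧ ∀ x ∈ U, s.toFun x = Abs.mk (σ x)

/-- Contraction of a section of `⋀ⁿ E ⊗ ⋀ᵐ T*M` with an `n`-form on `E`. -/
def contractL {x : M} (a : E x [⋀^Fin n]→ₗ[ℝ] ℝ) :
    LFib m n E x →ₗ[ℝ] TangentSpace (𝓡 m) x [⋀^Fin m]→ₗ[ℝ] ℝ :=
  (TensorProduct.lid ℝ (TangentSpace (𝓡 m) x [⋀^Fin m]→ₗ[ℝ] ℝ)).toLinearMap ∘ₗ
    LinearMap.rTensor (TangentSpace (𝓡 m) x [⋀^Fin m]→ₗ[ℝ] ℝ)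
      (exteriorPower.alternatingMapLinearEquiv a)

variable (m n E) in
/-- Operators from superfunctions on `E[1]` to `m`-forms on `M`; Berezinian sections are represented
by such (differential) operators. -/
abbrev BerOp : Type _ := SuperFn m n E → ∀ x : M, TangentSpace (𝓡 m) x [⋀^Fin m]→ₗ[ℝ] ℝ

/-- The operator `S(σ)` of a section `σ` of `L^E`. For `σ = (eₙ ∧ … ∧ e₁) ⊗ μ` it is
`f ↦ (i_{eₙ} ∘ … ∘ i_{e₁} f) μ = f(e₁, …, eₙ) μ`, that is, `μ ⊗ ∂_{yⁿ} ∘ … ∘ ∂_{y¹}`; the components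
of `f` in degrees other than `n` do not contribute. The reversal of the order accounts for the order
of the factors of `σ`. -/
def berS (σ : ∀ x, LFib m n E x) : BerOp m n E := fun f x =>
  contractL (((f n).1 x).domDomCongr Fin.revPerm) (σ x)

/-- The integral of an `m`-form with support in the chart domain at `x₀`, in the coordinates of that
chart. -/
def chartIntegral (x₀ : M) (η : ∀ x : M, TangentSpace (𝓡 m) x [⋀^Fin m]→ₗ[ℝ] ℝ) : ℝ :=
  ∫ u in (chartAt (EuclideanSpace ℝ (Fin m)) x₀).target,
    η ((chartAt (EuclideanSpace ℝ (Fin m)) x₀).symm u) fun a =>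
      mfderiv (𝓡 m) (𝓡 m) (chartAt (EuclideanSpace ℝ (Fin m)) x₀).symm u
        (EuclideanSpace.single a (1 : ℝ) : EuclideanSpace ℝ (Fin m))

/-- The superfunction `f` has compact support contained in `U`. -/
def SupportedIn (U : Set M) (f : SuperFn m n E) : Prop :=
  ∃ K : Set M, IsCompact K ∧ K ⊆ U ∧ ∀ x ∉ K, ∀ k, (f k).1 x = 0

/-- Two operators represent the same section of the Berezinian sheaf over an open subset `U` of the
chart domain at `x₀`: they have the same Berezin integrals against all superfunctions with compact
support in `U` (their difference takes such superfunctions to differentials of compactly supported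
`(m-1)`-forms). -/
def BerEq (x₀ : M) (U : Set M) (P Q : BerOp m n E) : Prop :=
  ∀ f : SuperFn m n E, SupportedIn U f → chartIntegral x₀ (P f) = chartIntegral x₀ (Q f)

/-- The right module structure of Berezinian sections: `(s · g)(f) = s(g f)`. -/
def berMul (P : BerOp m n E) (g : SuperFn m n E) : BerOp m n E := fun f => P (superMul g f)

/-- The Lie derivative `ℒ_X s = -(-1)^(|X||s|) s ∘ X`. -/
def berLie (degX degS : ℕ) (X : SuperFn m n E → SuperFn m n E) (P : BerOp m n E) : BerOp m n E :=
  fun f => -(-1 : ℝ) ^ (degX * degS) • P (X f)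

/-- `g` is the superdivergence `div_{|s|}(X)` of the vector field `X` of degree `degX` on `E[1]` with
respect to the Berezinian `1`-density `|s| = S(|σ|)`: for every local representative `σ` of `|σ|`,
the local Berezinian volume `s = S(σ)`, of degree `n` modulo `2`, satisfies
`ℒ_X s = (-1)^(|X||s|) s · g`. -/
def IsSuperdiv (s : AbsSection m n E) (degX : ℕ) (X : SuperFn m n E → SuperFn m n E)
    (g : SuperFn m n E) : Prop :=
  ∀ (x₀ : M) (U : Set M), IsOpen U → U ⊆ (chartAt (EuclideanSpace ℝ (Fin m)) x₀).source →
    ∀ σ : ∀ x, LFib m n E x, s.IsRep U σ →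
      BerEq x₀ U (berLie degX n X (berS σ))
        (fun f => (-1 : ℝ) ^ (degX * n) • berMul (berS σ) g f)

variable [VectorBundle ℝ (EuclideanSpace ℝ (Fin n)) E]
  [ContMDiffVectorBundle ∞ (EuclideanSpace ℝ (Fin n)) E (𝓡 m)] [T2Space M]

namespace SkewAlgebroid

variable (A : SkewAlgebroid m n E)

/-- The de Rham vector field on `E[1]`, of degree `1`. -/
def deRhamField (f : SuperFn m n E) : SuperFn m n E
  | 0 => 0
  | k + 1 => A.deRham k (f k)

/-- The canonical connection on `L^E`:
`∇_X (Y ⊗ μ) = ℒ_X Y ⊗ μ + Y ⊗ ℒ_{ρ(X)} μ`, where `Y = Y₁ ∧ … ∧ Yₙ` and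
`ℒ_X Y = ∑ᵢ Y₁ ∧ … ∧ [X, Yᵢ] ∧ … ∧ Yₙ`. -/
def nabla (X : Sec m n E) (Y : Fin n → Sec m n E) (μ : DForm m M m) (x : M) : LFib m n E x :=
  (∑ i, exteriorPower.ιMulti ℝ n (update (fun j => Y j x) i (A.bracket X (Y i) x))) ⊗ₜ[ℝ] μ.1 x +
    exteriorPower.ιMulti ℝ n (fun j => Y j x) ⊗ₜ[ℝ]
      ((tangentAlgebroid m M).lieForm (A.anchorSec X) μ).1 x

/-- `φ` is the modular form of the section `|σ|` of `|L^E|`: `∇_X σ = ⟨X, φ⟩ σ` for all sections `X`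
and all local representatives `σ = (Y₁ ∧ … ∧ Yₙ) ⊗ μ` of `|σ|`. -/
def IsModularForm (s : AbsSection m n E) (φ : Form m n E 1) : Prop :=
  ∀ (U : Set M) (Y : Fin n → Sec m n E) (μ : DForm m M m), IsOpen U → s.IsRep U (decomp Y μ) →
    ∀ (X : Sec m n E), ∀ x ∈ U, A.nabla X Y μ x = φ.1 x (fun _ => X x) • decomp Y μ x

/-- The subspace `d 𝒜⁰(E*)` of `𝒜¹(E*)`. -/
def exactForms : AddSubgroup (Form m n E 1) :=
  (LinearMap.range (A.deRham 0) : Submodule ℝ (Form m n E 1)).toAddSubgroup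

/-- The quotient `𝒜¹(E*) / d 𝒜⁰(E*)`. -/
abbrev FormClass : Type _ := Form m n E 1 ⧸ A.exactForms

/-- The class of a `1`-form modulo the forms `df`. -/
def toClass (φ : Form m n E 1) : A.FormClass := QuotientAddGroup.mk φ

/-- `c` is the modular class: the class of the modular form of a nowhere-vanishing section of
`|L^E|`. -/
def IsModularClass (c : A.FormClass) : Prop :=
  ∃ (s : AbsSection m n E) (φ : Form m n E 1), A.IsModularForm s φ ∧ A.toClass φ = c

end SkewAlgebroid

end Super

end SkewAlg

end

/-! The superdivergence of the de Rham vector field `d` with respect to `S(|σ|)` is the modular form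
`φ` of `|σ|` itself, not merely a representative of its class. After cancellation of signs the claim
is that, for every `α` of degree `n - 1` with compact support in a small open set, the `m`-form
`S(σ)(dα + φ ∧ α)` has integral zero. In a neighbourhood where `σ = (Y₁ ∧ … ∧ Yₙ) ⊗ μ`, take the top
form `ν` with `ν(Y) = 1` and write `α = i_X ν` (`exists_contract_eq`). Three identities hold there.
Since `dν = 0` for reasons of degree, Cartan's formula gives `dα = ℒ_X ν` (`cartanAlt_contract`);
neither `d² = 0` nor the Jacobi identity is involved. Since `φ ∧ ν = 0`, `φ ∧ α = φ(X) ν`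
(`wedge_one_apply_of_eq_contract`). Finally `∇_X σ = φ(X) σ`, paired with `ν`, reads `ℒ_{ρ(X)} μ =
((ℒ_X ν)(Y) + φ(X)) μ`. Hence `S(σ)(dα + φ ∧ α)` is, up to the constant sign `revSign n`, the Lie
derivative `ℒ_{ρ(X)} μ`, which in coordinates is a divergence (`lieAlt_coord`). The section `X` is
only local, but the `i`-th component of `ρ(X)` times `μ` is, up to the same sign, `S(σ)(dξᵢ ∧ α)`
for the coordinate `ξᵢ`. These forms are globally defined with compact support, so the integral of
the divergence vanishes without a partition of unity (`chartIntegral_deRham_add_modularForm`).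

Uniqueness of the superdivergence is the fundamental lemma of the calculus of variations, combined
with the nondegeneracy of the wedge pairing between degrees `k` and `n - k`
(`exists_wedgeAlt_ne_zero`). All components of the superdivergence are therefore determined, so it
is homogeneous of degree 1.

The modular class rests on three facts. The connection is well defined and linear over functions in
`X`: identities in the line bundle `L^E` are checked in a scalar coordinate `pairL`, and the two
derivatives of `f` in `∇_{fX}` cancel. Two nowhere-vanishing sections of `|L^E|` have a positive
smooth ratio `r`, and their modular forms differ by `d log r` (`toClass_modularForm_eq`). Sections
of `|L^E|` without zeros exist because squares of local sections can be added with a partition of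
unity, and a positive square in a line has a root up to sign (`nonempty_absSection`). -/

noncomputable section

namespace SkewAlg

/-! ### Alternating forms on a finite-dimensional vector space -/

section LinearAlgebra

variable {V : Type*} [AddCommGroup V] [Module ℝ V]

/-- The wedge product is a sum over cosets of permutations. Multiplied by `k! l!` it becomes a sum
over all permutations, with no choice of representatives, and this is the form used in every
computation below. -/
theorem wedgeAlt_mul_factorial {k l p : ℕ} (h : k + l = p) (a : V [⋀^Fin k]→ₗ[ℝ] ℝ)
    (b : V [⋀^Fin l]→ₗ[ℝ] ℝ) (v : Fin p → V) :
    (k.factorial * l.factorial : ℝ) * wedgeAlt h a b v =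
      ∑ σ : Equiv.Perm (Fin k ⊕ Fin l), ((Equiv.Perm.sign σ : ℤ) : ℝ) *
        (a (fun i => v (finCongr h (finSumFinEquiv (σ (Sum.inl i))))) *
          b (fun i => v (finCongr h (finSumFinEquiv (σ (Sum.inr i)))))) := by
  have e := congrArg (fun D => LinearMap.mul' ℝ ℝ
    (D fun i => v (finCongr h (finSumFinEquiv i)))) (MultilinearMap.domCoprod_alternization_eq a b)
  simp only [MultilinearMap.alternatization_apply, map_sum, Fintype.card_fin,
    AlternatingMap.smul_apply, map_nsmul] at e
  rw [nsmul_eq_mul] at e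
  push_cast at e
  refine Eq.trans ?_ (e.symm.trans ?_)
  · rfl
  · refine Finset.sum_congr rfl fun σ _ => ?_
    rw [Units.smul_def, map_zsmul, zsmul_eq_mul]
    rfl

/-- A permutation of `Fin (k + 1)` is a pair of the image `p` of `0` and a permutation `τ` of the
other places. The `k!` choices of `τ` contribute equally, which cancels the factorial. -/
theorem wedgeAlt_one_apply {k : ℕ} (h : 1 + k = k + 1) (θ : V [⋀^Fin 1]→ₗ[ℝ] ℝ)
    (a : V [⋀^Fin k]→ₗ[ℝ] ℝ) (v : Fin (k + 1) → V) :
    wedgeAlt h θ a v =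
      ∑ j : Fin (k + 1), (-1) ^ (j : ℕ) * (θ (fun _ => v j) * a (j.removeNth v)) := by
  have hk : (k.factorial : ℝ) ≠ 0 := by positivity
  apply mul_left_cancel₀ hk
  have e := wedgeAlt_mul_factorial h θ a v
  rw [Nat.factorial_one, Nat.cast_one, one_mul] at e
  rw [e]
  let q : Fin 1 ⊕ Fin k ≃ Fin (k + 1) := finSumFinEquiv.trans (finCongr h)
  have q0 : ∀ i, q (Sum.inl i) = 0 := fun i => by
    ext; simp [q]
  have q1 : ∀ i, q (Sum.inr i) = Fin.succ i := fun i => by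
    ext; simp [q]
  rw [← Equiv.sum_comp (q.permCongr.trans Equiv.Perm.decomposeFin).symm, Fintype.sum_prod_type,
    Finset.mul_sum]
  refine Finset.sum_congr rfl fun p _ => ?_
  have hs : ∀ τ : Equiv.Perm (Fin k), Equiv.Perm.sign
      ((q.permCongr.trans Equiv.Perm.decomposeFin).symm (p, τ)) =
      ite (p = 0) 1 (-1) * Equiv.Perm.sign τ := fun τ => by
    rw [← Equiv.Perm.decomposeFin.symm_sign]
    refine Eq.trans ?_ (Equiv.Perm.sign_permCongr q.symm _)
    rfl
  have hq : ∀ (τ : Equiv.Perm (Fin k)) i, finCongr h (finSumFinEquiv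
      (((q.permCongr.trans Equiv.Perm.decomposeFin).symm (p, τ)) i)) =
      Equiv.Perm.decomposeFin.symm (p, τ) (q i) := fun τ i => by
    change q (q.symm _) = _
    simp
  have ha : ∀ τ : Equiv.Perm (Fin k), a (fun i => v (Equiv.swap 0 p (τ i).succ)) =
      ((Equiv.Perm.sign τ : ℤ) : ℝ) * a fun i => v (Equiv.swap 0 p i.succ) := fun τ => by
    have := a.map_perm (fun i => v (Equiv.swap 0 p i.succ)) τ
    rw [Units.smul_def, zsmul_eq_mul] at this
    exact this
  -- For `p = j + 1` the swap puts `v 0` in slot `j` of the tail, while `p.removeNth v` has it in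
  -- front. Moving it costs `(-1)^j`, and the sign of the swap supplies the missing factor.
  have hr : ((ite (p = 0) 1 (-1) : ℤˣ) : ℤ) * a (fun i => v (Equiv.swap 0 p i.succ)) =
      (-1) ^ (p : ℕ) * a (p.removeNth v) := by
    rcases Fin.eq_zero_or_eq_succ p with rfl | ⟨j, rfl⟩
    · simp only [Equiv.swap_self, Equiv.refl_apply, if_true, Fin.removeNth_zero]
      simp [Fin.tail_def]
    · have e1 : (fun i => v (Equiv.swap 0 j.succ i.succ)) = update (Fin.tail v) j (v 0) := by
        funext i
        rcases eq_or_ne i j with rfl | hij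
        · simp
        · rw [Equiv.swap_apply_of_ne_of_ne (Fin.succ_ne_zero _) (by simpa using hij)]
          simp [hij, Fin.tail]
      cases k with
      | zero => exact j.elim0
      | succ k =>
        have e2 : j.succ.removeNth v = Fin.cons (v 0) (j.removeNth (Fin.tail v)) := by
          funext i
          refine Fin.cases ?_ (fun i => ?_) i
          · simp [Fin.removeNth]
          · simp [Fin.removeNth, Fin.tail]
        rw [e1, e2, ← Fin.insertNth_removeNth, AlternatingMap.map_insertNth]
        simp only [Fin.succ_ne_zero, if_false, Fin.val_succ, pow_succ, zsmul_eq_mul]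
        push_cast
        ring_nf
        rfl
  have ht : ∀ τ : Equiv.Perm (Fin k), ((Equiv.Perm.sign τ : ℤ) : ℝ) *
      ((Equiv.Perm.sign τ : ℤ) : ℝ) = 1 := fun τ => by
    rw [← Int.cast_mul, ← Units.val_mul, ← sq, Int.units_sq]; simp
  have key : ∀ τ : Equiv.Perm (Fin k), (((ite (p = 0) 1 (-1) * Equiv.Perm.sign τ : ℤˣ) : ℤ) : ℝ) *
      (θ (fun _ => v p) * a (fun i => v (Equiv.swap 0 p (τ i).succ))) =
      (-1) ^ (p : ℕ) * (θ (fun _ => v p) * a (p.removeNth v)) := fun τ => by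
    rw [ha]
    push_cast
    linear_combination (θ fun _ => v p) * hr +
      ((ite (p = 0) 1 (-1) : ℤˣ) : ℤ) * (θ fun _ => v p) *
        a (fun i => v (Equiv.swap 0 p i.succ)) * ht τ
  simp only [hs, hq, q0, q1, Equiv.Perm.decomposeFin_symm_apply_zero,
    Equiv.Perm.decomposeFin_symm_apply_succ, key]
  simp [Fintype.card_perm]

/-- A nonzero form is nonzero on some injective tuple of vectors of any given basis; that basis is
then reindexed so that this tuple comes first. -/
theorem exists_basis_sum {n k l : ℕ} (h : k + l = n) (hV : Module.finrank ℝ V = n)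
    [FiniteDimensional ℝ V] {a : V [⋀^Fin k]→ₗ[ℝ] ℝ} (ha : a ≠ 0) :
    ∃ e : Module.Basis (Fin k ⊕ Fin l) ℝ V, a (fun i => e (Sum.inl i)) ≠ 0 := by
  let e₀ := Module.finBasisOfFinrankEq ℝ V hV
  obtain ⟨r, hr, hne⟩ : ∃ r : Fin k → Fin n, Injective r ∧ a (fun i => e₀ (r i)) ≠ 0 := by
    by_contra! hc
    exact ha (e₀.ext_alternating fun r hr => by simpa using hc r hr)
  have hcard : Fintype.card (Fin l) = Fintype.card ↥(Set.range r)ᶜ := by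
    rw [Fintype.card_compl_set, Set.card_range_of_injective hr]
    simp; omega
  let q : Fin k ⊕ Fin l ≃ Fin n :=
    (Equiv.sumCongr (Equiv.ofInjective r hr) (Fintype.equivOfCardEq hcard)).trans
      (Equiv.Set.sumCompl (Set.range r))
  refine ⟨e₀.reindex q.symm, ?_⟩
  simpa [q] using hne

/-- Nondegeneracy of the wedge pairing into top degree. If `a` is nonzero on the first block of a
basis and `b` is the determinant in the coordinates of the second block, only permutations
preserving the blocks contribute, all with the same sign. -/
theorem exists_wedgeAlt_ne_zero {n k l : ℕ} (h : k + l = n) (hV : Module.finrank ℝ V = n)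
    [FiniteDimensional ℝ V] {a : V [⋀^Fin k]→ₗ[ℝ] ℝ} (ha : a ≠ 0) :
    ∃ b : V [⋀^Fin l]→ₗ[ℝ] ℝ, wedgeAlt h a b ≠ 0 := by
  obtain ⟨e, he⟩ := exists_basis_sum h hV ha
  let q : Fin k ⊕ Fin l ≃ Fin n := finSumFinEquiv.trans (finCongr h)
  let b : V [⋀^Fin l]→ₗ[ℝ] ℝ := (Matrix.detRowAlternating (n := Fin l) (R := ℝ)).compLinearMap
    (LinearMap.pi fun i => e.coord (Sum.inr i))
  have hb : b (fun i => e (Sum.inr i)) = 1 := by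
    change Matrix.det (fun i j => e.coord (Sum.inr j) (e (Sum.inr i))) = 1
    have : (fun i j => e.coord (Sum.inr j) (e (Sum.inr i))) = (1 : Matrix (Fin l) (Fin l) ℝ) := by
      ext i j
      simp [Matrix.one_apply, Finsupp.single_apply]
    rw [this, Matrix.det_one]
  refine ⟨b, fun h0 => ?_⟩
  have e1 := wedgeAlt_mul_factorial h a b (fun i => e (q.symm i))
  rw [h0, AlternatingMap.zero_apply, mul_zero] at e1
  have hq : ∀ i, q.symm (finCongr h (finSumFinEquiv i)) = i := fun i => q.symm_apply_apply i
  simp only [hq] at e1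
  -- Multiplied by `a(e₁, …, e_k)`, the term of a block-preserving permutation is a square, as the
  -- signs cancel. If some vector of the second block leaves it, the determinant `b` has a zero row.
  -- The identity permutation makes the sum positive.
  have hT : ∀ σ : Equiv.Perm (Fin k ⊕ Fin l),
      0 ≤ a (fun i => e (Sum.inl i)) * (((Equiv.Perm.sign σ : ℤ) : ℝ) *
        (a (fun i => e (σ (Sum.inl i))) * b (fun i => e (σ (Sum.inr i))))) := by
    intro σ
    by_cases hσ : Set.MapsTo σ (Set.range Sum.inr) (Set.range Sum.inr)
    · have hσ' : Set.MapsTo σ (Set.range (Sum.inl : Fin k → Fin k ⊕ Fin l)) (Set.range Sum.inl) := by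
        -- A permutation that maps the finite second block into itself does so surjectively, hence
        -- it preserves the first block as well.
        choose υ hυ using fun i : Fin l => hσ ⟨i, rfl⟩
        have hsurj : Surjective υ := Finite.surjective_of_injective fun i j hij => by
          simpa using σ.injective ((hυ i).symm.trans ((congrArg Sum.inr hij).trans (hυ j)))
        rintro _ ⟨i, rfl⟩
        rcases hi : σ (Sum.inl i) with j | j
        · exact ⟨j, rfl⟩
        · obtain ⟨i', hi'⟩ := hsurj j
          exact absurd (σ.injective ((hυ i').symm.trans ((congrArg Sum.inr hi').trans hi.symm)))
            (by simp)
      obtain ⟨⟨τ, υ⟩, rfl⟩ := Equiv.Perm.mem_sumCongrHom_range_of_perm_mapsTo_inl hσ'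
      have e2 := a.map_perm (fun i => e (Sum.inl i)) τ
      have e3 := b.map_perm (fun i => e (Sum.inr i)) υ
      rw [Units.smul_def, zsmul_eq_mul] at e2 e3
      simp only [Equiv.Perm.sumCongrHom_apply, Equiv.Perm.sumCongr_apply, Sum.map_inl,
        Sum.map_inr, Equiv.Perm.sign_sumCongr]
      simp only [Function.comp_def] at e2 e3
      rw [e2, e3, hb]
      have ht : ∀ {j : ℕ} (τ : Equiv.Perm (Fin j)), ((Equiv.Perm.sign τ : ℤ) : ℝ) *
          ((Equiv.Perm.sign τ : ℤ) : ℝ) = 1 := fun τ => by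
        rw [← Int.cast_mul, ← Units.val_mul, ← sq, Int.units_sq]; simp
      have : a (fun i => e (Sum.inl i)) *
          (((Equiv.Perm.sign τ * Equiv.Perm.sign υ : ℤˣ) : ℤ) *
            (((Equiv.Perm.sign τ : ℤ) : ℝ) * a (fun i => e (Sum.inl i)) *
              (((Equiv.Perm.sign υ : ℤ) : ℝ) * 1))) = a (fun i => e (Sum.inl i)) ^ 2 := by
        push_cast
        linear_combination a (fun i => e (Sum.inl i)) ^ 2 * ht τ * ((Equiv.Perm.sign υ : ℤ) : ℝ) ^ 2
          + a (fun i => e (Sum.inl i)) ^ 2 * ht υ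
      rw [this]
      positivity
    · have : b (fun i => e (σ (Sum.inr i))) = 0 := by
        simp only [Set.MapsTo, Set.mem_range, forall_exists_index, forall_apply_eq_imp_iff,
          not_forall] at hσ
        obtain ⟨i, hi⟩ := hσ
        rcases hj : σ (Sum.inr i) with j | j
        · refine Matrix.det_eq_zero_of_row_eq_zero i fun j' => ?_
          change e.coord (Sum.inr j') (e (σ (Sum.inr i))) = 0
          simp [hj]
        · exact absurd ⟨j, hj.symm⟩ hi
      simp [this]
  have hpos : 0 < ∑ σ : Equiv.Perm (Fin k ⊕ Fin l),
      a (fun i => e (Sum.inl i)) * (((Equiv.Perm.sign σ : ℤ) : ℝ) *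
        (a (fun i => e (σ (Sum.inl i))) * b (fun i => e (σ (Sum.inr i))))) := by
    refine Finset.sum_pos' (fun σ _ => hT σ) ⟨1, Finset.mem_univ _, ?_⟩
    simp only [Equiv.Perm.sign_one, Equiv.Perm.coe_one, id, hb]
    have := mul_self_pos.2 he
    simpa using this
  rw [← Finset.mul_sum, ← e1, mul_zero] at hpos
  exact lt_irrefl _ hpos

theorem alternating_eq_zero_of_finrank_lt {N : Type*} [AddCommGroup N] [Module ℝ N]
    [FiniteDimensional ℝ V] [Module.IsTorsionFree ℝ N] {k : ℕ}
    (hk : Module.finrank ℝ V < k) (a : V [⋀^Fin k]→ₗ[ℝ] N) : a = 0 := by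
  ext v
  refine a.map_linearDependent v fun hv => ?_
  have := hv.fintype_card_le_finrank
  simp at this
  omega

/-- A form of top degree `ν` satisfies `∑ⱼ (-1)ʲ θ(vⱼ) ν(x, …, v̂ⱼ, …) = θ(x) ν(v)`. -/
theorem sum_removeNth_cons {k : ℕ} [FiniteDimensional ℝ V] (hV : Module.finrank ℝ V = k + 1)
    (ν : V [⋀^Fin (k + 1)]→ₗ[ℝ] ℝ) (θ : V →ₗ[ℝ] ℝ) (x : V) (v : Fin (k + 1) → V) :
    ∑ j : Fin (k + 1), (-1) ^ (j : ℕ) *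
      (θ (v j) * ν (Fin.cons x (j.removeNth v) : Fin (k + 1) → V)) = θ x * ν v := by
  -- `D` is `θ ∧ ν`, of degree above the dimension. Its vanishing on `(x, v₀, …, v_k)` is the
  -- identity.
  let D : V [⋀^Fin (k + 2)]→ₗ[ℝ] ℝ := AlternatingMap.alternatizeUncurryFin (θ.smulRight ν)
  have h0 : D (Fin.cons x v) = 0 := by
    rw [alternating_eq_zero_of_finrank_lt (by omega) D]; rfl
  have r1 : ∀ i : Fin (k + 1), Fin.removeNth i.succ (Fin.cons x v : Fin (k + 2) → V) =
      Fin.cons x (i.removeNth v) := fun i => by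
    funext j
    refine Fin.cases ?_ (fun j => ?_) j
    · simp [Fin.removeNth]
    · simp [Fin.removeNth]
  have r0 : Fin.removeNth 0 (Fin.cons x v : Fin (k + 2) → V) = v := Fin.removeNth_zero _
  simp only [D, AlternatingMap.alternatizeUncurryFin_apply] at h0
  rw [Fin.sum_univ_succ] at h0
  simp only [r0, r1, Fin.cons_zero, Fin.cons_succ, Fin.val_succ, LinearMap.smulRight_apply,
    AlternatingMap.smul_apply, Fin.val_zero, pow_zero, one_smul, zsmul_eq_mul, smul_eq_mul] at h0
  push_cast at h0
  simp only [pow_succ, mul_neg, mul_one, neg_mul, Finset.sum_neg_distrib] at h0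
  linarith

theorem update_eq_removeNth {k : ℕ} (ν : V [⋀^Fin (k + 1)]→ₗ[ℝ] ℝ) (x : V) (v : Fin (k + 1) → V)
    (j : Fin (k + 1)) :
    ν (update v j x) = (-1) ^ (j : ℕ) * ν (Fin.cons x (j.removeNth v) : Fin (k + 1) → V) := by
  rw [← Fin.insertNth_removeNth, AlternatingMap.map_insertNth, zsmul_eq_mul]
  push_cast
  rfl

/-- The preceding identity with `x` inserted in the `j`-th place, where moving it to the front
produces the sign. It computes the correction term of `ℒ_{fX}` on top forms. -/
theorem sum_update {n : ℕ} [FiniteDimensional ℝ V] (hV : Module.finrank ℝ V = n)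
    (ν : V [⋀^Fin n]→ₗ[ℝ] ℝ) (θ : V →ₗ[ℝ] ℝ) (x : V) (v : Fin n → V) :
    ∑ j, θ (v j) * ν (update v j x) = θ x * ν v := by
  cases n with
  | zero =>
    have : Subsingleton V := Module.finrank_zero_iff.1 hV
    simp [Subsingleton.elim x 0]
  | succ k =>
    rw [← sum_removeNth_cons hV]
    refine Finset.sum_congr rfl fun j _ => ?_
    rw [update_eq_removeNth]
    ring

/-- Every alternating map of top degree is a multiple of the determinant. The values are taken in an
arbitrary `N` so that the universal map into `⋀ⁿ V` is covered. -/
theorem alternating_mul_comm {n : ℕ} [FiniteDimensional ℝ V] (hV : Module.finrank ℝ V = n)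
    {N : Type*} [AddCommGroup N] [Module ℝ N]
    (ν : V [⋀^Fin n]→ₗ[ℝ] ℝ) (η : V [⋀^Fin n]→ₗ[ℝ] N) (v u : Fin n → V) :
    ν v • η u = ν u • η v := by
  let e := Module.finBasisOfFinrankEq ℝ V hV
  have h : ∀ u, η u = e.det u • η e := fun u => by
    have : η = (LinearMap.toSpanSingleton ℝ N (η e)).compAlternatingMap e.det := by
      refine e.ext_alternating fun r hr => ?_
      obtain ⟨σ, rfl⟩ : ∃ σ : Equiv.Perm (Fin n), r = σ :=
        ⟨Equiv.ofBijective r (Finite.injective_iff_bijective.1 hr), rfl⟩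
      have e1 := η.map_perm e σ
      have e2 := e.det.map_perm e σ
      simp only [Function.comp_def] at e1 e2
      rw [e1, LinearMap.compAlternatingMap_apply, e2, e.det_self]
      simp only [LinearMap.toSpanSingleton_apply, Units.smul_def, zsmul_eq_mul, mul_one]
      rw [Int.cast_smul_eq_zsmul]
    conv_lhs => rw [this]
    rfl
  rw [h u, h v, ν.eq_smul_basis_det e]
  simp only [AlternatingMap.smul_apply, smul_smul, smul_eq_mul]
  congr 1
  ring

theorem exists_alternating_ne_zero {n : ℕ} [FiniteDimensional ℝ V] (hV : Module.finrank ℝ V = n) :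
    ∃ (ν : V [⋀^Fin n]→ₗ[ℝ] ℝ) (v : Fin n → V), ν v = 1 :=
  ⟨(Module.finBasisOfFinrankEq ℝ V hV).det, _, Module.Basis.det_self _⟩

/-- If `ν v = 1` for a form `ν` of top degree, every form `a` of one degree less is the contraction
of `ν` with `∑ⱼ (-1)ʲ a(…, v̂ⱼ, …) vⱼ`. -/
theorem eq_contraction {k : ℕ} [FiniteDimensional ℝ V] (hV : Module.finrank ℝ V = k + 1)
    (ν : V [⋀^Fin (k + 1)]→ₗ[ℝ] ℝ) (v : Fin (k + 1) → V) (hv : ν v = 1)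
    (a : V [⋀^Fin k]→ₗ[ℝ] ℝ) :
    a = ν.curryLeft (∑ j : Fin (k + 1), ((-1) ^ (j : ℕ) * a (j.removeNth v)) • v j) := by
  -- A top form vanishes on dependent vectors, so `ν v = 1` makes `v` a basis, and it suffices to
  -- compare both sides on tuples of its vectors.
  have hli : LinearIndependent ℝ v := by
    by_contra h
    have := ν.map_linearDependent v h
    rw [hv] at this
    exact one_ne_zero this
  let e := basisOfLinearIndependentOfCardEqFinrank hli (by simp [hV])
  have he : ∀ i, e i = v i := fun i => by simp [e]
  have main : ∀ i : Fin (k + 1), a (i.removeNth v) =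
      ν.curryLeft (∑ j : Fin (k + 1), ((-1) ^ (j : ℕ) * a (j.removeNth v)) • v j)
        (i.removeNth v) := by
    intro i
    have h1 : ∀ j, ν (Fin.cons (v j) (i.removeNth v) : Fin (k + 1) → V) =
        if j = i then (-1) ^ (i : ℕ) else 0 := fun j => by
      have h2 := update_eq_removeNth ν (v j) v i
      have hs : ((-1) ^ (i : ℕ) : ℝ) * (-1) ^ (i : ℕ) = 1 := by
        rw [← mul_pow]; simp
      have h3 : ν (Fin.cons (v j) (i.removeNth v) : Fin (k + 1) → V) =
          (-1) ^ (i : ℕ) * ν (update v i (v j)) := by rw [h2, ← mul_assoc, hs, one_mul]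
      rw [h3]
      split_ifs with hj
      · rw [hj, update_eq_self, hv, mul_one]
      · rw [ν.map_eq_zero_of_eq _ (i := i) (j := j) (by simp [hj]) (Ne.symm hj), mul_zero]
    let L : V →ₗ[ℝ] ℝ :=
      { toFun := fun x => ν.curryLeft x (i.removeNth v)
        map_add' := fun x y => by rw [map_add]; rfl
        map_smul' := fun c x => by rw [map_smul]; rfl }
    have h4 : ∀ j, L (v j) = if j = i then (-1) ^ (i : ℕ) else 0 := h1
    change _ = L _
    rw [map_sum]
    simp only [map_smul]
    simp only [h4, smul_eq_mul, mul_ite, mul_zero, Finset.sum_ite_eq', Finset.mem_univ, if_true]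
    rw [mul_right_comm, ← mul_pow]
    simp
  refine e.ext_alternating fun r hr => ?_
  simp only [he]
  -- An injective choice of `k` out of `k + 1` basis vectors omits one index `i`; up to a
  -- permutation it is the tuple of `main i`.
  obtain ⟨i, hi⟩ : ∃ i, i ∉ Set.range r := by
    by_contra! hc
    have := Fintype.card_le_of_surjective r hc
    simp at this
  have hsub : ∀ j, ∃ j', i.succAbove j' = r j := fun j =>
    Fin.exists_succAbove_eq fun h => hi ⟨j, h⟩
  choose τ hτ using hsub
  have hτi : Injective τ := fun a b hab => hr (by rw [← hτ, ← hτ, hab])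
  let σ : Equiv.Perm (Fin k) := Equiv.ofBijective τ (Finite.injective_iff_bijective.1 hτi)
  have hv' : (fun j => v (r j)) = i.removeNth v ∘ σ := by
    funext j
    change v (r j) = v (i.succAbove (τ j))
    rw [hτ]
  rw [hv', AlternatingMap.map_perm, AlternatingMap.map_perm, ← main i]

end LinearAlgebra

end SkewAlg

namespace SkewAlg

/-! ### Fibres, cut-offs and local frames -/

section Fiber

variable (n : ℕ) {M : Type*} [TopologicalSpace M]
  (E : M → Type*) [∀ x, AddCommGroup (E x)] [∀ x, Module ℝ (E x)] [∀ x, TopologicalSpace (E x)]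
  [TopologicalSpace (TotalSpace (EuclideanSpace ℝ (Fin n)) E)]
  [FiberBundle (EuclideanSpace ℝ (Fin n)) E] [VectorBundle ℝ (EuclideanSpace ℝ (Fin n)) E]

/-- The isomorphism of a fibre with the model fibre. -/
def fiberEquiv (x : M) : E x ≃ₗ[ℝ] EuclideanSpace ℝ (Fin n) :=
  (trivializationAt (EuclideanSpace ℝ (Fin n)) E x).linearEquivAt ℝ x
    (FiberBundle.mem_baseSet_trivializationAt _ E x)

theorem finrank_fiber (x : M) : Module.finrank ℝ (E x) = n := by
  rw [(fiberEquiv n E x).finrank_eq, finrank_euclideanSpace_fin]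

theorem finiteDimensional_fiber (n : ℕ) {M : Type*} [TopologicalSpace M]
    (E : M → Type*) [∀ x, AddCommGroup (E x)] [∀ x, Module ℝ (E x)] [∀ x, TopologicalSpace (E x)]
    [TopologicalSpace (TotalSpace (EuclideanSpace ℝ (Fin n)) E)]
    [FiberBundle (EuclideanSpace ℝ (Fin n)) E] [VectorBundle ℝ (EuclideanSpace ℝ (Fin n)) E]
    (x : M) : FiniteDimensional ℝ (E x) :=
  (fiberEquiv n E x).symm.finiteDimensional

end Fiber

section Local

variable {m n : ℕ} {M : Type*} [TopologicalSpace M] [ChartedSpace (EuclideanSpace ℝ (Fin m)) M]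
  {E : M → Type*} [∀ x, AddCommGroup (E x)] [∀ x, Module ℝ (E x)] [∀ x, TopologicalSpace (E x)]
  [TopologicalSpace (TotalSpace (EuclideanSpace ℝ (Fin n)) E)]
  [FiberBundle (EuclideanSpace ℝ (Fin n)) E]

/-- The product of a smooth function and a form. -/
def formMul {k : ℕ} (f : Fct m M) (α : Form m n E k) : Form m n E k :=
  ⟨fun x => f x • α.1 x, fun X => f.contMDiff.mul (α.2 X)⟩

theorem formMul_apply {k : ℕ} (f : Fct m M) (α : Form m n E k) (x : M) :
    (formMul f α).1 x = f x • α.1 x := rfl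

variable [VectorBundle ℝ (EuclideanSpace ℝ (Fin n)) E]

theorem evalSec_formMul {k : ℕ} (f : Fct m M) (α : Form m n E k) (X : Fin k → Sec m n E) :
    evalSec (formMul f α) X = f * evalSec α X := rfl

/-- The contraction of a form with a section. -/
def contract {k : ℕ} (X : Sec m n E) (α : Form m n E (k + 1)) : Form m n E k :=
  ⟨fun x => (α.1 x).curryLeft (X x), fun Z => by
    refine (α.2 (Fin.cons X Z : Fin (k + 1) → Sec m n E)).congr fun x => ?_
    change α.1 x _ = α.1 x _
    congr 1
    funext i
    refine Fin.cases ?_ (fun i => ?_) i <;> rfl⟩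

theorem evalSec_contract {k : ℕ} (X : Sec m n E) (α : Form m n E (k + 1)) (Z : Fin k → Sec m n E) :
    evalSec (contract X α) Z = evalSec α (Fin.cons X Z : Fin (k + 1) → Sec m n E) := by
  ext x
  change α.1 x _ = α.1 x _
  congr 1
  funext i
  refine Fin.cases ?_ (fun i => ?_) i <;> rfl

theorem form_eq_zero_of_lt {k : ℕ} (hk : n < k) (α : Form m n E k) : α = 0 := by
  ext1
  funext x
  have := finiteDimensional_fiber n E x
  exact alternating_eq_zero_of_finrank_lt (by rwa [finrank_fiber n E x]) _

variable [IsManifold (𝓡 m) ∞ M] [ContMDiffVectorBundle ∞ (EuclideanSpace ℝ (Fin n)) E (𝓡 m)]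
  [T2Space M]

theorem exists_bump_one {u : Set M} {x : M} (hu : u ∈ 𝓝 x) :
    ∃ f : Fct m M, tsupport f ⊆ u ∧ (∀ᶠ y in 𝓝 x, f y = 1) ∧ (∀ y, 0 ≤ f y) ∧
      HasCompactSupport f := by
  obtain ⟨f, -, hf⟩ := (SmoothBumpFunction.nhds_basis_tsupport (I := 𝓡 m) x).mem_iff.1 hu
  exact ⟨⟨f, f.contMDiff⟩, hf, f.eventuallyEq_one, fun _ => f.nonneg, f.hasCompactSupport⟩

/-- A function that is smooth near a point agrees near this point with a smooth function. -/
theorem exists_fct_eventuallyEq {f : M → ℝ} {x : M}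
    (hf : ∀ᶠ y in 𝓝 x, ContMDiffAt (𝓡 m) 𝓘(ℝ, ℝ) ∞ f y) :
    ∃ g : Fct m M, ∀ᶠ y in 𝓝 x, g y = f y := by
  obtain ⟨χ, h1, h2, -⟩ := exists_bump_one (m := m) hf
  refine ⟨⟨fun y => χ y * f y, contMDiff_of_tsupport fun y hy => ?_⟩, ?_⟩
  · exact (χ.contMDiff y).mul (h1 (tsupport_mul_subset_left hy))
  · filter_upwards [h2] with y hy
    change χ y * f y = f y
    rw [hy, one_mul]

/-- Division by a function that is nonzero at `x`, carried out among global smooth functions: only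
germs matter later. -/
theorem exists_mul_eq_one (g : Fct m M) {x : M} (hg : g x ≠ 0) :
    ∃ f : Fct m M, ∀ᶠ y in 𝓝 x, f y * g y = 1 := by
  have h := g.contMDiff.continuous.continuousAt.eventually_ne hg
  obtain ⟨f, hf⟩ := exists_fct_eventuallyEq (m := m) (f := fun y => (g y)⁻¹) (x := x) (by
    filter_upwards [h] with y hy
    exact (contDiffAt_inv ℝ hy).contMDiffAt.comp y (g.contMDiff y))
  refine ⟨f, ?_⟩
  filter_upwards [h, hf] with y h1 h2
  rw [h2, inv_mul_cancel₀ h1]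

/-- Every alternating form on a fibre extends to a smooth form. -/
theorem exists_form {l : ℕ} (x : M) (b : E x [⋀^Fin l]→ₗ[ℝ] ℝ) :
    ∃ β : Form m n E l, β.1 x = b := by
  let t := trivializationAt (EuclideanSpace ℝ (Fin n)) E x
  have hx : x ∈ t.baseSet := FiberBundle.mem_baseSet_trivializationAt _ E x
  let c := (EuclideanSpace.basisFun (Fin n) ℝ).toBasis
  obtain ⟨f, hf, hfx⟩ := exists_bump (m := m) (t.open_baseSet.mem_nhds hx)
  -- `T y` transports vectors from `y` to `x` by keeping their components in the local frame.
  -- Pulling `b` back along `T` and cutting off gives the extension, and `T x` is the identity.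
  let T : ∀ y, E y →ₗ[ℝ] E x := fun y =>
    ∑ j, (t.localFrameCoeff (𝓡 m) c j y).smulRight (t.localFrame c j x)
  have hT : ∀ y (v : E y), T y v = ∑ j, t.localFrameCoeff (𝓡 m) c j y v • t.localFrame c j x :=
    fun y v => by simp [T]
  refine ⟨⟨fun y => f y • b.compLinearMap (T y), fun X => ?_⟩, ?_⟩
  · have hc : ∀ i j, ContMDiffOn (𝓡 m) 𝓘(ℝ, ℝ) ∞
        (fun y => t.localFrameCoeff (𝓡 m) c j y (X i y)) t.baseSet := fun i j =>
      contMDiffOn_baseSet_localFrameCoeff (I := 𝓡 m) (e := t) c (k := ∞)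
        ((X i).contMDiff.contMDiffOn) j
    have he : ∀ y, (f y • b.compLinearMap (T y)) (fun i => X i y) =
        f y * ∑ r : Fin l → Fin n, (∏ i, t.localFrameCoeff (𝓡 m) c (r i) y (X i y)) *
          b (fun i => t.localFrame c (r i) x) := fun y => by
      change f y * b (fun i => T y (X i y)) = _
      simp only [hT]
      have := b.toMultilinearMap.map_sum (α := fun _ => Fin n)
        (fun i j => t.localFrameCoeff (𝓡 m) c j y (X i y) • t.localFrame c j x)
      refine congrArg (f y * ·) (this.trans ?_)
      refine Finset.sum_congr rfl fun r _ => ?_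
      exact b.toMultilinearMap.map_smul_univ _ _
    refine contMDiff_of_tsupport fun y hy => ?_
    have hy' : y ∈ t.baseSet := by
      refine hf (tsupport_mul_subset_left (f := f) (g := fun y => ∑ r : Fin l → Fin n,
        (∏ i, t.localFrameCoeff (𝓡 m) c (r i) y (X i y)) *
          b (fun i => t.localFrame c (r i) x)) ?_)
      rwa [← funext he]
    have hs : ContMDiffAt (𝓡 m) 𝓘(ℝ, ℝ) ∞ (fun y => f y * ∑ r : Fin l → Fin n,
        (∏ i, t.localFrameCoeff (𝓡 m) c (r i) y (X i y)) *
          b (fun i => t.localFrame c (r i) x)) y := by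
      refine (f.contMDiff y).mul (ContMDiffAt.sum fun r _ => ?_)
      refine ContMDiffAt.mul (ContMDiffAt.prod fun i _ => ?_) contMDiffAt_const
      exact (hc i (r i) y hy').contMDiffAt (t.open_baseSet.mem_nhds hy')
    exact hs.congr_of_eventuallyEq (Filter.Eventually.of_forall he)
  · have : T x = LinearMap.id := by
      ext v
      obtain ⟨X, rfl⟩ := exists_sec_eq (m := m) (n := n) x v
      rw [hT]
      exact (t.eq_sum_localFrameCoeff_smul (I := 𝓡 m) (s := X) (b := c) hx).symm
    change f x • b.compLinearMap (T x) = b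
    rw [this, hfx, one_smul]
    rfl

/-- Near every point there is a frame of sections together with a form of top degree with value `1`
on this frame. -/
theorem exists_frame (x : M) : ∃ (ν : Form m n E n) (Y : Fin n → Sec m n E),
    ∀ᶠ y in 𝓝 x, ν.1 y (fun i => Y i y) = 1 := by
  have := finiteDimensional_fiber n E x
  obtain ⟨a, v, hav⟩ := exists_alternating_ne_zero (finrank_fiber n E x)
  obtain ⟨ν, rfl⟩ := exists_form (m := m) (n := n) x a
  choose Y hY using fun i => exists_sec_eq (m := m) (n := n) x (v i)
  obtain ⟨f, hf⟩ := exists_mul_eq_one (evalSec ν Y) (x := x) (by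
    rw [evalSec_apply]; simp [hY, hav])
  exact ⟨formMul f ν, Y, hf⟩

end Local

/-! ### Scalar coordinates on the line bundle `L^E` -/

section Pairing

variable {m n : ℕ} {M : Type*} [TopologicalSpace M] [ChartedSpace (EuclideanSpace ℝ (Fin m)) M]
  {E : M → Type*} [∀ x, AddCommGroup (E x)] [∀ x, Module ℝ (E x)]

/-- The pairing of `⋀ⁿ E ⊗ ⋀ᵐ T*M` with an `n`-form on `E` and `m` tangent vectors. -/
def pairL {x : M} (a : E x [⋀^Fin n]→ₗ[ℝ] ℝ) (w : Fin m → TangentSpace (𝓡 m) x) :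
    LFib m n E x →ₗ[ℝ] ℝ where
  toFun σ := contractL a σ w
  map_add' σ τ := by rw [map_add]; rfl
  map_smul' c σ := by rw [map_smul]; rfl

theorem contractL_tmul {x : M} (a : E x [⋀^Fin n]→ₗ[ℝ] ℝ) (v : Fin n → E x)
    (μ : TangentSpace (𝓡 m) x [⋀^Fin m]→ₗ[ℝ] ℝ) :
    contractL a (exteriorPower.ιMulti ℝ n v ⊗ₜ[ℝ] μ) = a v • μ := by
  simp [contractL, exteriorPower.alternatingMapLinearEquiv_apply_ιMulti]

theorem pairL_tmul {x : M} (a : E x [⋀^Fin n]→ₗ[ℝ] ℝ) (w : Fin m → TangentSpace (𝓡 m) x)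
    (v : Fin n → E x) (μ : TangentSpace (𝓡 m) x [⋀^Fin m]→ₗ[ℝ] ℝ) :
    pairL a w (exteriorPower.ιMulti ℝ n v ⊗ₜ[ℝ] μ) = a v * μ w := by
  change contractL a (exteriorPower.ιMulti ℝ n v ⊗ₜ[ℝ] μ) w = _
  rw [contractL_tmul]; rfl

variable [∀ x, TopologicalSpace (E x)]
  [TopologicalSpace (TotalSpace (EuclideanSpace ℝ (Fin n)) E)]
  [FiberBundle (EuclideanSpace ℝ (Fin n)) E] [VectorBundle ℝ (EuclideanSpace ℝ (Fin n)) E]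
  [IsManifold (𝓡 m) ∞ M]

/-- This expresses, without division, that the fibre of `L^E` is a line. On decomposable elements it
is `alternating_mul_comm` in each tensor factor, and the rest is linearity. -/
theorem smul_eq_pairL_smul {x : M} (a : E x [⋀^Fin n]→ₗ[ℝ] ℝ) (w : Fin m → TangentSpace (𝓡 m) x)
    (v : Fin n → E x) (μ : TangentSpace (𝓡 m) x [⋀^Fin m]→ₗ[ℝ] ℝ) (σ : LFib m n E x) :
    (a v * μ w) • σ = pairL a w σ • (exteriorPower.ιMulti ℝ n v ⊗ₜ[ℝ] μ) := by
  have := finiteDimensional_fiber n E x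
  have : FiniteDimensional ℝ (TangentSpace (𝓡 m) x) :=
    finiteDimensional_fiber m (TangentSpace (𝓡 m) : M → Type _) x
  have hT : Module.finrank ℝ (TangentSpace (𝓡 m) x) = m :=
    finrank_fiber m (TangentSpace (𝓡 m) : M → Type _) x
  induction σ using TensorProduct.induction_on with
  | zero => simp
  | add σ τ hσ hτ => rw [smul_add, map_add, add_smul, hσ, hτ]
  | tmul q μ' =>
    let T : ⋀[ℝ]^n (E x) →ₗ[ℝ] LFib m n E x := (TensorProduct.mk ℝ _ _).flip μ'
    have h : (a v * μ w) • T =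
        (pairL a w ∘ₗ T).smulRight (exteriorPower.ιMulti ℝ n v ⊗ₜ[ℝ] μ) := by
      refine @exteriorPower.linearMap_ext ℝ _ n (E x) (LFib m n E x) _ _ _ _ _ _ ?_
      ext1 u
      change (a v * μ w) • (exteriorPower.ιMulti ℝ n u ⊗ₜ[ℝ] μ') =
        pairL a w (exteriorPower.ιMulti ℝ n u ⊗ₜ[ℝ] μ') • (exteriorPower.ιMulti ℝ n v ⊗ₜ[ℝ] μ)
      rw [pairL_tmul]
      have h1 := alternating_mul_comm (finrank_fiber n E x) a (exteriorPower.ιMulti ℝ n) v u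
      have h2 : μ w • μ' = μ' w • μ := by
        ext w'
        have := alternating_mul_comm hT μ μ' w w'
        simp only [smul_eq_mul] at this
        simp only [AlternatingMap.smul_apply, smul_eq_mul]
        rw [this, mul_comm]
      rw [mul_smul, ← TensorProduct.tmul_smul, h2, TensorProduct.smul_tmul', h1,
        TensorProduct.tmul_smul, ← TensorProduct.smul_tmul', smul_smul, mul_comm]
    exact LinearMap.congr_fun h q

/-- Pairing with a coframe that is nonzero somewhere is a coordinate on the line, so equalities in
`L^E` can be verified as equalities of real numbers. -/
theorem pairL_injective {x : M} {a : E x [⋀^Fin n]→ₗ[ℝ] ℝ} {w : Fin m → TangentSpace (𝓡 m) x}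
    {v : Fin n → E x} {μ : TangentSpace (𝓡 m) x [⋀^Fin m]→ₗ[ℝ] ℝ} (h : a v * μ w ≠ 0) :
    Injective (pairL (m := m) (n := n) a w) := by
  intro σ τ hστ
  have h1 := smul_eq_pairL_smul a w v μ σ
  rw [hστ, ← smul_eq_pairL_smul a w v μ τ] at h1
  exact smul_right_injective _ h h1

variable [ContMDiffVectorBundle ∞ (EuclideanSpace ℝ (Fin n)) E (𝓡 m)] [T2Space M]

theorem pairL_decomp (ν : Form m n E n) (W : Fin m → VecField m M) (Y : Fin n → Sec m n E)
    (μ : DForm m M m) (x : M) :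
    pairL (ν.1 x) (fun j => W j x) (decomp Y μ x) = (evalSec ν Y * evalSec μ W) x :=
  pairL_tmul _ _ _ _

variable (m n E) in
/-- Near every point `L^E` has a smooth frame and a smooth coordinate. -/
theorem exists_pairL (x : M) : ∃ (ν : Form m n E n) (W : Fin m → VecField m M)
    (Y : Fin n → Sec m n E) (μ : DForm m M m), ∀ᶠ y in 𝓝 x,
      pairL (ν.1 y) (fun j => W j y) (decomp Y μ y) = 1 ∧
      Injective (pairL (m := m) (n := n) (ν.1 y) fun j => W j y) := by
  obtain ⟨ν, Y, h1⟩ := exists_frame (m := m) (n := n) (E := E) x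
  obtain ⟨μ, W, h2⟩ := exists_frame (m := m) (n := m) (E := (TangentSpace (𝓡 m) : M → Type _)) x
  refine ⟨ν, W, Y, μ, ?_⟩
  filter_upwards [h1, h2] with y h1 h2
  refine ⟨?_, pairL_injective (v := fun i => Y i y) (μ := μ.1 y) ?_⟩
  · rw [decomp, pairL_tmul, h1, h2, one_mul]
  · rw [h1, h2]; simp

variable (m n E) in
theorem exists_pairL_injective (x : M) : ∃ (ν : Form m n E n) (W : Fin m → VecField m M),
    ∀ᶠ y in 𝓝 x, Injective (pairL (m := m) (n := n) (ν.1 y) fun j => W j y) := by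
  obtain ⟨ν, W, Y, μ, h⟩ := exists_pairL m n E x
  exact ⟨ν, W, h.mono fun _ h => h.2⟩

end Pairing

end SkewAlg

namespace SkewAlg

/-! ### The connection on `L^E`, modular forms and the modular class -/

section Nabla

variable {m n : ℕ} {M : Type*} [TopologicalSpace M] [ChartedSpace (EuclideanSpace ℝ (Fin m)) M]
  [IsManifold (𝓡 m) ∞ M]
  {E : M → Type*} [∀ x, AddCommGroup (E x)] [∀ x, Module ℝ (E x)] [∀ x, TopologicalSpace (E x)]
  [TopologicalSpace (TotalSpace (EuclideanSpace ℝ (Fin n)) E)]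
  [FiberBundle (EuclideanSpace ℝ (Fin n)) E] [VectorBundle ℝ (EuclideanSpace ℝ (Fin n)) E]

theorem mvfderiv_congr {f g : M → ℝ} {x : M} (h : ∀ᶠ y in 𝓝 x, f y = g y) :
    mvfderiv (𝓡 m) f x = mvfderiv (𝓡 m) g x := by
  have h1 : mfderiv (𝓡 m) 𝓘(ℝ, ℝ) f x = mfderiv (𝓡 m) 𝓘(ℝ, ℝ) g x :=
    Filter.EventuallyEq.mfderiv_eq h
  ext v
  change mfderiv (𝓡 m) 𝓘(ℝ, ℝ) f x v = mfderiv (𝓡 m) 𝓘(ℝ, ℝ) g x v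
  rw [h1]
  rfl

namespace SkewAlgebroid

variable (A : SkewAlgebroid m n E)

theorem rho_congr (X : Sec m n E) {f g : Fct m M} {x : M} (h : ∀ᶠ y in 𝓝 x, f y = g y) :
    A.rho X f x = A.rho X g x := by
  rw [rho_apply, rho_apply, mvfderiv_congr h]

theorem rho_const (X : Sec m n E) (f : Fct m M) (c : ℝ) {x : M} (h : ∀ᶠ y in 𝓝 x, f y = c) :
    A.rho X f x = 0 := by
  rw [rho_apply, mvfderiv_congr h, mvfderiv_const]; rfl

theorem rho_anchorSec (X : Sec m n E) (f : Fct m M) :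
    (tangentAlgebroid m M).rho (A.anchorSec X) f = A.rho X f := rfl

theorem anchorSec_add (X X' : Sec m n E) :
    A.anchorSec (X + X') = A.anchorSec X + A.anchorSec X' := by
  ext1 x
  exact map_add (A.anchor x) (X x) (X' x)

theorem anchorSec_fsmul (f : Fct m M) (X : Sec m n E) :
    A.anchorSec (fsmul f X) = fsmul f (A.anchorSec X) := by
  ext1 x
  exact map_smul (A.anchor x) (f x) (X x)

theorem lieAlt_add {k : ℕ} (X X' : Sec m n E) (α : Form m n E k) (Z : Fin k → Sec m n E) :
    A.lieAlt (X + X') α Z = A.lieAlt X α Z + A.lieAlt X' α Z := by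
  simp only [lieAlt_apply, map_add, LinearMap.add_apply, AlternatingMap.map_update_add,
    Finset.sum_add_distrib]
  abel

theorem lieAlt_formMul {k : ℕ} (X : Sec m n E) (f : Fct m M) (α : Form m n E k)
    (Z : Fin k → Sec m n E) :
    A.lieAlt X (formMul f α) Z = A.rho X f * evalSec α Z + f * A.lieAlt X α Z := by
  simp only [lieAlt_apply, evalSec_formMul, rho_mul, ← Finset.mul_sum]
  ring

/-- On forms of top degree, `ℒ_{f X} ν = f ℒ_X ν + ρ(X)(f) ν`. -/
theorem lieAlt_fsmul_top (X : Sec m n E) (f : Fct m M) (ν : Form m n E n)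
    (Z : Fin n → Sec m n E) :
    A.lieAlt (fsmul f X) ν Z = f * A.lieAlt X ν Z + A.rho X f * evalSec ν Z := by
  have hα := evalSec_tensorial ν
  have h1 : ∀ j, evalSec ν (update Z j (A.bracket (fsmul f X) (Z j))) =
      f * evalSec ν (update Z j (A.bracket X (Z j))) -
        A.rho (Z j) f * evalSec ν (update Z j X) := fun j => by
    rw [bracket_fsmul_left, AlternatingMap.map_update_sub, hα, hα]
  -- Pointwise this is `sum_update` for the covector `df ∘ ρ`.
  have h2 : ∑ j, A.rho (Z j) f * evalSec ν (update Z j X) = A.rho X f * evalSec ν Z := by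
    ext x
    have := finiteDimensional_fiber n E x
    let θ : E x →ₗ[ℝ] ℝ := (mvfderiv (𝓡 m) f x).toLinearMap ∘ₗ A.anchor x
    have key := sum_update (finrank_fiber n E x) (ν.1 x) θ (X x) (fun i => Z i x)
    let ev : Fct m M →+ ℝ :=
      { toFun := fun X => X x, map_zero' := rfl, map_add' := fun _ _ => rfl }
    change ev (∑ j, A.rho (Z j) f * evalSec ν (update Z j X)) = _
    rw [map_sum]
    refine Eq.trans (Finset.sum_congr rfl fun j _ => ?_) key
    change θ (Z j x) * (ν.1 x fun i => update Z j X i x) = _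
    rw [sec_update]
  rw [lieAlt_apply, lieAlt_apply, rho_fsmul]
  simp only [h1]
  rw [Finset.sum_sub_distrib, ← Finset.mul_sum, h2]
  ring

variable [ContMDiffVectorBundle ∞ (EuclideanSpace ℝ (Fin n)) E (𝓡 m)] [T2Space M]

theorem evalSec_lieForm {k : ℕ} (X : Sec m n E) (α : Form m n E k) :
    evalSec (A.lieForm X α) = A.lieAlt X α := evalSec_formOf _ _

/-- The coordinate of `∇_X σ`, in terms of Lie derivatives. -/
theorem pairL_nabla (ν : Form m n E n) (W : Fin m → VecField m M) (X : Sec m n E)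
    (Y : Fin n → Sec m n E) (μ : DForm m M m) (x : M) :
    pairL (ν.1 x) (fun j => W j x) (A.nabla X Y μ x) =
      ((A.rho X (evalSec ν Y) - A.lieAlt X ν Y) * evalSec μ W +
        evalSec ν Y * (tangentAlgebroid m M).lieAlt (A.anchorSec X) μ W) x := by
  have h1 : pairL (ν.1 x) (fun j => W j x) (exteriorPower.ιMulti ℝ n (fun j => Y j x) ⊗ₜ[ℝ]
      ((tangentAlgebroid m M).lieForm (A.anchorSec X) μ).1 x) =
      (evalSec ν Y * (tangentAlgebroid m M).lieAlt (A.anchorSec X) μ W) x := by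
    rw [pairL_tmul, ← evalSec_lieForm]; rfl
  have h2 : pairL (ν.1 x) (fun j => W j x) ((∑ i, exteriorPower.ιMulti ℝ n
      (update (fun j => Y j x) i (A.bracket X (Y i) x))) ⊗ₜ[ℝ] μ.1 x) =
      ((∑ i, evalSec ν (update Y i (A.bracket X (Y i)))) * evalSec μ W) x := by
    let ev : Fct m M →+ ℝ :=
      { toFun := fun X => X x, map_zero' := rfl, map_add' := fun _ _ => rfl }
    rw [TensorProduct.sum_tmul, map_sum]
    change _ = ev (∑ i, evalSec ν (update Y i (A.bracket X (Y i)))) * evalSec μ W x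
    rw [map_sum, Finset.sum_mul]
    refine Finset.sum_congr rfl fun i _ => ?_
    rw [pairL_tmul, ← sec_update]
    rfl
  rw [nabla, map_add, h1, h2, lieAlt_apply A X ν, sub_sub_cancel]
  rfl

/-- `∇_X σ` at a point depends only on the germ of `σ`. -/
theorem nabla_congr (X : Sec m n E) {Y Y' : Fin n → Sec m n E} {μ μ' : DForm m M m} {x : M}
    (h : ∀ᶠ y in 𝓝 x, decomp Y μ y = decomp Y' μ' y) : A.nabla X Y μ x = A.nabla X Y' μ' x := by
  obtain ⟨ν, W, h0⟩ := exists_pairL_injective m n E x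
  apply h0.self_of_nhds
  -- The Leibniz rule rewrites the coordinate of `∇_X σ` so that `Y` and `μ` enter only through
  -- `decomp Y μ`: once through the derivative of a coordinate function, otherwise through values at
  -- `x`.
  have key : ∀ (Y : Fin n → Sec m n E) (μ : DForm m M m),
      pairL (ν.1 x) (fun j => W j x) (A.nabla X Y μ x) =
        A.rho X (evalSec ν Y * evalSec μ W) x -
        pairL ((A.lieForm X ν).1 x) (fun j => W j x) (decomp Y μ x) -
        ∑ j, pairL (ν.1 x) (fun i => update W j
          ((tangentAlgebroid m M).bracket (A.anchorSec X) (W j)) i x) (decomp Y μ x) := by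
    intro Y μ
    let ev : Fct m M →+ ℝ :=
      { toFun := fun X => X x, map_zero' := rfl, map_add' := fun _ _ => rfl }
    simp only [pairL_decomp]
    change _ = _ - _ - ∑ j, ev (evalSec ν Y * evalSec μ (update W j
      ((tangentAlgebroid m M).bracket (A.anchorSec X) (W j))))
    rw [← map_sum, ← Finset.mul_sum, pairL_nabla, evalSec_lieForm, rho_mul, lieAlt_apply _ _ μ,
      rho_anchorSec]
    change (_ : ℝ) * _ + _ * (_ - _) = _ * _ + _ * _ - _ * _ - _ * _
    change ((_ : ℝ) - _) * _ + _ * (_ - _) = _ * _ + _ * _ - _ * _ - _ * _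
    ring
  rw [key, key, h.self_of_nhds]
  congr 2
  apply rho_congr
  filter_upwards [h] with y hy
  rw [← pairL_decomp, ← pairL_decomp, hy]

theorem nabla_formMul (X : Sec m n E) (Y : Fin n → Sec m n E) (f : Fct m M) (μ : DForm m M m)
    (x : M) : A.nabla X Y (formMul f μ) x = f x • A.nabla X Y μ x + A.rho X f x • decomp Y μ x := by
  obtain ⟨ν, W, h0⟩ := exists_pairL_injective m n E x
  apply h0.self_of_nhds
  rw [map_add, map_smul, map_smul, pairL_nabla, pairL_nabla, pairL_decomp, lieAlt_formMul,
    evalSec_formMul, rho_anchorSec]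
  change ((_ : ℝ) - _) * (_ * _) + _ * (_ * _ + _ * _) = _ * (( _ - _) * _ + _ * _) + _ * (_ * _)
  ring

theorem nabla_add (X X' : Sec m n E) (Y : Fin n → Sec m n E) (μ : DForm m M m) (x : M) :
    A.nabla (X + X') Y μ x = A.nabla X Y μ x + A.nabla X' Y μ x := by
  obtain ⟨ν, W, h0⟩ := exists_pairL_injective m n E x
  apply h0.self_of_nhds
  rw [map_add, pairL_nabla, pairL_nabla, pairL_nabla, anchorSec_add, lieAlt_add, lieAlt_add,
    map_add, LinearMap.add_apply]
  change ((_ : ℝ) + _ - (_ + _)) * _ + _ * (_ + _) = (_ - _) * _ + _ * _ + ((_ - _) * _ + _ * _)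
  ring

/-- The factor `⋀ⁿ E` contributes `-ρ(X)(f)` and the factor `⋀ᵐ T*M` contributes `+ρ(X)(f)`. This
cancellation is the reason for the twist by `⋀ᵐ T*M`. -/
theorem nabla_fsmul (f : Fct m M) (X : Sec m n E) (Y : Fin n → Sec m n E) (μ : DForm m M m)
    (x : M) : A.nabla (fsmul f X) Y μ x = f x • A.nabla X Y μ x := by
  obtain ⟨ν, W, h0⟩ := exists_pairL_injective m n E x
  apply h0.self_of_nhds
  rw [map_smul, pairL_nabla, pairL_nabla, anchorSec_fsmul, lieAlt_fsmul_top, lieAlt_fsmul_top,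
    rho_fsmul, rho_anchorSec]
  change ((_ : ℝ) * _ - (_ * _ + _ * _)) * _ + _ * (_ * _ + _ * _) = _ * ((_ - _) * _ + _ * _)
  ring

end SkewAlgebroid

theorem decomp_formMul (Y : Fin n → Sec m n E) (f : Fct m M) (μ : DForm m M m) (x : M) :
    decomp Y (formMul f μ) x = f x • decomp Y μ x := by
  rw [decomp, formMul_apply, TensorProduct.tmul_smul]; rfl

variable [ContMDiffVectorBundle ∞ (EuclideanSpace ℝ (Fin n)) E (𝓡 m)] [T2Space M]

/-- Two decomposable sections, the second one without zeros near `x`, have a smooth quotient. -/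
theorem exists_ratio (Y Y' : Fin n → Sec m n E) (μ μ' : DForm m M m) {x : M}
    (hx : decomp Y μ x ≠ 0) :
    ∃ r : Fct m M, ∀ᶠ y in 𝓝 x, decomp Y' μ' y = r y • decomp Y μ y := by
  obtain ⟨ν, W, h0⟩ := exists_pairL_injective m n E x
  obtain ⟨f, hf⟩ := exists_mul_eq_one (evalSec ν Y * evalSec μ W) (x := x) (by
    rw [← pairL_decomp]
    exact fun h => hx (h0.self_of_nhds (h.trans (map_zero _).symm)))
  refine ⟨f * (evalSec ν Y' * evalSec μ' W), ?_⟩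
  filter_upwards [h0, hf] with y h1 h2
  apply h1
  rw [map_smul, pairL_decomp, pairL_decomp]
  change _ = f y * _ * _
  rw [mul_right_comm, h2, one_mul]

theorem exists_smul_eq {x : M} {τ : LFib m n E x} (hτ : τ ≠ 0) (σ : LFib m n E x) :
    ∃ c : ℝ, σ = c • τ := by
  obtain ⟨ν, W, h0⟩ := exists_pairL_injective m n E x
  have hp : pairL (ν.1 x) (fun j => W j x) τ ≠ 0 :=
    fun h => hτ (h0.self_of_nhds (h.trans (map_zero _).symm))
  refine ⟨pairL (ν.1 x) (fun j => W j x) σ / pairL (ν.1 x) (fun j => W j x) τ,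
    h0.self_of_nhds ?_⟩
  rw [map_smul, smul_eq_mul, div_mul_cancel₀ _ hp]

theorem LFib.smul_cancel {x : M} {a : LFib m n E x} (ha : a ≠ 0) {r r' : ℝ}
    (h : r • a = r' • a) : r = r' := by
  obtain ⟨ν, W, h0⟩ := exists_pairL_injective m n E x
  have hp : pairL (ν.1 x) (fun j => W j x) a ≠ 0 :=
    fun h => ha (h0.self_of_nhds (h.trans (map_zero _).symm))
  have := congrArg (pairL (ν.1 x) (fun j => W j x)) h
  rw [map_smul, map_smul] at this
  exact mul_right_cancel₀ hp this

theorem LFib.mk_eq_mk {x : M} {a b : LFib m n E x} :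
    Abs.mk a = Abs.mk b ↔ a = b ∨ a = (-1 : ℝ) • b := by
  have h : -b = (-1 : ℝ) • b := (neg_one_smul ℝ b).symm
  rw [← h]
  exact Quotient.eq (r := absSetoid (LFib m n E x))

theorem LFib.abs_eq_one {x : M} {a : LFib m n E x} (ha : a ≠ 0) {r : ℝ}
    (h : Abs.mk (r • a) = Abs.mk a) : |r| = 1 := by
  rcases LFib.mk_eq_mk.1 h with h | h
  · rw [LFib.smul_cancel ha (h.trans (one_smul ℝ a).symm), abs_one]
  · rw [LFib.smul_cancel ha h, abs_neg, abs_one]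

theorem AbsSection.ne_zero_of_eq (s : AbsSection m n E) {x : M} {a : LFib m n E x}
    (h : s.toFun x = Abs.mk a) : a ≠ 0 := fun h0 => s.ne_zero x (by rw [h, h0])

/-- `(Y, μ)` represents the section `s` of `|L^E|` near `x`. -/
def AbsSection.RepAt (s : AbsSection m n E) (x : M) (Y : Fin n → Sec m n E) (μ : DForm m M m) :
    Prop := ∀ᶠ y in 𝓝 x, s.toFun y = Abs.mk (decomp Y μ y)

theorem AbsSection.exists_repAt (s : AbsSection m n E) (x : M) : ∃ Y μ, s.RepAt x Y μ := by
  obtain ⟨U, σ, hU, hx, h1, h2⟩ := s.smooth x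
  obtain ⟨Y, μ, h⟩ := h1 x hx
  refine ⟨Y, μ, ?_⟩
  filter_upwards [h, hU.mem_nhds hx] with y hy hyU
  rw [h2 y hyU, hy]

theorem AbsSection.RepAt.ne_zero {s : AbsSection m n E} {x : M} {Y : Fin n → Sec m n E}
    {μ : DForm m M m} (h : s.RepAt x Y μ) : decomp Y μ x ≠ 0 := s.ne_zero_of_eq h.self_of_nhds

namespace SkewAlgebroid

variable (A : SkewAlgebroid m n E)

/-- The coefficient of `∇_X σ` with respect to `σ` does not depend on the representative `σ`. -/
theorem nabla_eq_of_repAt {s : AbsSection m n E} {x : M} {Y Y' : Fin n → Sec m n E}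
    {μ μ' : DForm m M m} (h : s.RepAt x Y μ) (h' : s.RepAt x Y' μ') (X : Sec m n E) {c : ℝ}
    (hc : A.nabla X Y μ x = c • decomp Y μ x) : A.nabla X Y' μ' x = c • decomp Y' μ' x := by
  obtain ⟨r, hr⟩ := exists_ratio Y Y' μ μ' h.ne_zero
  have e : ∀ᶠ y in 𝓝 x, decomp Y' μ' y = decomp Y (formMul r μ) y := by
    filter_upwards [hr] with y hy
    rw [hy, decomp_formMul]
  have hsq : ∀ᶠ y in 𝓝 x, |r y| = 1 := by
    filter_upwards [hr, h, h'] with y h1 h2 h3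
    exact LFib.abs_eq_one (s.ne_zero_of_eq h2) (by rw [← h1, ← h2, ← h3])
  -- Two representatives differ by `r = ±1`. Differentiating `r² = 1` gives `ρ(X)(r) = 0`, so the
  -- sign ambiguity does not affect the connection coefficient.
  have hd : A.rho X r x = 0 := by
    have h1 := A.rho_const X (r * r) 1 (x := x) (by
      filter_upwards [hsq] with y hy
      change r y * r y = 1
      rw [← abs_mul_abs_self, hy, one_mul])
    rw [rho_mul] at h1
    change A.rho X r x * r x + r x * A.rho X r x = 0 at h1
    rcases eq_or_eq_neg_of_abs_eq hsq.self_of_nhds with h2 | h2 <;> rw [h2] at h1 <;> linarith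
  rw [A.nabla_congr X e, nabla_formMul, hd, zero_smul, add_zero, hc, e.self_of_nhds,
    decomp_formMul, smul_comm]

theorem exists_modularCoeff (s : AbsSection m n E) (X : Sec m n E) (x : M) :
    ∃ c : ℝ, ∀ Y μ, s.RepAt x Y μ → A.nabla X Y μ x = c • decomp Y μ x := by
  obtain ⟨Y, μ, h⟩ := s.exists_repAt x
  obtain ⟨c, hc⟩ := exists_smul_eq h.ne_zero (A.nabla X Y μ x)
  exact ⟨c, fun Y' μ' h' => A.nabla_eq_of_repAt h h' X hc⟩

/-- The function `⟨X, φ⟩` for the modular form `φ` of `s`. -/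
def modularCoeff (s : AbsSection m n E) (X : Sec m n E) (x : M) : ℝ :=
  (A.exists_modularCoeff s X x).choose

theorem nabla_eq_modularCoeff {s : AbsSection m n E} {x : M} {Y : Fin n → Sec m n E}
    {μ : DForm m M m} (h : s.RepAt x Y μ) (X : Sec m n E) :
    A.nabla X Y μ x = A.modularCoeff s X x • decomp Y μ x :=
  (A.exists_modularCoeff s X x).choose_spec Y μ h

theorem modularCoeff_eq {s : AbsSection m n E} {x : M} {Y : Fin n → Sec m n E}
    {μ : DForm m M m} (h : s.RepAt x Y μ) (X : Sec m n E) {c : ℝ}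
    (hc : A.nabla X Y μ x = c • decomp Y μ x) : A.modularCoeff s X x = c := by
  rw [A.nabla_eq_modularCoeff h] at hc
  exact LFib.smul_cancel h.ne_zero hc

/-- Near `x` the coefficient is the quotient of the smooth coordinates of `∇_X σ` and `σ`, for one
representative `σ` and one coframe. -/
theorem contMDiff_modularCoeff (s : AbsSection m n E) (X : Sec m n E) :
    ContMDiff (𝓡 m) 𝓘(ℝ, ℝ) ∞ (A.modularCoeff s X) := by
  intro x
  obtain ⟨Y, μ, h⟩ := s.exists_repAt x
  obtain ⟨ν, W, h0⟩ := exists_pairL_injective m n E x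
  obtain ⟨f, hf⟩ := exists_mul_eq_one (evalSec ν Y * evalSec μ W) (x := x) (by
    rw [← pairL_decomp]
    exact fun h1 => h.ne_zero (h0.self_of_nhds (h1.trans (map_zero _).symm)))
  refine (f * ((A.rho X (evalSec ν Y) - A.lieAlt X ν Y) * evalSec μ W +
    evalSec ν Y * (tangentAlgebroid m M).lieAlt (A.anchorSec X) μ W)).contMDiff.contMDiffAt
      |>.congr_of_eventuallyEq ?_
  -- A pair that represents `s` near `x` also represents it near each nearby point `y`, so the
  -- coefficient at `y` can be computed from the same pair.
  filter_upwards [Filter.Eventually.eventually_nhds h, hf] with y h1 h2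
  have h3 := congrArg (pairL (ν.1 y) (fun j => W j y)) (A.nabla_eq_modularCoeff h1 X)
  rw [pairL_nabla, map_smul, pairL_decomp] at h3
  change _ = f y * _
  rw [h3, smul_eq_mul, mul_left_comm, h2, mul_one]

theorem modularCoeff_add (s : AbsSection m n E) (X X' : Sec m n E) (x : M) :
    A.modularCoeff s (X + X') x = A.modularCoeff s X x + A.modularCoeff s X' x := by
  obtain ⟨Y, μ, h⟩ := s.exists_repAt x
  refine A.modularCoeff_eq h _ ?_
  rw [nabla_add, add_smul, ← A.nabla_eq_modularCoeff h, ← A.nabla_eq_modularCoeff h]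

theorem modularCoeff_fsmul (s : AbsSection m n E) (f : Fct m M) (X : Sec m n E) (x : M) :
    A.modularCoeff s (fsmul f X) x = f x * A.modularCoeff s X x := by
  obtain ⟨Y, μ, h⟩ := s.exists_repAt x
  refine A.modularCoeff_eq h _ ?_
  rw [nabla_fsmul, mul_smul, ← A.nabla_eq_modularCoeff h]

/-- The map `X ↦ ⟨X, φ⟩` for the modular form `φ` of `s`. -/
def modularLinear (s : AbsSection m n E) : Sec m n E →ₗ[ℝ] Fct m M where
  toFun X := ⟨A.modularCoeff s X, A.contMDiff_modularCoeff s X⟩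
  map_add' X X' := by
    ext x
    exact A.modularCoeff_add s X X' x
  map_smul' c X := by
    ext x
    exact A.modularCoeff_fsmul s ⟨fun _ => c, contMDiff_const⟩ X x

/-- The modular form of a section of `|L^E|`. -/
def modularForm (s : AbsSection m n E) : Form m n E 1 :=
  formOf (AlternatingMap.ofSubsingleton ℝ (Sec m n E) (Fct m M) (0 : Fin 1) (A.modularLinear s))
    (by
      intro X i f a
      obtain rfl : i = 0 := Subsingleton.elim _ _
      ext x
      simp only [AlternatingMap.ofSubsingleton_apply_apply, update_self]
      exact A.modularCoeff_fsmul s f a x)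

theorem modularForm_apply (s : AbsSection m n E) (X : Sec m n E) (x : M) :
    (A.modularForm s).1 x (fun _ => X x) = A.modularCoeff s X x :=
  formOf_apply _ _ (fun _ => X) x

theorem isModularForm_modularForm (s : AbsSection m n E) : A.IsModularForm s (A.modularForm s) := by
  intro U Y μ hU h X x hx
  rw [modularForm_apply]
  refine A.nabla_eq_modularCoeff ?_ X
  filter_upwards [hU.mem_nhds hx] with y hy
  exact h.2 y hy

theorem form_one_ext {φ ψ : Form m n E 1}
    (h : ∀ (X : Sec m n E) x, φ.1 x (fun _ => X x) = ψ.1 x (fun _ => X x)) : φ = ψ := by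
  apply evalSec_injective
  ext X x
  have : (fun i => X i x) = fun _ => X 0 x := by
    funext i
    rw [Subsingleton.elim i 0]
  rw [evalSec_apply, evalSec_apply, this, h]

/-- Every point has a decomposable representative near it, and its value there is nonzero, so the
defining equation fixes each value of `φ`. -/
theorem eq_modularForm {s : AbsSection m n E} {φ : Form m n E 1} (h : A.IsModularForm s φ) :
    φ = A.modularForm s := by
  refine form_one_ext fun X x => ?_
  rw [modularForm_apply]
  obtain ⟨Y, μ, hr⟩ := s.exists_repAt x
  obtain ⟨U, hU, hUo, hx⟩ := eventually_nhds_iff.1 hr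
  refine (A.modularCoeff_eq hr X (h U Y μ hUo ⟨fun y _ => ⟨Y, μ, ?_⟩, hU⟩ X x hx)).symm
  exact Filter.Eventually.of_forall fun _ => rfl

theorem deRham_zero_apply (F : Form m n E 0) (X : Sec m n E) (x : M) :
    (A.deRham 0 F).1 x (fun _ => X x) = A.rho X (evalSec F Fin.elim0) x := by
  refine (formOf_apply _ (A.cartanAlt_tensorial F) (fun _ => X) x).trans ?_
  rw [cartanAlt_apply]
  have h0 : Fin.removeNth 0 (fun _ : Fin 1 => X) = Fin.elim0 := Subsingleton.elim _ _
  rw [Fin.sum_univ_one, h0, Finset.univ_eq_empty, Finset.sum_empty, smul_zero, sub_zero]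
  simp

/-- The quotient of two sections of `|L^E|` without zeros. -/
theorem exists_abs_ratio (s s' : AbsSection m n E) (x : M) :
    ∃ r : ℝ, 0 < r ∧ ∀ a c, s.toFun x = Abs.mk a → s'.toFun x = Abs.mk (c • a) → r = |c| := by
  obtain ⟨Y, μ, h⟩ := s.exists_repAt x
  obtain ⟨Y', μ', h'⟩ := s'.exists_repAt x
  obtain ⟨c, hc⟩ := exists_smul_eq h.ne_zero (decomp Y' μ' x)
  have hc0 : c ≠ 0 := fun h0 => h'.ne_zero (by rw [hc, h0, zero_smul])
  refine ⟨|c|, abs_pos.2 hc0, fun a d ha hb => ?_⟩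
  rw [h'.self_of_nhds, hc] at hb
  rw [h.self_of_nhds, LFib.mk_eq_mk] at ha
  have key : ∃ e : ℝ, |e| = 1 ∧ decomp Y μ x = e • a := by
    rcases ha with ha | ha
    · exact ⟨1, abs_one, ha.trans (one_smul ℝ a).symm⟩
    · exact ⟨-1, by simp, ha⟩
  obtain ⟨e, he, h1⟩ := key
  have ha0 : a ≠ 0 := fun h0 => h.ne_zero (by rw [h1, h0, smul_zero])
  rw [h1, smul_smul, LFib.mk_eq_mk, smul_smul] at hb
  rcases hb with hb | hb
  · rw [← LFib.smul_cancel ha0 hb, abs_mul, he, mul_one]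
  · have := congrArg abs (LFib.smul_cancel ha0 hb)
    rwa [abs_mul, he, mul_one, abs_mul, abs_neg, abs_one, one_mul] at this

/-- If `|σ'| = r |σ|` with `r > 0`, the Leibniz rule for the connection gives `φ' = φ + d log r`.
The positivity of `r`, available because signs were divided out, makes the logarithm global. -/
theorem toClass_modularForm_eq (s s' : AbsSection m n E) :
    A.toClass (A.modularForm s) = A.toClass (A.modularForm s') := by
  choose r hr0 hr using exists_abs_ratio s s'
  have hloc : ∀ x, ∃ (Y : Fin n → Sec m n E) (μ : DForm m M m) (q : Fct m M), s.RepAt x Y μ ∧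
      s'.RepAt x Y (formMul q μ) ∧ q x ≠ 0 ∧ ∀ᶠ y in 𝓝 x, r y = |q y| := by
    intro x
    obtain ⟨Y, μ, h⟩ := s.exists_repAt x
    obtain ⟨Y', μ', h'⟩ := s'.exists_repAt x
    obtain ⟨q, hq⟩ := exists_ratio Y Y' μ μ' h.ne_zero
    refine ⟨Y, μ, q, h, ?_, fun h0 => h'.ne_zero ?_, ?_⟩
    · filter_upwards [h', hq] with y h1 h2
      rw [decomp_formMul, ← h2, h1]
    · rw [hq.self_of_nhds, h0, zero_smul]
    · filter_upwards [h, h', hq] with y h1 h2 h3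
      rw [h3] at h2
      exact hr y _ _ h1 h2
  -- Locally `r = |q|` with `q` smooth and nonzero, and `Real.log` ignores the sign of its argument,
  -- so no case distinction is needed.
  have hsm : ContMDiff (𝓡 m) 𝓘(ℝ, ℝ) ∞ fun x => Real.log (r x) := by
    intro x
    obtain ⟨Y, μ, q, -, -, hq, hrq⟩ := hloc x
    have : ContMDiffAt (𝓡 m) 𝓘(ℝ, ℝ) ∞ (fun y => Real.log (q y)) x :=
      (Real.contDiffAt_log.2 hq).contMDiffAt.comp x (q.contMDiff x)
    refine this.congr_of_eventuallyEq ?_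
    filter_upwards [hrq] with y hy
    rw [hy, Real.log_abs]
  let G : Fct m M := ⟨fun x => Real.log (r x), hsm⟩
  let F : Form m n E 0 := ⟨fun x => AlternatingMap.constOfIsEmpty ℝ (E x) (Fin 0) (G x),
    fun _ => hsm⟩
  have key : A.modularForm s' = A.modularForm s + A.deRham 0 F := by
    refine form_one_ext fun X x => ?_
    change _ = (A.modularForm s).1 x (fun _ => X x) + (A.deRham 0 F).1 x (fun _ => X x)
    rw [modularForm_apply, modularForm_apply, deRham_zero_apply]
    have hF : evalSec F (Fin.elim0 : Fin 0 → Sec m n E) = G := by ext; rfl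
    rw [hF]
    obtain ⟨Y, μ, q, h, h', hq, hrq⟩ := hloc x
    have hG : A.rho X q x = q x * A.rho X G x := by
      -- Comparing derivatives of `q² = exp (2 log r)` yields `ρ(X)(q) = q ρ(X)(log r)` whatever the
      -- sign of `q`.
      let P : Fct m M := ⟨fun y => Real.exp (2 * G y),
        Real.contDiff_exp.contMDiff.comp (contMDiff_const.mul G.contMDiff)⟩
      have e1 : ∀ᶠ y in 𝓝 x, (q * q) y = P y := by
        filter_upwards [hrq] with y hy
        change q y * q y = Real.exp (2 * Real.log (r y))
        have h2 := hr0 y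
        rw [two_mul, Real.exp_add, Real.exp_log h2, hy, abs_mul_abs_self]
      have e2 : A.rho X P x = P x * (2 * A.rho X G x) := by
        rw [rho_apply, rho_apply]
        have hd : HasDerivAt (fun t => Real.exp (2 * t)) (Real.exp (2 * G x) * 2) (G x) := by
          have := ((hasDerivAt_id (G x)).const_mul 2).exp
          simpa using this
        have hm := hd.hasFDerivAt.hasMFDerivAt.comp x (fct_mdiff G x).hasMFDerivAt
        have e3 : mvfderiv (𝓡 m) P x (A.anchor x (X x)) =
            mfderiv (𝓡 m) 𝓘(ℝ, ℝ) P x (A.anchor x (X x)) := rfl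
        have e4 := hm.mfderiv
        have e5 : mfderiv (𝓡 m) 𝓘(ℝ, ℝ) P x = _ := e4
        rw [e3, e5]
        change mvfderiv (𝓡 m) G x (A.anchor x (X x)) * (Real.exp (2 * G x) * 2) = _
        change _ = Real.exp (2 * G x) * (2 * _)
        ring
      have e6 := A.rho_congr X e1
      rw [rho_mul, e2, ← e1.self_of_nhds] at e6
      change A.rho X q x * q x + q x * A.rho X q x = q x * q x * (2 * A.rho X G x) at e6
      apply mul_left_cancel₀ hq
      linarith
    refine A.modularCoeff_eq h' X ?_
    rw [nabla_formMul, A.nabla_eq_modularCoeff h, decomp_formMul, hG, smul_smul, smul_smul,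
      ← add_smul]
    congr 1
    ring
  rw [key]
  refine QuotientAddGroup.eq.2 ?_
  rw [neg_add_cancel_left]
  exact ⟨F, rfl⟩

end SkewAlgebroid

end Nabla

end SkewAlg

namespace SkewAlg

/-! ### Existence of nowhere-vanishing sections of `|L^E|` -/

section Existence

variable {m n : ℕ} {M : Type*} [TopologicalSpace M] [ChartedSpace (EuclideanSpace ℝ (Fin m)) M]
  [IsManifold (𝓡 m) ∞ M]
  {E : M → Type*} [∀ x, AddCommGroup (E x)] [∀ x, Module ℝ (E x)] [∀ x, TopologicalSpace (E x)]
  [TopologicalSpace (TotalSpace (EuclideanSpace ℝ (Fin n)) E)]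
  [FiberBundle (EuclideanSpace ℝ (Fin n)) E] [VectorBundle ℝ (EuclideanSpace ℝ (Fin n)) E]
  [ContMDiffVectorBundle ∞ (EuclideanSpace ℝ (Fin n)) E (𝓡 m)] [T2Space M]

/-- In a line, a sum of squares of vectors with non-negative weights, not all zero, is the square of
a non-zero vector. -/
theorem exists_sq_eq_finsum {ι : Type*} {x : M} (σ : ι → LFib m n E x) (f : ι → ℝ)
    (hf : ∀ i, 0 ≤ f i) (hfin : (support f).Finite) {i₀ : ι} (h0 : 0 < f i₀) (hσ : σ i₀ ≠ 0) :
    ∃ a : LFib m n E x, a ≠ 0 ∧ ∀ l : LFib m n E x →ₗ[ℝ] ℝ,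
      l a ^ 2 = ∑ᶠ i, f i • l (σ i) ^ 2 := by
  choose c hc using fun i => exists_smul_eq hσ (σ i)
  have hc0 : c i₀ = 1 := (LFib.smul_cancel hσ ((one_smul ℝ _).trans (hc i₀))).symm
  have hfin' : (support fun i => f i * c i ^ 2).Finite :=
    hfin.subset (support_mul_subset_left _ _)
  have hpos : 0 < ∑ᶠ i, f i * c i ^ 2 := by
    rw [finsum_eq_sum _ hfin']
    refine Finset.sum_pos' (fun i _ => mul_nonneg (hf i) (sq_nonneg _)) ⟨i₀, ?_, ?_⟩
    · simp [hc0, h0.ne']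
    · simpa [hc0] using h0
  -- With `σ i = c i • σ i₀`, the sum of squares is a multiple of the square of `σ i₀`. The multiple
  -- is positive because `c i₀ = 1` and `f i₀ > 0`.
  refine ⟨Real.sqrt (∑ᶠ i, f i * c i ^ 2) • σ i₀, fun h => ?_, fun l => ?_⟩
  · have := LFib.smul_cancel hσ (h.trans (zero_smul ℝ _).symm)
    exact (Real.sqrt_pos.2 hpos).ne' this
  · rw [map_smul, smul_eq_mul, mul_pow, Real.sq_sqrt hpos.le, finsum_mul' _ _ hfin']
    refine finsum_congr fun i => ?_
    rw [hc i, map_smul, smul_eq_mul, smul_eq_mul]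
    ring

variable (m n E) in
/-- There is a nowhere-vanishing section of `|L^E|`. -/
theorem nonempty_absSection [SigmaCompactSpace M] : Nonempty (AbsSection m n E) := by
  choose ν W Y μ h using fun x => exists_pairL m n E x
  let U : M → Set M := fun x => interior {y | decomp (Y x) (μ x) y ≠ 0}
  have hU : ∀ x, x ∈ U x := fun x => by
    refine mem_interior_iff_mem_nhds.2 ((h x).mono fun y hy h0 => ?_)
    have := hy.1
    rw [h0, map_zero] at this
    exact zero_ne_one this
  obtain ⟨f, hf⟩ := SmoothPartitionOfUnity.exists_isSubordinate (𝓡 m) (isClosed_univ (X := M)) U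
    (fun x => isOpen_interior) fun x _ => Set.mem_iUnion.2 ⟨x, hU x⟩
  -- `a x` is a square root of `∑ fᵢ σᵢ²`, stated through linear functionals to avoid the tensor
  -- square of `L^E`. It is chosen pointwise and determined only up to sign, which suffices for
  -- `|L^E|`.
  have ha : ∀ x, ∃ a : LFib m n E x, a ≠ 0 ∧ ∀ l : LFib m n E x →ₗ[ℝ] ℝ,
      l a ^ 2 = ∑ᶠ i, f i x • l (decomp (Y i) (μ i) x) ^ 2 := fun x => by
    obtain ⟨i, hi⟩ := f.exists_pos_of_mem (Set.mem_univ x)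
    refine exists_sq_eq_finsum _ (fun i => f i x) (fun i => f.nonneg i x) ?_ hi ?_
    · exact f.locallyFinite.point_finite x
    · exact interior_subset (hf i (subset_tsupport _ hi.ne'))
  choose a ha0 ha using ha
  refine ⟨⟨fun x => Abs.mk (a x), fun x => ?_, fun x h0 => ha0 x ?_⟩⟩
  · let P : ∀ y, LFib m n E y →ₗ[ℝ] ℝ := fun y => pairL ((ν x).1 y) fun j => W x j y
    -- `G` is the square of the coordinate of `a`, hence smooth, and positive near `x`. Its root
    -- times the local frame is a smooth representative of `|a|`.
    let G : Fct m M := ⟨fun y => ∑ᶠ i, f i y • P y (decomp (Y i) (μ i) y) ^ 2, by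
      refine f.contMDiff_finsum_smul fun i y _ => ?_
      have := (((evalSec (ν x) (Y i) * evalSec (μ i) (W x)) ^ 2 : Fct m M)).contMDiff y
      refine this.congr_of_eventuallyEq (Filter.Eventually.of_forall fun y => ?_)
      change P y (decomp (Y i) (μ i) y) ^ 2 = (evalSec (ν x) (Y i) * evalSec (μ i) (W x)) y ^ 2
      rw [← pairL_decomp]⟩
    have hG : ∀ y, G y = P y (a y) ^ 2 := fun y => (ha y _).symm
    have hpos : ∀ᶠ y in 𝓝 x, 0 < G y := (h x).mono fun y hy => by
      rw [hG]
      refine sq_pos_of_ne_zero fun h1 => ha0 y (hy.2 (h1.trans (map_zero _).symm))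
    obtain ⟨H, hH⟩ := exists_fct_eventuallyEq (m := m) (f := fun y => Real.sqrt (G y)) (x := x) (by
      filter_upwards [hpos] with y hy
      exact (Real.contDiffAt_sqrt hy.ne').contMDiffAt.comp y (G.contMDiff y))
    obtain ⟨V, hV, hVo, hxV⟩ := eventually_nhds_iff.1 (hH.and (h x))
    refine ⟨V, decomp (Y x) (formMul H (μ x)), hVo, hxV, fun y _ => ⟨_, _,
      Filter.Eventually.of_forall fun _ => rfl⟩, fun y hy => ?_⟩
    obtain ⟨h1, h2, h3⟩ := hV y hy
    rw [LFib.mk_eq_mk, decomp_formMul, h1, hG, Real.sqrt_sq_eq_abs]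
    rcases abs_choice (P y (a y)) with h4 | h4
    · left
      apply h3
      rw [map_smul, h2, h4, smul_eq_mul, mul_one]
    · right
      apply h3
      rw [map_smul, map_smul, h2, h4, smul_eq_mul, smul_eq_mul, mul_one, neg_one_mul, neg_neg]
  · rcases LFib.mk_eq_mk.1 h0 with h1 | h1
    · exact h1
    · rw [h1, smul_zero]

end Existence

end SkewAlg

namespace SkewAlg

/-! ### Coordinate vector fields and the coordinate form of the Lie derivative -/

section Chart

attribute [local instance] chartedSpaceSelf

variable {m : ℕ} {M : Type*} [TopologicalSpace M] [ChartedSpace (EuclideanSpace ℝ (Fin m)) M]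
  [IsManifold (𝓡 m) ∞ M]

/-- The coordinate vector fields of the chart at `x₀`. -/
def coordField (x₀ : M) (a : Fin m) (x : M) : TangentSpace (𝓡 m) x :=
  VectorField.mpullback (𝓡 m) (𝓡 m) (chartAt (EuclideanSpace ℝ (Fin m)) x₀)
    (fun _ => (EuclideanSpace.single a (1 : ℝ) : EuclideanSpace ℝ (Fin m))) x

variable {x₀ : M}

theorem mdifferentiable_chartAt (x₀ : M) :
    (chartAt (EuclideanSpace ℝ (Fin m)) x₀).MDifferentiable (𝓡 m) (𝓡 m) :=
  have : IsManifold (𝓡 m) 1 M := IsManifold.of_le (n := ∞) (by simp)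
  mdifferentiable_chart x₀

theorem mfderiv_symm_mfderiv {x : M} (hx : x ∈ (chartAt (EuclideanSpace ℝ (Fin m)) x₀).source)
    (v : TangentSpace (𝓡 m) x) :
    mfderiv (𝓡 m) (𝓡 m) (chartAt (EuclideanSpace ℝ (Fin m)) x₀).symm
      (chartAt (EuclideanSpace ℝ (Fin m)) x₀ x)
      (mfderiv (𝓡 m) (𝓡 m) (chartAt (EuclideanSpace ℝ (Fin m)) x₀) x v) = v :=
  congrArg (fun L => L v) ((mdifferentiable_chartAt x₀).symm_comp_deriv hx)

theorem mfderiv_mfderiv_symm {x : M} (hx : x ∈ (chartAt (EuclideanSpace ℝ (Fin m)) x₀).source)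
    (v : EuclideanSpace ℝ (Fin m)) :
    mfderiv (𝓡 m) (𝓡 m) (chartAt (EuclideanSpace ℝ (Fin m)) x₀) x
      (mfderiv (𝓡 m) (𝓡 m) (chartAt (EuclideanSpace ℝ (Fin m)) x₀).symm
        (chartAt (EuclideanSpace ℝ (Fin m)) x₀ x) v) = v := by
  have h := (mdifferentiable_chartAt x₀).comp_symm_deriv
    ((chartAt (EuclideanSpace ℝ (Fin m)) x₀).map_source hx)
  rw [(chartAt (EuclideanSpace ℝ (Fin m)) x₀).left_inv hx] at h
  exact congrArg (fun L => L v) h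

theorem isInvertible_mfderiv_chartAt {x : M}
    (hx : x ∈ (chartAt (EuclideanSpace ℝ (Fin m)) x₀).source) :
    (mfderiv (𝓡 m) (𝓡 m) (chartAt (EuclideanSpace ℝ (Fin m)) x₀) x).IsInvertible :=
  ⟨(mdifferentiable_chartAt x₀).mfderiv hx, rfl⟩

theorem coordField_eq {x : M} (hx : x ∈ (chartAt (EuclideanSpace ℝ (Fin m)) x₀).source)
    (a : Fin m) : coordField x₀ a x =
      mfderiv (𝓡 m) (𝓡 m) (chartAt (EuclideanSpace ℝ (Fin m)) x₀).symm
        (chartAt (EuclideanSpace ℝ (Fin m)) x₀ x)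
        (EuclideanSpace.single a (1 : ℝ) : EuclideanSpace ℝ (Fin m)) := by
  apply ((mdifferentiable_chartAt x₀).mfderiv hx).injective
  change mfderiv (𝓡 m) (𝓡 m) (chartAt (EuclideanSpace ℝ (Fin m)) x₀) x _ =
    mfderiv (𝓡 m) (𝓡 m) (chartAt (EuclideanSpace ℝ (Fin m)) x₀) x _
  rw [mfderiv_mfderiv_symm hx]
  exact (isInvertible_mfderiv_chartAt hx).self_apply_inverse _

theorem contMDiffAt_chartAt {x : M} (hx : x ∈ (chartAt (EuclideanSpace ℝ (Fin m)) x₀).source) :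
    ContMDiffAt (𝓡 m) (𝓡 m) ∞ (chartAt (EuclideanSpace ℝ (Fin m)) x₀) x :=
  contMDiffAt_of_mem_maximalAtlas (IsManifold.chart_mem_maximalAtlas x₀) hx

theorem contMDiffAt_chartAt_symm {u : EuclideanSpace ℝ (Fin m)}
    (hu : u ∈ (chartAt (EuclideanSpace ℝ (Fin m)) x₀).target) :
    ContMDiffAt (𝓡 m) (𝓡 m) ∞ (chartAt (EuclideanSpace ℝ (Fin m)) x₀).symm u :=
  contMDiffAt_symm_of_mem_maximalAtlas (IsManifold.chart_mem_maximalAtlas x₀) hu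

theorem contMDiff_constField (v : EuclideanSpace ℝ (Fin m)) :
    ContMDiff (𝓡 m) (𝓡 m).tangent ∞ (fun u : EuclideanSpace ℝ (Fin m) =>
      (⟨u, v⟩ : TangentBundle (𝓡 m) (EuclideanSpace ℝ (Fin m)))) := by
  exact contMDiff_vectorSpace_iff_contDiff.2 contDiff_const

theorem contMDiffOn_coordField (a : Fin m) :
    ContMDiffOn (𝓡 m) ((𝓡 m).prod 𝓘(ℝ, EuclideanSpace ℝ (Fin m))) ∞
      (fun x => (⟨x, coordField x₀ a x⟩ : TotalSpace (EuclideanSpace ℝ (Fin m))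
        (TangentSpace (𝓡 m) : M → Type _))) (chartAt (EuclideanSpace ℝ (Fin m)) x₀).source :=
  fun x hx => (ContMDiffAt.mpullback_vectorField_preimage (contMDiff_constField _ _)
    (contMDiffAt_chartAt hx) (isInvertible_mfderiv_chartAt hx) (by simp)).contMDiffWithinAt

/-- Pullback by the chart respects Lie brackets, and constant fields on the model space commute. -/
theorem mlieBracket_coordField {x : M} (hx : x ∈ (chartAt (EuclideanSpace ℝ (Fin m)) x₀).source)
    (a b : Fin m) :
    VectorField.mlieBracket (𝓡 m) (coordField x₀ a) (coordField x₀ b) x = 0 := by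
  have : IsManifold (𝓡 m) (minSmoothness ℝ 3) M := by
    rw [minSmoothness_of_isRCLikeNormedField]; infer_instance
  have h := VectorField.mpullback_mlieBracket (I := 𝓡 m) (I' := 𝓡 m) (n := ∞)
    (f := chartAt (EuclideanSpace ℝ (Fin m)) x₀) (x₀ := x)
    (V := fun _ => (EuclideanSpace.single a (1 : ℝ) : EuclideanSpace ℝ (Fin m)))
    (W := fun _ => (EuclideanSpace.single b (1 : ℝ) : EuclideanSpace ℝ (Fin m)))
    ((contMDiff_constField _).mdifferentiableAt (by simp))
    ((contMDiff_constField _).mdifferentiableAt (by simp)) (contMDiffAt_chartAt hx)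
    (by rw [minSmoothness_of_isRCLikeNormedField]; exact WithTop.coe_le_coe.2 le_top)
  refine h.symm.trans ?_
  have h0 : VectorField.mlieBracket (𝓡 m)
      (fun _ : EuclideanSpace ℝ (Fin m) =>
        (EuclideanSpace.single a (1 : ℝ) : EuclideanSpace ℝ (Fin m)))
      (fun _ => (EuclideanSpace.single b (1 : ℝ) : EuclideanSpace ℝ (Fin m))) = 0 := by
    refine VectorField.mlieBracketWithin_univ.symm.trans ?_
    funext u
    refine (congrFun VectorField.mlieBracketWithin_eq_lieBracketWithin u).trans ?_
    simp [VectorField.lieBracketWithin]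
    rfl
  rw [h0, VectorField.mpullback_zero]
  rfl

variable [T2Space M]

/-- The algebroid calculus acts on global sections, so the coordinate fields are replaced by global
fields with the same germs. -/
theorem exists_coordFields {x : M} (hx : x ∈ (chartAt (EuclideanSpace ℝ (Fin m)) x₀).source) :
    ∃ Z : Fin m → VecField m M, ∀ᶠ y in 𝓝 x, ∀ a, Z a y = coordField x₀ a y := by
  obtain ⟨f, hf, hf1, -⟩ := exists_bump_one (m := m)
    ((chartAt (EuclideanSpace ℝ (Fin m)) x₀).open_source.mem_nhds hx)
  choose Z hZ using fun a => exists_sec (chartAt (EuclideanSpace ℝ (Fin m)) x₀).open_source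
    (contMDiffOn_coordField (x₀ := x₀) a) f hf
  refine ⟨Z, ?_⟩
  filter_upwards [hf1] with y hy a
  rw [hZ, hy, one_smul]

/-- Coordinate derivatives as derivatives along coordinate fields. -/
theorem mvfderiv_coordField (F : Fct m M) {x : M}
    (hx : x ∈ (chartAt (EuclideanSpace ℝ (Fin m)) x₀).source) (a : Fin m) :
    mvfderiv (𝓡 m) F x (coordField x₀ a x) =
      fderiv ℝ (fun u => F ((chartAt (EuclideanSpace ℝ (Fin m)) x₀).symm u))
        (chartAt (EuclideanSpace ℝ (Fin m)) x₀ x) (EuclideanSpace.single a (1 : ℝ)) := by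
  rw [coordField_eq hx, ← mfderiv_eq_fderiv]
  have hu := (chartAt (EuclideanSpace ℝ (Fin m)) x₀).map_source hx
  have h := mfderiv_comp_apply_of_eq (I := 𝓡 m) (I' := 𝓡 m) (I'' := 𝓘(ℝ, ℝ)) (g := F)
    (f := (chartAt (EuclideanSpace ℝ (Fin m)) x₀).symm) (y := x)
    (chartAt (EuclideanSpace ℝ (Fin m)) x₀ x) (fct_mdiff F x)
    ((contMDiffAt_chartAt_symm hu).mdifferentiableAt (by simp))
    ((chartAt (EuclideanSpace ℝ (Fin m)) x₀).left_inv hx)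
    (EuclideanSpace.single a (1 : ℝ) : EuclideanSpace ℝ (Fin m))
  exact h.symm

/-- The differential of a coordinate function. -/
theorem mvfderiv_coord {ξ : M → ℝ} {i : Fin m} {x : M}
    (hx : x ∈ (chartAt (EuclideanSpace ℝ (Fin m)) x₀).source)
    (hξ : ∀ᶠ y in 𝓝 x, ξ y = chartAt (EuclideanSpace ℝ (Fin m)) x₀ y i)
    (v : TangentSpace (𝓡 m) x) :
    mvfderiv (𝓡 m) ξ x v = EuclideanSpace.proj (𝕜 := ℝ) i
      (mfderiv (𝓡 m) (𝓡 m) (chartAt (EuclideanSpace ℝ (Fin m)) x₀) x v) := by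
  rw [mvfderiv_congr hξ]
  let p : EuclideanSpace ℝ (Fin m) →L[ℝ] ℝ := EuclideanSpace.proj i
  have h := mfderiv_comp_apply (I := 𝓡 m) (I' := 𝓡 m) (I'' := 𝓘(ℝ, ℝ)) (g := p)
    (f := chartAt (EuclideanSpace ℝ (Fin m)) x₀) x p.mdifferentiableAt
    ((contMDiffAt_chartAt hx).mdifferentiableAt (by simp)) v
  rw [p.mfderiv_eq] at h
  exact h

theorem eq_sum_coordField {ξ : Fin m → M → ℝ} {x : M}
    (hx : x ∈ (chartAt (EuclideanSpace ℝ (Fin m)) x₀).source)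
    (hξ : ∀ᶠ y in 𝓝 x, ∀ i, ξ i y = chartAt (EuclideanSpace ℝ (Fin m)) x₀ y i)
    (v : TangentSpace (𝓡 m) x) :
    v = ∑ i, mvfderiv (𝓡 m) (ξ i) x v • coordField x₀ i x := by
  have h1 : ∀ i, mvfderiv (𝓡 m) (ξ i) x v = _ := fun i =>
    mvfderiv_coord hx (hξ.mono fun y hy => hy i) v
  let w : EuclideanSpace ℝ (Fin m) :=
    mfderiv (𝓡 m) (𝓡 m) (chartAt (EuclideanSpace ℝ (Fin m)) x₀) x v
  have hw := (EuclideanSpace.basisFun (Fin m) ℝ).sum_repr w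
  simp only [EuclideanSpace.basisFun_repr, EuclideanSpace.basisFun_apply] at hw
  let L : EuclideanSpace ℝ (Fin m) →ₗ[ℝ] TangentSpace (𝓡 m) x :=
    { toFun := fun u => mfderiv (𝓡 m) (𝓡 m) (chartAt (EuclideanSpace ℝ (Fin m)) x₀).symm
        (chartAt (EuclideanSpace ℝ (Fin m)) x₀ x) u
      map_add' := fun u u' => map_add _ _ _
      map_smul' := fun c u => map_smul _ _ _ }
  have hL : L w = v := mfderiv_symm_mfderiv hx v
  have hs : L w = ∑ i, w i • L (EuclideanSpace.single i 1) := by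
    conv_lhs => rw [← hw, map_sum]
    simp only [map_smul]
  refine hL.symm.trans (hs.trans (Finset.sum_congr rfl fun i _ => ?_))
  rw [h1, coordField_eq hx]
  rfl

/-- The Lie derivative of a form of top degree in coordinates:
`(ℒ_V μ)(∂₁, …, ∂ₘ) = ∑ᵢ ∂ᵢ(Vⁱ μ(∂₁, …, ∂ₘ))`. -/
theorem lieAlt_coord {x : M} (hx : x ∈ (chartAt (EuclideanSpace ℝ (Fin m)) x₀).source)
    {Z : Fin m → VecField m M} (hZ : ∀ᶠ y in 𝓝 x, ∀ a, Z a y = coordField x₀ a y)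
    {ξ : Fin m → Fct m M}
    (hξ : ∀ᶠ y in 𝓝 x, ∀ i, ξ i y = chartAt (EuclideanSpace ℝ (Fin m)) x₀ y i)
    (V : VecField m M) (μ : DForm m M m) :
    (tangentAlgebroid m M).lieAlt V μ Z x =
      ∑ i, (tangentAlgebroid m M).rho (Z i)
        ((tangentAlgebroid m M).rho V (ξ i) * evalSec μ Z) x := by
  let T := tangentAlgebroid m M
  let c : Fin m → Fct m M := fun i => T.rho V (ξ i)
  have hev : ∀ {ι : Type} (t : Finset ι) (F : ι → VecField m M) (y : M),
      (∑ i ∈ t, F i) y = ∑ i ∈ t, F i y := fun t F y => by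
    let ev : VecField m M →+ TangentSpace (𝓡 m) y :=
      { toFun := fun X => X y, map_zero' := rfl, map_add' := fun _ _ => rfl }
    exact map_sum ev F t
  -- The expansion `V = ∑ Vⁱ ∂ᵢ` is needed near `x` and not only at `x`, since the bracket
  -- differentiates `V`.
  have hV : ∀ᶠ y in 𝓝 x, V y = (∑ i, fsmul (c i) (Z i)) y := by
    filter_upwards [Filter.Eventually.eventually_nhds hξ, hZ,
      (chartAt (EuclideanSpace ℝ (Fin m)) x₀).open_source.mem_nhds hx] with y h1 h2 h3
    rw [hev]
    simp only [fsmul_apply, h2]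
    exact eq_sum_coordField h3 h1 (V y)
  have hZZ : ∀ i j, T.bracket (Z i) (Z j) x = 0 := fun i j => by
    refine (Filter.EventuallyEq.mlieBracket_vectorField_eq (hZ.mono fun y hy => hy i)
      (hZ.mono fun y hy => hy j)).trans (mlieBracket_coordField hx i j)
  have hb : ∀ j, T.bracket V (Z j) x = -∑ i, T.rho (Z j) (c i) x • Z i x := fun j => by
    have h1 : T.bracket V (Z j) x = T.bracket (∑ i, fsmul (c i) (Z i)) (Z j) x :=
      Filter.EventuallyEq.mlieBracket_vectorField_eq hV Filter.EventuallyEq.rfl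
    rw [h1, map_sum, LinearMap.sum_apply, hev, ← Finset.sum_neg_distrib]
    refine Finset.sum_congr rfl fun i _ => ?_
    rw [SkewAlgebroid.bracket_fsmul_left]
    change c i x • T.bracket (Z i) (Z j) x - T.rho (Z j) (c i) x • Z i x = _
    rw [hZZ, smul_zero, zero_sub]
  let ev : Fct m M →+ ℝ :=
    { toFun := fun X => X x, map_zero' := rfl, map_add' := fun _ _ => rfl }
  -- `[V, ∂ⱼ] = -∑ᵢ ∂ⱼ(Vⁱ) ∂ᵢ`; in the `j`-th place of `μ` every term with `i ≠ j` repeats an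
  -- argument. What remains is the divergence of `V`.
  have hs : ∀ j, evalSec μ (update Z j (T.bracket V (Z j))) x =
      -(T.rho (Z j) (c j) x * evalSec μ Z x) := fun j => by
    change (μ.1 x fun i => update Z j (T.bracket V (Z j)) i x) = _
    rw [sec_update, hb, AlternatingMap.map_update_neg, AlternatingMap.map_update_sum]
    congr 1
    rw [Finset.sum_eq_single j]
    · rw [AlternatingMap.map_update_smul]
      have : update (fun i => Z i x) j (Z j x) = fun i => Z i x :=
        update_eq_self j (fun i => Z i x)
      rw [this]
      rfl
    · intro i _ hij
      rw [AlternatingMap.map_update_smul, (μ.1 x).map_eq_zero_of_eq _ (i := j) (j := i)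
        (by simp [hij]) hij.symm, smul_zero]
    · simp
  rw [SkewAlgebroid.lieAlt_apply]
  change T.rho V (evalSec μ Z) x - ev (∑ j, evalSec μ (update Z j (T.bracket V (Z j)))) = _
  rw [map_sum]
  change _ - ∑ j, evalSec μ (update Z j (T.bracket V (Z j))) x = _
  simp only [hs, Finset.sum_neg_distrib, sub_neg_eq_add]
  have hVh : T.rho V (evalSec μ Z) x = ∑ i, c i x * T.rho (Z i) (evalSec μ Z) x := by
    have h1 : V x = ∑ i, c i x • Z i x := by
      rw [hV.self_of_nhds, hev]; rfl
    change mvfderiv (𝓡 m) (evalSec μ Z) x (V x) = _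
    rw [h1, map_sum]
    refine Finset.sum_congr rfl fun i _ => ?_
    rw [map_smul]; rfl
  rw [hVh, ← Finset.sum_add_distrib]
  refine Finset.sum_congr rfl fun i _ => ?_
  rw [SkewAlgebroid.rho_mul]
  change _ = T.rho (Z i) (c i) x * evalSec μ Z x + c i x * T.rho (Z i) (evalSec μ Z) x
  ring

end Chart

end SkewAlg

namespace SkewAlg

/-! ### Linearity of the wedge product -/

section WedgeLinear

variable {V : Type*} [AddCommGroup V] [Module ℝ V] {k l p : ℕ} (h : k + l = p)

theorem wedgeAlt_smul_add (c : ℝ) (a a' : V [⋀^Fin k]→ₗ[ℝ] ℝ) (b : V [⋀^Fin l]→ₗ[ℝ] ℝ) :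
    wedgeAlt h (c • a + a') b = c • wedgeAlt h a b + wedgeAlt h a' b := by
  ext v
  have hk : (k.factorial * l.factorial : ℝ) ≠ 0 := by positivity
  apply mul_left_cancel₀ hk
  rw [AlternatingMap.add_apply, AlternatingMap.smul_apply, mul_add, smul_eq_mul, mul_left_comm,
    wedgeAlt_mul_factorial, wedgeAlt_mul_factorial, wedgeAlt_mul_factorial, Finset.mul_sum,
    ← Finset.sum_add_distrib]
  refine Finset.sum_congr rfl fun σ _ => ?_
  rw [AlternatingMap.add_apply, AlternatingMap.smul_apply, smul_eq_mul]
  ring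

theorem wedgeAlt_smul_right (c : ℝ) (a : V [⋀^Fin k]→ₗ[ℝ] ℝ) (b : V [⋀^Fin l]→ₗ[ℝ] ℝ) :
    wedgeAlt h a (c • b) = c • wedgeAlt h a b := by
  ext v
  have hk : (k.factorial * l.factorial : ℝ) ≠ 0 := by positivity
  apply mul_left_cancel₀ hk
  rw [AlternatingMap.smul_apply, smul_eq_mul, mul_left_comm, wedgeAlt_mul_factorial,
    wedgeAlt_mul_factorial, Finset.mul_sum]
  refine Finset.sum_congr rfl fun σ _ => ?_
  rw [AlternatingMap.smul_apply, smul_eq_mul]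
  ring

theorem wedgeAlt_zero_left (b : V [⋀^Fin l]→ₗ[ℝ] ℝ) :
    wedgeAlt h (0 : V [⋀^Fin k]→ₗ[ℝ] ℝ) b = 0 := by
  have := wedgeAlt_smul_add h 1 (0 : V [⋀^Fin k]→ₗ[ℝ] ℝ) 0 b
  rw [smul_zero, add_zero, one_smul] at this
  simpa using this

theorem wedgeAlt_zero_right (a : V [⋀^Fin k]→ₗ[ℝ] ℝ) :
    wedgeAlt h a (0 : V [⋀^Fin l]→ₗ[ℝ] ℝ) = 0 := by
  have := wedgeAlt_smul_right h 0 a (0 : V [⋀^Fin l]→ₗ[ℝ] ℝ)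
  simpa using this

end WedgeLinear

/-! ### Locality of the de Rham derivative and Cartan's formula in top degree -/

section DeRham

variable {m n : ℕ} {M : Type*} [TopologicalSpace M] [ChartedSpace (EuclideanSpace ℝ (Fin m)) M]
  [IsManifold (𝓡 m) ∞ M]
  {E : M → Type*} [∀ x, AddCommGroup (E x)] [∀ x, Module ℝ (E x)] [∀ x, TopologicalSpace (E x)]
  [TopologicalSpace (TotalSpace (EuclideanSpace ℝ (Fin n)) E)]
  [FiberBundle (EuclideanSpace ℝ (Fin n)) E] [VectorBundle ℝ (EuclideanSpace ℝ (Fin n)) E]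
  [ContMDiffVectorBundle ∞ (EuclideanSpace ℝ (Fin n)) E (𝓡 m)] [T2Space M]

theorem fct_sum_apply {ι : Type*} (t : Finset ι) (F : ι → Fct m M) (x : M) :
    (∑ i ∈ t, F i) x = ∑ i ∈ t, F i x := by
  let ev : Fct m M →+ ℝ :=
    { toFun := fun X => X x, map_zero' := rfl, map_add' := fun _ _ => rfl }
  exact map_sum ev F t

theorem sec_sum_apply {ι : Type*} (t : Finset ι) (F : ι → Sec m n E) (x : M) :
    (∑ i ∈ t, F i) x = ∑ i ∈ t, F i x := by
  let ev : Sec m n E →+ E x :=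
    { toFun := fun X => X x, map_zero' := rfl, map_add' := fun _ _ => rfl }
  exact map_sum ev F t

theorem form_apply_eq_zero {k : ℕ} (α : Form m n E k) (x : M)
    (h : ∀ X : Fin k → Sec m n E, evalSec α X x = 0) : α.1 x = 0 := by
  ext v
  choose X hX using fun i => exists_sec_eq (m := m) (n := n) x (v i)
  have := h X
  rw [evalSec_apply] at this
  simp only [hX] at this
  exact this

namespace SkewAlgebroid

variable (A : SkewAlgebroid m n E)

theorem evalSec_deRham {k : ℕ} (α : Form m n E k) : evalSec (A.deRham k α) = A.cartanAlt α :=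
  evalSec_formOf _ (A.cartanAlt_tensorial α)

/-- The de Rham derivative is a local operator. -/
theorem deRham_eq_zero {k : ℕ} {α : Form m n E k} {x : M} (h : ∀ᶠ y in 𝓝 x, α.1 y = 0) :
    (A.deRham k α).1 x = 0 := by
  refine form_apply_eq_zero _ x fun X => ?_
  have h0 : ∀ Z : Fin k → Sec m n E, ∀ᶠ y in 𝓝 x, evalSec α Z y = 0 := fun Z => by
    filter_upwards [h] with y hy
    rw [evalSec_apply, hy]; rfl
  rw [evalSec_deRham, cartanAlt_apply, fct_sum_apply]
  refine Finset.sum_eq_zero fun i _ => ?_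
  have h1 : (A.rho (X i) (evalSec α (i.removeNth X)) - (1 / 2 : ℝ) •
      ∑ j, evalSec α (update (i.removeNth X) j (A.bracket (X i) (i.removeNth X j)))) x = 0 := by
    change A.rho (X i) (evalSec α (i.removeNth X)) x - (1 / 2 : ℝ) *
      (∑ j, evalSec α (update (i.removeNth X) j (A.bracket (X i) (i.removeNth X j)))) x = 0
    rw [A.rho_const (X i) _ 0 (h0 _), fct_sum_apply, Finset.sum_eq_zero fun j _ =>
      (h0 _).self_of_nhds]
    simp
  let ev : Fct m M →+ ℝ :=
    { toFun := fun X => X x, map_zero' := rfl, map_add' := fun _ _ => rfl }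
  change ev ((-1) ^ (i : ℕ) • _) = 0
  rw [map_zsmul]
  exact (congrArg (_ • ·) h1).trans (smul_zero _)

theorem deRham_congr {k : ℕ} {α β : Form m n E k} {x : M} (h : ∀ᶠ y in 𝓝 x, α.1 y = β.1 y) :
    (A.deRham k α).1 x = (A.deRham k β).1 x := by
  have h1 : (A.deRham k (α - β)).1 x = 0 := A.deRham_eq_zero (by
    filter_upwards [h] with y hy
    change α.1 y - β.1 y = 0
    rw [hy, sub_self])
  have h2 : A.deRham k α = A.deRham k (α - β) + A.deRham k β := by
    have e : α - β + β = α := by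
      ext1
      funext y
      exact sub_add_cancel (α.1 y) (β.1 y)
    rw [← LinearMap.map_add, e]
  rw [h2]
  change (A.deRham k (α - β)).1 x + (A.deRham k β).1 x = _
  rw [h1, zero_add]

/-- Cartan's formula `d i_X ν = ℒ_X ν` for a form `ν` of top degree. -/
theorem cartanAlt_contract {k : ℕ} (hn : n < k + 2) (X : Sec m n E) (ν : Form m n E (k + 1))
    (Y : Fin (k + 1) → Sec m n E) :
    A.cartanAlt (contract X ν) Y = A.lieAlt X ν Y := by
  -- `dν` has degree above the rank. Expanding `dν(X, Y₀, …, Y_k) = 0` and isolating `X` gives the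
  -- formula.
  have h0 : A.cartanAlt ν (Fin.cons X Y : Fin (k + 2) → Sec m n E) = 0 := by
    rw [← evalSec_deRham, form_eq_zero_of_lt hn (A.deRham (k + 1) ν)]; rfl
  have r1 : ∀ i : Fin (k + 1), Fin.removeNth i.succ (Fin.cons X Y : Fin (k + 2) → Sec m n E) =
      Fin.cons X (i.removeNth Y) := fun i => by
    funext j
    refine Fin.cases ?_ (fun j => ?_) j
    · simp [Fin.removeNth]
    · simp [Fin.removeNth]
  have r0 : Fin.removeNth 0 (Fin.cons X Y : Fin (k + 2) → Sec m n E) = Y := Fin.removeNth_zero _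
  rw [cartanAlt_apply, Fin.sum_univ_succ] at h0
  simp only [r0, r1, Fin.cons_zero, Fin.cons_succ, Fin.val_succ, Fin.val_zero, pow_zero,
    one_smul] at h0
  have h1 : ∀ i : Fin (k + 1), ∑ j, evalSec ν (update (Fin.cons X (i.removeNth Y) :
      Fin (k + 1) → Sec m n E) j (A.bracket (Y i) ((Fin.cons X (i.removeNth Y) :
      Fin (k + 1) → Sec m n E) j))) =
      evalSec ν (Fin.cons (A.bracket (Y i) X) (i.removeNth Y) : Fin (k + 1) → Sec m n E) +
      ∑ j, evalSec (contract X ν) (update (i.removeNth Y) j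
        (A.bracket (Y i) (i.removeNth Y j))) := fun i => by
    rw [Fin.sum_univ_succ]
    simp only [Fin.cons_zero, Fin.cons_succ, Fin.update_cons_zero, ← Fin.cons_update,
      evalSec_contract]
  have h2 : ∀ i : Fin (k + 1), evalSec ν (update Y i (A.bracket X (Y i))) = -((-1) ^ (i : ℕ) •
      evalSec ν (Fin.cons (A.bracket (Y i) X) (i.removeNth Y) : Fin (k + 1) → Sec m n E)) :=
    fun i => by
      rw [A.bracket_skew X (Y i), AlternatingMap.map_update_neg, ← Fin.insertNth_removeNth,
        AlternatingMap.map_insertNth]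
      rfl
  -- The terms in which some `Yᵢ` differentiates give `-d(i_X ν)` and one half of the brackets of
  -- `X` with the `Yᵢ`. The term in which `X` differentiates supplies the other half, completing
  -- `ℒ_X ν`.
  have h3 : ∀ i : Fin (k + 1), (-1) ^ ((i : ℕ) + 1) •
      (A.rho (Y i) (evalSec ν (Fin.cons X (i.removeNth Y) : Fin (k + 1) → Sec m n E)) -
        (1 / 2 : ℝ) • (evalSec ν (Fin.cons (A.bracket (Y i) X) (i.removeNth Y) :
          Fin (k + 1) → Sec m n E) + ∑ j, evalSec (contract X ν) (update (i.removeNth Y) j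
            (A.bracket (Y i) (i.removeNth Y j))))) =
      (1 / 2 : ℝ) • (-1) ^ (i : ℕ) • evalSec ν (Fin.cons (A.bracket (Y i) X) (i.removeNth Y) :
          Fin (k + 1) → Sec m n E) -
      (-1) ^ (i : ℕ) • (A.rho (Y i) (evalSec (contract X ν) (i.removeNth Y)) -
        (1 / 2 : ℝ) • ∑ j, evalSec (contract X ν) (update (i.removeNth Y) j
            (A.bracket (Y i) (i.removeNth Y j)))) := fun i => by
    rw [← evalSec_contract, pow_succ]
    rcases neg_one_pow_eq_or ℤ (i : ℕ) with h | h <;> rw [h] <;> module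
  simp only [h1, h2, h3] at h0
  rw [Finset.sum_sub_distrib, Finset.sum_neg_distrib, ← Finset.smul_sum] at h0
  rw [cartanAlt_apply, lieAlt_apply]
  simp only [h2]
  rw [Finset.sum_neg_distrib]
  linear_combination (norm := module) -h0

end SkewAlgebroid

end DeRham

end SkewAlg

namespace SkewAlg

/-! ### Coefficient functions of top forms in a chart and their integrals -/

section ChartFn

variable {m : ℕ} {M : Type*} [TopologicalSpace M] [ChartedSpace (EuclideanSpace ℝ (Fin m)) M]

/-- The coefficient function of an `m`-form in the coordinates of the chart at `x₀`, extended by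
zero. -/
def chartFn (x₀ : M) (η : ∀ x : M, TangentSpace (𝓡 m) x [⋀^Fin m]→ₗ[ℝ] ℝ) :
    EuclideanSpace ℝ (Fin m) → ℝ :=
  (chartAt (EuclideanSpace ℝ (Fin m)) x₀).target.indicator fun u =>
    η ((chartAt (EuclideanSpace ℝ (Fin m)) x₀).symm u) fun a =>
      mfderiv (𝓡 m) (𝓡 m) (chartAt (EuclideanSpace ℝ (Fin m)) x₀).symm u
        (EuclideanSpace.single a (1 : ℝ) : EuclideanSpace ℝ (Fin m))

theorem chartIntegral_eq (x₀ : M) (η : ∀ x : M, TangentSpace (𝓡 m) x [⋀^Fin m]→ₗ[ℝ] ℝ) :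
    chartIntegral x₀ η = ∫ u, chartFn x₀ η u :=
  (MeasureTheory.integral_indicator
    (chartAt (EuclideanSpace ℝ (Fin m)) x₀).open_target.measurableSet).symm

theorem chartIntegral_smul (x₀ : M) (c : ℝ)
    (η : ∀ x : M, TangentSpace (𝓡 m) x [⋀^Fin m]→ₗ[ℝ] ℝ) :
    chartIntegral x₀ (c • η) = c * chartIntegral x₀ η :=
  MeasureTheory.integral_const_mul c _

theorem chartFn_of_notMem {x₀ : M} {η : ∀ x : M, TangentSpace (𝓡 m) x [⋀^Fin m]→ₗ[ℝ] ℝ}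
    {K : Set M} (hη : ∀ x ∉ K, η x = 0) {u : EuclideanSpace ℝ (Fin m)}
    (hu : u ∉ chartAt (EuclideanSpace ℝ (Fin m)) x₀ '' K) : chartFn x₀ η u = 0 := by
  refine Set.indicator_apply_eq_zero.2 fun ht => ?_
  rw [hη _ fun hK => hu ⟨_, hK, (chartAt (EuclideanSpace ℝ (Fin m)) x₀).right_inv ht⟩]
  rfl

variable [IsManifold (𝓡 m) ∞ M] {x₀ : M}

theorem chartFn_apply (η : ∀ x : M, TangentSpace (𝓡 m) x [⋀^Fin m]→ₗ[ℝ] ℝ) {x : M}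
    (hx : x ∈ (chartAt (EuclideanSpace ℝ (Fin m)) x₀).source) :
    chartFn x₀ η (chartAt (EuclideanSpace ℝ (Fin m)) x₀ x) = η x fun a => coordField x₀ a x := by
  rw [chartFn, Set.indicator_of_mem ((chartAt (EuclideanSpace ℝ (Fin m)) x₀).map_source hx)]
  -- Going to the chart and back returns `x` only up to a proved equality, on which the type of `η`
  -- depends. The point is generalized so that the equality can be substituted.
  have h : ∀ (y : M) (hy : y = x), (η y fun a =>
      mfderiv (𝓡 m) (𝓡 m) (chartAt (EuclideanSpace ℝ (Fin m)) x₀).symm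
        (chartAt (EuclideanSpace ℝ (Fin m)) x₀ x)
        (EuclideanSpace.single a (1 : ℝ) : EuclideanSpace ℝ (Fin m))) =
      η x fun a => coordField x₀ a x := by
    rintro y rfl
    congr 1
    funext a
    exact (coordField_eq hx a).symm
  exact h _ ((chartAt (EuclideanSpace ℝ (Fin m)) x₀).left_inv hx)

variable [T2Space M]

theorem isCompact_image_chart {K : Set M} (hK : IsCompact K)
    (hKs : K ⊆ (chartAt (EuclideanSpace ℝ (Fin m)) x₀).source) :
    IsCompact (chartAt (EuclideanSpace ℝ (Fin m)) x₀ '' K) :=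
  hK.image_of_continuousOn ((chartAt (EuclideanSpace ℝ (Fin m)) x₀).continuousOn.mono hKs)

theorem eventually_chartFn {η : ∀ x : M, TangentSpace (𝓡 m) x [⋀^Fin m]→ₗ[ℝ] ℝ} {x : M}
    (hx : x ∈ (chartAt (EuclideanSpace ℝ (Fin m)) x₀).source) {F : Fct m M}
    (h : ∀ᶠ y in 𝓝 x, (η y fun a => coordField x₀ a y) = F y) :
    ∀ᶠ u in 𝓝 (chartAt (EuclideanSpace ℝ (Fin m)) x₀ x),
      chartFn x₀ η u = F ((chartAt (EuclideanSpace ℝ (Fin m)) x₀).symm u) := by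
  have hu := (chartAt (EuclideanSpace ℝ (Fin m)) x₀).map_source hx
  have hc := (chartAt (EuclideanSpace ℝ (Fin m)) x₀).continuousAt_symm hu
  rw [ContinuousAt, (chartAt (EuclideanSpace ℝ (Fin m)) x₀).left_inv hx] at hc
  filter_upwards [hc.eventually h,
    (chartAt (EuclideanSpace ℝ (Fin m)) x₀).open_target.mem_nhds hu] with u h1 h2
  have h3 := chartFn_apply η ((chartAt (EuclideanSpace ℝ (Fin m)) x₀).map_target h2)
  rw [(chartAt (EuclideanSpace ℝ (Fin m)) x₀).right_inv h2] at h3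
  rw [h3, h1]

theorem contDiffAt_comp_symm (F : Fct m M) {u : EuclideanSpace ℝ (Fin m)}
    (hu : u ∈ (chartAt (EuclideanSpace ℝ (Fin m)) x₀).target) :
    ContDiffAt ℝ ∞ (fun u => F ((chartAt (EuclideanSpace ℝ (Fin m)) x₀).symm u)) u :=
  contMDiffAt_iff_contDiffAt.1
    ((F.contMDiff _).comp u (contMDiffAt_chartAt_symm hu))

/-- The coefficient function of an `m`-form with compact support that is smooth near its support. -/
theorem contDiff_chartFn {η : ∀ x : M, TangentSpace (𝓡 m) x [⋀^Fin m]→ₗ[ℝ] ℝ} {K : Set M}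
    (hK : IsCompact K) (hKs : K ⊆ (chartAt (EuclideanSpace ℝ (Fin m)) x₀).source)
    (hη : ∀ x ∉ K, η x = 0) (hsm : ∀ x ∈ K, ∃ μ : DForm m M m, ∀ᶠ y in 𝓝 x, η y = μ.1 y) :
    ContDiff ℝ ∞ (chartFn x₀ η) ∧ HasCompactSupport (chartFn x₀ η) := by
  have hKc := isCompact_image_chart hK hKs
  refine ⟨contDiff_iff_contDiffAt.2 fun u => ?_, ?_⟩
  · by_cases hu : u ∈ chartAt (EuclideanSpace ℝ (Fin m)) x₀ '' K
    · obtain ⟨x, hx, rfl⟩ := hu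
      obtain ⟨μ, hμ⟩ := hsm x hx
      obtain ⟨Z, hZ⟩ := exists_coordFields (hKs hx)
      have h := eventually_chartFn (hKs hx) (F := evalSec μ Z) (η := η) (by
        filter_upwards [hμ, hZ] with y h1 h2
        rw [h1, evalSec_apply]
        simp only [h2])
      exact (contDiffAt_comp_symm _
        ((chartAt (EuclideanSpace ℝ (Fin m)) x₀).map_source (hKs hx))).congr_of_eventuallyEq h
    · refine contDiffAt_const (c := (0 : ℝ)) |>.congr_of_eventuallyEq ?_
      filter_upwards [hKc.isClosed.isOpen_compl.mem_nhds hu] with u' hu'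
      exact chartFn_of_notMem hη hu'
  · exact HasCompactSupport.intro hKc fun u hu => chartFn_of_notMem hη hu

end ChartFn

/-- Integration by parts against the constant function 1. -/
theorem integral_fderiv_eq_zero {V : Type*} [NormedAddCommGroup V] [NormedSpace ℝ V]
    [FiniteDimensional ℝ V] [MeasurableSpace V] [BorelSpace V] (μ : MeasureTheory.Measure V)
    [μ.IsAddHaarMeasure] {G : V → ℝ} (hG : ContDiff ℝ ∞ G)
    (hc : HasCompactSupport G) (v : V) :
    MeasureTheory.Integrable (fun u => fderiv ℝ G u v) μ ∧ ∫ u, fderiv ℝ G u v ∂μ = 0 := by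
  have h1 : Continuous fun u => fderiv ℝ G u v :=
    (hG.continuous_fderiv (by simp)).clm_apply continuous_const
  have h2 : MeasureTheory.Integrable (fun u => fderiv ℝ G u v) μ :=
    h1.integrable_of_hasCompactSupport (hc.fderiv_apply ℝ v)
  refine ⟨h2, ?_⟩
  have h := integral_mul_fderiv_eq_neg_fderiv_mul_of_integrable (μ := μ) (f := fun _ : V => (1 : ℝ))
    (g := G) (v := v) (by simp) (by simpa using h2)
    (by simpa using hG.continuous.integrable_of_hasCompactSupport hc)
    (fun x _ => differentiableAt_const _) (fun x _ => (hG.differentiable (by simp)) x)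
  simpa using h

/-! ### The operators `S(σ)` and products of superfunctions -/

section Berezin

variable {m n : ℕ} {M : Type*} [TopologicalSpace M] [ChartedSpace (EuclideanSpace ℝ (Fin m)) M]
  [IsManifold (𝓡 m) ∞ M]
  {E : M → Type*} [∀ x, AddCommGroup (E x)] [∀ x, Module ℝ (E x)] [∀ x, TopologicalSpace (E x)]
  [TopologicalSpace (TotalSpace (EuclideanSpace ℝ (Fin n)) E)]
  [FiberBundle (EuclideanSpace ℝ (Fin n)) E]

/-- The `m`-form obtained by contraction of a section of `L^E` with an `n`-form on `E`. -/
def berForm (σ : ∀ x, LFib m n E x) (β : Form m n E n) (x : M) :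
    TangentSpace (𝓡 m) x [⋀^Fin m]→ₗ[ℝ] ℝ :=
  contractL ((β.1 x).domDomCongr Fin.revPerm) (σ x)

/-- The sign of the order-reversing permutation. -/
def revSign (n : ℕ) : ℝ := ((Equiv.Perm.sign (Fin.revPerm (n := n)) : ℤ) : ℝ)

theorem revSign_mul_self (n : ℕ) : revSign n * revSign n = 1 := by
  rw [revSign, ← Int.cast_mul, ← Units.val_mul, ← sq, Int.units_sq]; simp

/-- The reversed order of the factors costs a sign depending on `n` alone, so it factors out of all
identities between Berezinian sections. -/
theorem berForm_of_eq {σ : ∀ x, LFib m n E x} {Y : Fin n → Sec m n E} {μ : DForm m M m} {x : M}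
    (h : σ x = decomp Y μ x) (β : Form m n E n) :
    berForm σ β x = (revSign n * β.1 x fun i => Y i x) • μ.1 x := by
  rw [berForm, h, decomp, contractL_tmul]
  congr 1
  rw [AlternatingMap.domDomCongr_apply, AlternatingMap.map_perm, Units.smul_def, zsmul_eq_mul]
  rfl

theorem berForm_of_eq_zero {σ : ∀ x, LFib m n E x} {β : Form m n E n} {x : M} (h : β.1 x = 0) :
    berForm σ β x = 0 := by
  have h0 : contractL (m := m) (0 : E x [⋀^Fin n]→ₗ[ℝ] ℝ) = 0 := by
    simp [contractL]
  have h1 : (0 : E x [⋀^Fin n]→ₗ[ℝ] ℝ).domDomCongr Fin.revPerm = 0 := rfl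
  rw [berForm, h, h1, h0]
  rfl

variable [VectorBundle ℝ (EuclideanSpace ℝ (Fin n)) E]

theorem exists_berForm_eq {U : Set M} {σ : ∀ x, LFib m n E x} (hσ : IsSmoothL U σ)
    (β : Form m n E n) {x : M} (hx : x ∈ U) :
    ∃ μ : DForm m M m, ∀ᶠ y in 𝓝 x, berForm σ β y = μ.1 y := by
  obtain ⟨Y, μ, h⟩ := hσ x hx
  refine ⟨formMul (revSign n • evalSec β Y) μ, ?_⟩
  filter_upwards [h] with y hy
  rw [berForm_of_eq hy]
  rfl

variable [T2Space M] {x₀ : M}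

theorem contDiff_chartFn_berForm {U K : Set M}
    (hU : U ⊆ (chartAt (EuclideanSpace ℝ (Fin m)) x₀).source) (hK : IsCompact K) (hKU : K ⊆ U)
    {σ : ∀ x, LFib m n E x} (hσ : IsSmoothL U σ) {β : Form m n E n} (hβ : ∀ x ∉ K, β.1 x = 0) :
    ContDiff ℝ ∞ (chartFn x₀ (berForm σ β)) ∧ HasCompactSupport (chartFn x₀ (berForm σ β)) :=
  contDiff_chartFn hK (hKU.trans hU) (fun x hx => berForm_of_eq_zero (hβ x hx))
    fun _ hx => exists_berForm_eq hσ β (hKU hx)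

theorem integrable_chartFn_berForm {U K : Set M}
    (hU : U ⊆ (chartAt (EuclideanSpace ℝ (Fin m)) x₀).source) (hK : IsCompact K) (hKU : K ⊆ U)
    {σ : ∀ x, LFib m n E x} (hσ : IsSmoothL U σ) {β : Form m n E n} (hβ : ∀ x ∉ K, β.1 x = 0) :
    MeasureTheory.Integrable (chartFn x₀ (berForm σ β)) :=
  have h := contDiff_chartFn_berForm hU hK hKU hσ hβ
  h.1.continuous.integrable_of_hasCompactSupport h.2

theorem wedge_apply {k l p : ℕ} (h : k + l = p) (α : Form m n E k) (β : Form m n E l) (x : M) :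
    (wedge h α β).1 x = wedgeAlt h (α.1 x) (β.1 x) := rfl

theorem ofDegree_self {k : ℕ} (α : Form m n E k) : ofDegree k α k = α := Pi.single_eq_same _ _

theorem ofDegree_of_ne {k l : ℕ} (h : l ≠ k) (α : Form m n E k) : ofDegree k α l = 0 :=
  Pi.single_eq_of_ne h _

theorem superMul_ofDegree_left {k l p : ℕ} (h : k + l = p) (α : Form m n E k)
    (f : SuperFn m n E) : superMul (ofDegree k α) f p = wedge h α (f l) := by
  have hm : (k, l) ∈ Finset.HasAntidiagonal.antidiagonal p :=
    Finset.HasAntidiagonal.mem_antidiagonal.2 h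
  rw [superMul, Finset.sum_eq_single ⟨(k, l), hm⟩]
  · change wedge _ (ofDegree k α k) (f l) = _
    rw [ofDegree_self]
  · rintro ⟨⟨i, j⟩, hq⟩ _ hne
    have hi : i ≠ k := by
      rintro rfl
      have := Finset.HasAntidiagonal.mem_antidiagonal.1 hq
      apply hne
      congr
      simp at this
      omega
    ext1
    funext x
    rw [wedge_apply, ofDegree_of_ne hi]
    exact wedgeAlt_zero_left _ _
  · exact fun h => absurd (Finset.mem_attach _ _) h

theorem superMul_ofDegree_left_of_lt {k p : ℕ} (h : p < k) (α : Form m n E k)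
    (f : SuperFn m n E) : superMul (ofDegree k α) f p = 0 := by
  refine Finset.sum_eq_zero ?_
  rintro ⟨⟨i, j⟩, hq⟩ _
  have hi : i ≠ k := by
    rintro rfl
    have := Finset.HasAntidiagonal.mem_antidiagonal.1 hq
    simp at this
    omega
  ext1
  funext x
  rw [wedge_apply, ofDegree_of_ne hi]
  exact wedgeAlt_zero_left _ _

theorem superMul_ofDegree_right {k l p : ℕ} (h : k + l = p) (g : SuperFn m n E)
    (β : Form m n E l) : superMul g (ofDegree l β) p = wedge h (g k) β := by
  have hm : (k, l) ∈ Finset.HasAntidiagonal.antidiagonal p :=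
    Finset.HasAntidiagonal.mem_antidiagonal.2 h
  rw [superMul, Finset.sum_eq_single ⟨(k, l), hm⟩]
  · change wedge _ (g k) (ofDegree l β l) = _
    rw [ofDegree_self]
  · rintro ⟨⟨i, j⟩, hq⟩ _ hne
    have hj : j ≠ l := by
      rintro rfl
      have := Finset.HasAntidiagonal.mem_antidiagonal.1 hq
      apply hne
      congr
      simp at this
      omega
    ext1
    funext x
    rw [wedge_apply, ofDegree_of_ne hj]
    exact wedgeAlt_zero_right _ _
  · exact fun h => absurd (Finset.mem_attach _ _) h

end Berezin

end SkewAlg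

namespace SkewAlg

/-! ### Global extensions of coordinate functions -/

section Coordinates

variable {m : ℕ} {M : Type*} [TopologicalSpace M] [ChartedSpace (EuclideanSpace ℝ (Fin m)) M]
  [IsManifold (𝓡 m) ∞ M] [T2Space M] [SigmaCompactSpace M] {x₀ : M}

/-- Global smooth functions that agree with the coordinates of a chart near a compact set. -/
theorem exists_coordFcts {K : Set M} (hK : IsCompact K)
    (hKs : K ⊆ (chartAt (EuclideanSpace ℝ (Fin m)) x₀).source) :
    ∃ ξ : Fin m → Fct m M, ∀ x ∈ K, ∀ᶠ y in 𝓝 x, ∀ i,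
      ξ i y = chartAt (EuclideanSpace ℝ (Fin m)) x₀ y i := by
  have : LocallyCompactSpace M := Manifold.locallyCompact_of_finiteDimensional (𝓡 m)
  obtain ⟨L, hL, hKL, hLs⟩ := exists_compact_between hK
    (chartAt (EuclideanSpace ℝ (Fin m)) x₀).open_source hKs
  -- A cut-off equal to 1 on a neighbourhood of `K`, so that the products with the coordinates also
  -- have the correct derivatives on `K`.
  obtain ⟨χ, h1, h0, -⟩ := exists_contMDiffMap_one_nhds_of_subset_interior (n := ⊤) (𝓡 m)
    hK.isClosed hKL
  have hsupp : tsupport χ ⊆ L := by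
    refine closure_minimal (fun x hx => ?_) hL.isClosed
    by_contra hxL
    exact hx (h0 x hxL)
  have hsm : ∀ i : Fin m, ContMDiff (𝓡 m) 𝓘(ℝ, ℝ) ∞
      fun y => χ y * chartAt (EuclideanSpace ℝ (Fin m)) x₀ y i := fun i => by
    refine contMDiff_of_tsupport fun y hy => ?_
    have hy' := hLs (hsupp (tsupport_mul_subset_left hy))
    have hp : ContDiff ℝ ∞ fun u : EuclideanSpace ℝ (Fin m) => u i :=
      (EuclideanSpace.proj i : EuclideanSpace ℝ (Fin m) →L[ℝ] ℝ).contDiff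
    exact (χ.contMDiff y).mul (hp.contDiffAt.contMDiffAt.comp y (contMDiffAt_chartAt hy'))
  refine ⟨fun i => ⟨_, hsm i⟩, fun x hx => ?_⟩
  filter_upwards [h1.filter_mono (nhds_le_nhdsSet hx)] with y hy i
  change χ y * _ = _
  rw [hy, one_mul]

end Coordinates

/-! ### Forms of degree one below the rank as contractions -/

section TopContraction

variable {m k : ℕ} {M : Type*} [TopologicalSpace M] [ChartedSpace (EuclideanSpace ℝ (Fin m)) M]
  [IsManifold (𝓡 m) ∞ M]
  {E : M → Type*} [∀ x, AddCommGroup (E x)] [∀ x, Module ℝ (E x)] [∀ x, TopologicalSpace (E x)]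
  [TopologicalSpace (TotalSpace (EuclideanSpace ℝ (Fin (k + 1))) E)]
  [FiberBundle (EuclideanSpace ℝ (Fin (k + 1))) E]
  [VectorBundle ℝ (EuclideanSpace ℝ (Fin (k + 1))) E]
  [ContMDiffVectorBundle ∞ (EuclideanSpace ℝ (Fin (k + 1))) E (𝓡 m)] [T2Space M]

/-- Near a point where `Y` is a frame, a form of degree one below the rank is the contraction of the
dual volume form with a section. -/
theorem exists_contract_eq {Y : Fin (k + 1) → Sec m (k + 1) E} {μ : DForm m M m} {x : M}
    (h : decomp Y μ x ≠ 0) (α : Form m (k + 1) E k) :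
    ∃ (ν : Form m (k + 1) E (k + 1)) (X : Sec m (k + 1) E),
      (∀ᶠ y in 𝓝 x, evalSec ν Y y = 1) ∧ ∀ᶠ y in 𝓝 x, α.1 y = (contract X ν).1 y := by
  obtain ⟨ν, W, hν⟩ := exists_pairL_injective m (k + 1) E x
  have h1 : evalSec ν Y x ≠ 0 := fun h0 => h <| hν.self_of_nhds <| by
    rw [pairL_decomp, map_zero]
    change evalSec ν Y x * _ = 0
    rw [h0, zero_mul]
  obtain ⟨g, hg⟩ := exists_mul_eq_one _ h1
  have h2 : ∀ᶠ y in 𝓝 x, evalSec (formMul g ν) Y y = 1 := by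
    filter_upwards [hg] with y hy
    rw [← hy]
    rfl
  -- `ν` is normalized to the value 1 on `Y`. The section is the one of `eq_contraction`, with
  -- smooth coefficients the values of `α` on the frame with one vector removed.
  refine ⟨formMul g ν, ∑ j : Fin (k + 1),
    fsmul ((-1 : ℝ) ^ (j : ℕ) • evalSec α (j.removeNth Y)) (Y j), h2, ?_⟩
  filter_upwards [h2] with y hy
  have := finiteDimensional_fiber (k + 1) E y
  refine (eq_contraction (finrank_fiber (k + 1) E y) ((formMul g ν).1 y) (fun i => Y i y) hy
    (α.1 y)).trans ?_
  change _ = ((formMul g ν).1 y).curryLeft ((∑ j : Fin (k + 1),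
    fsmul ((-1 : ℝ) ^ (j : ℕ) • evalSec α (j.removeNth Y)) (Y j)) y)
  rw [sec_sum_apply]
  rfl

/-- Contracting `θ ∧ ν = 0` with `X` gives `θ ∧ i_X ν = θ(X) ν`, and `ν(Y) = 1`. -/
theorem wedge_one_apply_of_eq_contract (h : 1 + k = k + 1) {Y : Fin (k + 1) → Sec m (k + 1) E}
    {ν : Form m (k + 1) E (k + 1)} {X : Sec m (k + 1) E} {α : Form m (k + 1) E k} {y : M}
    (hν : evalSec ν Y y = 1) (hα : α.1 y = (contract X ν).1 y) (θ : Form m (k + 1) E 1) :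
    ((wedge h θ α).1 y fun i => Y i y) = θ.1 y fun _ => X y := by
  have := finiteDimensional_fiber (k + 1) E y
  let t : E y →ₗ[ℝ] ℝ :=
    { toFun := fun v => θ.1 y fun _ => v
      map_add' := fun v w => by
        have := (θ.1 y).map_update_add (fun _ => v) 0 v w
        simp only [update_eq_const_of_subsingleton] at this
        exact this
      map_smul' := fun c v => by
        have := (θ.1 y).map_update_smul (fun _ => v) 0 c v
        simp only [update_eq_const_of_subsingleton] at this
        exact this }
  have h1 := sum_removeNth_cons (finrank_fiber (k + 1) E y) (ν.1 y) t (X y) fun i => Y i y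
  rw [wedge_apply, wedgeAlt_one_apply, hα]
  refine Eq.trans h1 ?_
  rw [evalSec_apply] at hν
  rw [hν, mul_one]
  rfl

end TopContraction

end SkewAlg

namespace SkewAlg

/-! ### The Berezin integral of `dα + φ ∧ α` -/

section Divergence

variable {m n k : ℕ} {M : Type*} [TopologicalSpace M] [ChartedSpace (EuclideanSpace ℝ (Fin m)) M]
  [IsManifold (𝓡 m) ∞ M]

/-- A smooth function as a form of degree zero. -/
def fctForm (E : M → Type*) [∀ x, AddCommGroup (E x)] [∀ x, Module ℝ (E x)]
    [∀ x, TopologicalSpace (E x)] [TopologicalSpace (TotalSpace (EuclideanSpace ℝ (Fin n)) E)]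
    [FiberBundle (EuclideanSpace ℝ (Fin n)) E] (F : Fct m M) : Form m n E 0 :=
  ⟨fun x => AlternatingMap.constOfIsEmpty ℝ (E x) (Fin 0) (F x), fun _ => F.contMDiff⟩

variable {E : M → Type*} [∀ x, AddCommGroup (E x)] [∀ x, Module ℝ (E x)]
  [∀ x, TopologicalSpace (E x)]
  [TopologicalSpace (TotalSpace (EuclideanSpace ℝ (Fin (k + 1))) E)]
  [FiberBundle (EuclideanSpace ℝ (Fin (k + 1))) E]
  [VectorBundle ℝ (EuclideanSpace ℝ (Fin (k + 1))) E]
  [ContMDiffVectorBundle ∞ (EuclideanSpace ℝ (Fin (k + 1))) E (𝓡 m)] [T2Space M]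
  (A : SkewAlgebroid m (k + 1) E) {x₀ : M}

theorem AbsSection.IsRep.exists_decomp {m n : ℕ} {M : Type*} [TopologicalSpace M]
    [ChartedSpace (EuclideanSpace ℝ (Fin m)) M] [IsManifold (𝓡 m) ∞ M]
    {E : M → Type*} [∀ x, AddCommGroup (E x)] [∀ x, Module ℝ (E x)] [∀ x, TopologicalSpace (E x)]
    [TopologicalSpace (TotalSpace (EuclideanSpace ℝ (Fin n)) E)]
    [FiberBundle (EuclideanSpace ℝ (Fin n)) E] {s : AbsSection m n E} {U : Set M}
    {σ : ∀ x, LFib m n E x} (hσ : s.IsRep U σ) (hU : IsOpen U) {x : M} (hx : x ∈ U) :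
    ∃ Y μ, (∀ᶠ y in 𝓝 x, σ y = decomp Y μ y) ∧ s.RepAt x Y μ := by
  obtain ⟨Y, μ, h⟩ := hσ.1 x hx
  refine ⟨Y, μ, h, ?_⟩
  filter_upwards [h, hU.mem_nhds hx] with y h1 h2
  rw [← h1, hσ.2 y h2]

/-- The central computation: with `α = i_X ν`, the left side is `±(ℒ_{ρ(X)} μ)(∂₁, …, ∂ₘ)` and the
right side is its expression as a divergence. The right side is written with `dξᵢ ∧ α` because that
form, unlike `X`, does not depend on local choices. -/
theorem SkewAlgebroid.chartFn_deRham_add_modularForm (h : 1 + k = k + 1) {U : Set M}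
    (hUo : IsOpen U) {s : AbsSection m (k + 1) E} {σ : ∀ x, LFib m (k + 1) E x}
    (hσ : s.IsRep U σ) {x : M} (hxU : x ∈ U)
    (hx : x ∈ (chartAt (EuclideanSpace ℝ (Fin m)) x₀).source) {ξ : Fin m → Fct m M}
    (hξ : ∀ᶠ y in 𝓝 x, ∀ i, ξ i y = chartAt (EuclideanSpace ℝ (Fin m)) x₀ y i)
    (α : Form m (k + 1) E k) :
    chartFn x₀ (berForm σ (A.deRham k α)) (chartAt (EuclideanSpace ℝ (Fin m)) x₀ x) +
      chartFn x₀ (berForm σ (wedge h (A.modularForm s) α))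
        (chartAt (EuclideanSpace ℝ (Fin m)) x₀ x) =
      ∑ i, fderiv ℝ (chartFn x₀ (berForm σ (wedge h (A.deRham 0 (fctForm E (ξ i))) α)))
        (chartAt (EuclideanSpace ℝ (Fin m)) x₀ x) (EuclideanSpace.single i 1) := by
  obtain ⟨Y, μ, hY, hR⟩ := hσ.exists_decomp hUo hxU
  obtain ⟨Z, hZ⟩ := exists_coordFields hx
  obtain ⟨ν, X, hν, hα⟩ := exists_contract_eq hR.ne_zero α
  have hZx : (fun a => coordField x₀ a x) = fun a => Z a x :=
    funext fun a => (hZ.self_of_nhds a).symm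
  have h1 : ((A.deRham k α).1 x fun i => Y i x) = A.lieAlt X ν Y x := by
    rw [A.deRham_congr hα, ← evalSec_apply, A.evalSec_deRham, A.cartanAlt_contract (by omega)]
  have h2 := wedge_one_apply_of_eq_contract h hν.self_of_nhds hα.self_of_nhds (A.modularForm s)
  -- This is `∇_X σ = φ(X) σ` in the coordinate given by `ν` and the `∂ₐ`. As `ν(Y) = 1` near `x`,
  -- the term `ρ(X)(ν(Y))` vanishes.
  have h3 : (tangentAlgebroid m M).lieAlt (A.anchorSec X) μ Z x =
      (A.lieAlt X ν Y x + (A.modularForm s).1 x fun _ => X x) * evalSec μ Z x := by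
    have hn := congrArg (pairL (ν.1 x) fun j => Z j x) (A.nabla_eq_modularCoeff hR X)
    rw [A.pairL_nabla, map_smul, pairL_decomp, smul_eq_mul] at hn
    change (A.rho X (evalSec ν Y) x - A.lieAlt X ν Y x) * evalSec μ Z x +
      evalSec ν Y x * (tangentAlgebroid m M).lieAlt (A.anchorSec X) μ Z x =
      A.modularCoeff s X x * (evalSec ν Y x * evalSec μ Z x) at hn
    rw [A.rho_const X _ 1 hν, hν.self_of_nhds] at hn
    rw [A.modularForm_apply]
    linear_combination hn
  -- `(dξᵢ ∧ α)(Y) = ρ(X)(ξᵢ)` is the `i`-th component of `ρ(X)`. It is identified on a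
  -- neighbourhood, as it is to be differentiated.
  have h4 : ∀ i, fderiv ℝ (chartFn x₀ (berForm σ (wedge h (A.deRham 0 (fctForm E (ξ i))) α)))
        (chartAt (EuclideanSpace ℝ (Fin m)) x₀ x) (EuclideanSpace.single i 1) =
      revSign (k + 1) * (tangentAlgebroid m M).rho (Z i)
        ((tangentAlgebroid m M).rho (A.anchorSec X) (ξ i) * evalSec μ Z) x := fun i => by
    have he := eventually_chartFn hx (F := revSign (k + 1) •
      (A.rho X (ξ i) * evalSec μ Z))
      (η := berForm σ (wedge h (A.deRham 0 (fctForm E (ξ i))) α)) (by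
        filter_upwards [hY, hZ, hν, hα] with y g1 g2 g3 g4
        rw [berForm_of_eq g1, wedge_one_apply_of_eq_contract h g3 g4, A.deRham_zero_apply]
        change revSign (k + 1) * A.rho X (ξ i) y * (μ.1 y fun a => coordField x₀ a y) =
          revSign (k + 1) * (A.rho X (ξ i) y * μ.1 y fun a => Z a y)
        simp only [g2]
        ring)
    rw [Filter.EventuallyEq.fderiv_eq he, ← mvfderiv_coordField _ hx, ← hZ.self_of_nhds i,
      A.rho_anchorSec]
    change (tangentAlgebroid m M).rho (Z i) (revSign (k + 1) • (A.rho X (ξ i) * evalSec μ Z)) x = _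
    rw [map_smul]
    rfl
  rw [Finset.sum_congr rfl fun i _ => h4 i, ← Finset.mul_sum, ← lieAlt_coord hx hZ hξ, h3,
    chartFn_apply _ hx, chartFn_apply _ hx, berForm_of_eq hY.self_of_nhds,
    berForm_of_eq hY.self_of_nhds, hZx, h1, h2]
  change revSign (k + 1) * A.lieAlt X ν Y x * evalSec μ Z x +
    revSign (k + 1) * ((A.modularForm s).1 x fun _ => X x) * evalSec μ Z x = _
  ring

/-- The Berezin integral of `dα + φ ∧ α` vanishes for the modular form `φ`. -/
theorem SkewAlgebroid.chartIntegral_deRham_add_modularForm [SigmaCompactSpace M] (h : 1 + k = k + 1)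
    {U K : Set M} (hUo : IsOpen U) (hU : U ⊆ (chartAt (EuclideanSpace ℝ (Fin m)) x₀).source)
    (hK : IsCompact K) (hKU : K ⊆ U) {s : AbsSection m (k + 1) E}
    {σ : ∀ x, LFib m (k + 1) E x} (hσ : s.IsRep U σ) {α : Form m (k + 1) E k}
    (hα : ∀ x ∉ K, α.1 x = 0) :
    chartIntegral x₀ (berForm σ (A.deRham k α)) +
      chartIntegral x₀ (berForm σ (wedge h (A.modularForm s) α)) = 0 := by
  obtain ⟨ξ, hξ⟩ := exists_coordFcts hK (hKU.trans hU)
  have hd : ∀ x ∉ K, (A.deRham k α).1 x = 0 := fun x hx => A.deRham_eq_zero <| by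
    filter_upwards [hK.isClosed.isOpen_compl.mem_nhds hx] with y hy using hα y hy
  have hw : ∀ θ : Form m (k + 1) E 1, ∀ x ∉ K, (wedge h θ α).1 x = 0 := fun θ x hx => by
    rw [wedge_apply, hα x hx, wedgeAlt_zero_right]
  have hW := fun i => contDiff_chartFn_berForm hU hK hKU hσ.1 (hw (A.deRham 0 (fctForm E (ξ i))))
  have hI := fun i => integral_fderiv_eq_zero MeasureTheory.volume (hW i).1 (hW i).2
    (EuclideanSpace.single i (1 : ℝ))
  rw [chartIntegral_eq, chartIntegral_eq,
    ← MeasureTheory.integral_add (integrable_chartFn_berForm hU hK hKU hσ.1 hd)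
      (integrable_chartFn_berForm hU hK hKU hσ.1 (hw _))]
  -- Inside the image of `K` this is the pointwise computation, with local choices depending on the
  -- point. Outside this compact set all coefficient functions vanish identically near `u`.
  have key : ∀ u, chartFn x₀ (berForm σ (A.deRham k α)) u +
      chartFn x₀ (berForm σ (wedge h (A.modularForm s) α)) u =
      ∑ i, fderiv ℝ (chartFn x₀ (berForm σ (wedge h (A.deRham 0 (fctForm E (ξ i))) α))) u
        (EuclideanSpace.single i 1) := fun u => by
    by_cases hu : u ∈ chartAt (EuclideanSpace ℝ (Fin m)) x₀ '' K
    · obtain ⟨x, hx, rfl⟩ := hu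
      exact A.chartFn_deRham_add_modularForm h hUo hσ (hKU hx) (hU (hKU hx)) (hξ x hx) α
    · rw [chartFn_of_notMem (fun x hx => berForm_of_eq_zero (hd x hx)) hu,
        chartFn_of_notMem (fun x hx => berForm_of_eq_zero (hw _ x hx)) hu, add_zero]
      symm
      refine Finset.sum_eq_zero fun i _ => ?_
      have he : chartFn x₀ (berForm σ (wedge h (A.deRham 0 (fctForm E (ξ i))) α)) =ᶠ[𝓝 u]
          fun _ => 0 := by
        filter_upwards [(isCompact_image_chart hK (hKU.trans hU)).isClosed.isOpen_compl.mem_nhds hu]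
          with u' hu'
        exact chartFn_of_notMem (fun x hx => berForm_of_eq_zero (hw _ x hx)) hu'
      rw [he.fderiv_eq]
      simp
  simp only [key]
  rw [MeasureTheory.integral_finsetSum _ fun i _ => (hI i).1]
  exact Finset.sum_eq_zero fun i _ => (hI i).2

end Divergence

/-! ### The modular form as superdivergence -/

section Superdivergence

variable {m n : ℕ} {M : Type*} [TopologicalSpace M] [ChartedSpace (EuclideanSpace ℝ (Fin m)) M]
  [IsManifold (𝓡 m) ∞ M]
  {E : M → Type*} [∀ x, AddCommGroup (E x)] [∀ x, Module ℝ (E x)] [∀ x, TopologicalSpace (E x)]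
  [TopologicalSpace (TotalSpace (EuclideanSpace ℝ (Fin n)) E)]
  [FiberBundle (EuclideanSpace ℝ (Fin n)) E] [VectorBundle ℝ (EuclideanSpace ℝ (Fin n)) E]
  [ContMDiffVectorBundle ∞ (EuclideanSpace ℝ (Fin n)) E (𝓡 m)] [T2Space M] [SigmaCompactSpace M]

/-- The modular form is a superdivergence of the de Rham vector field. -/
theorem SkewAlgebroid.isSuperdiv_modularForm (A : SkewAlgebroid m n E) (s : AbsSection m n E) :
    IsSuperdiv s 1 A.deRhamField (ofDegree 1 (A.modularForm s)) := by
  rintro x₀ U hUo hU σ hσ f ⟨K, hK, hKU, hf⟩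
  change chartIntegral x₀ ((-(-1 : ℝ) ^ (1 * n)) • berForm σ (A.deRhamField f n)) =
    chartIntegral x₀ ((-1 : ℝ) ^ (1 * n) •
      berForm σ (superMul (ofDegree 1 (A.modularForm s)) f n))
  rw [chartIntegral_smul, chartIntegral_smul]
  cases n with
  -- In rank zero no component of `f` is mapped to degree `n` by `d` or by the product with a
  -- `1`-form; both sides are zero.
  | zero =>
    have h0 : berForm σ (0 : Form m 0 E 0) = 0 := funext fun x => berForm_of_eq_zero rfl
    have h1 : chartIntegral x₀ (0 : ∀ x : M, TangentSpace (𝓡 m) x [⋀^Fin m]→ₗ[ℝ] ℝ) = 0 := by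
      simpa using chartIntegral_smul x₀ 0 (0 : ∀ x : M, TangentSpace (𝓡 m) x [⋀^Fin m]→ₗ[ℝ] ℝ)
    rw [superMul_ofDegree_left_of_lt Nat.zero_lt_one]
    change _ * chartIntegral x₀ (berForm σ 0) = _
    rw [h0, h1, mul_zero, mul_zero]
  | succ k =>
    have hk : 1 + k = k + 1 := Nat.add_comm 1 k
    have h := A.chartIntegral_deRham_add_modularForm hk hUo hU hK hKU hσ
      (α := f k) fun x hx => hf x hx k
    rw [superMul_ofDegree_left hk]
    change _ * chartIntegral x₀ (berForm σ (A.deRham k (f k))) = _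
    linear_combination -(-1 : ℝ) ^ (1 * (k + 1)) * h

end Superdivergence

end SkewAlg

namespace SkewAlg

/-! ### Uniqueness of the superdivergence -/

section Uniqueness

variable {m n : ℕ} {M : Type*} [TopologicalSpace M] [ChartedSpace (EuclideanSpace ℝ (Fin m)) M]
  [IsManifold (𝓡 m) ∞ M]
  {E : M → Type*} [∀ x, AddCommGroup (E x)] [∀ x, Module ℝ (E x)] [∀ x, TopologicalSpace (E x)]
  [TopologicalSpace (TotalSpace (EuclideanSpace ℝ (Fin n)) E)]
  [FiberBundle (EuclideanSpace ℝ (Fin n)) E]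

/-- The determinant of the model space, pulled back by the differential of the chart. -/
theorem exists_alternating_coordField {x₀ x : M}
    (hx : x ∈ (chartAt (EuclideanSpace ℝ (Fin m)) x₀).source) :
    ∃ μ : TangentSpace (𝓡 m) x [⋀^Fin m]→ₗ[ℝ] ℝ, (μ fun a => coordField x₀ a x) = 1 := by
  let b := (EuclideanSpace.basisFun (Fin m) ℝ).toBasis
  let L : TangentSpace (𝓡 m) x →ₗ[ℝ] EuclideanSpace ℝ (Fin m) :=
    (mfderiv (𝓡 m) (𝓡 m) (chartAt (EuclideanSpace ℝ (Fin m)) x₀) x).toLinearMap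
  refine ⟨b.det.compLinearMap L, ?_⟩
  have h : (fun a => L (coordField x₀ a x)) = b := by
    funext a
    rw [coordField_eq hx]
    refine (mfderiv_mfderiv_symm hx _).trans ?_
    simp only [b, OrthonormalBasis.coe_toBasis, EuclideanSpace.basisFun_apply]
    rfl
  rw [AlternatingMap.compLinearMap_apply]
  change b.det (fun a => L (coordField x₀ a x)) = 1
  rw [h, b.det_self]

theorem IsSuperdiv.chartIntegral_superMul {s : AbsSection m n E} {d : ℕ}
    {X : SuperFn m n E → SuperFn m n E} {g h : SuperFn m n E} (hg : IsSuperdiv s d X g)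
    (hh : IsSuperdiv s d X h) {x₀ : M} {U : Set M} (hUo : IsOpen U)
    (hU : U ⊆ (chartAt (EuclideanSpace ℝ (Fin m)) x₀).source) {σ : ∀ x, LFib m n E x}
    (hσ : s.IsRep U σ) {f : SuperFn m n E} (hf : SupportedIn U f) :
    chartIntegral x₀ (berForm σ (superMul g f n)) =
      chartIntegral x₀ (berForm σ (superMul h f n)) := by
  have h1 := (hg x₀ U hUo hU σ hσ f hf).symm.trans (hh x₀ U hUo hU σ hσ f hf)
  change chartIntegral x₀ ((-1 : ℝ) ^ (d * n) • berForm σ (superMul g f n)) =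
    chartIntegral x₀ ((-1 : ℝ) ^ (d * n) • berForm σ (superMul h f n)) at h1
  rw [chartIntegral_smul, chartIntegral_smul] at h1
  exact mul_left_cancel₀ (pow_ne_zero _ (by norm_num)) h1

variable [VectorBundle ℝ (EuclideanSpace ℝ (Fin n)) E]
  [ContMDiffVectorBundle ∞ (EuclideanSpace ℝ (Fin n)) E (𝓡 m)] [T2Space M]

/-- The superdivergence is unique. -/
theorem IsSuperdiv.unique {s : AbsSection m n E} {d : ℕ}
    {X : SuperFn m n E → SuperFn m n E} {g h : SuperFn m n E} (hg : IsSuperdiv s d X g)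
    (hh : IsSuperdiv s d X h) : g = h := by
  funext k
  rcases lt_or_ge n k with hk | hk
  · rw [form_eq_zero_of_lt hk (g k), form_eq_zero_of_lt hk (h k)]
  obtain ⟨l, hkl⟩ := Nat.exists_eq_add_of_le hk
  replace hkl : k + l = n := hkl.symm
  by_contra hne
  -- The difference `g - h` in degree `k` is written in the form to which `wedgeAlt_smul_add`
  -- applies.
  obtain ⟨x, hx⟩ : ∃ x, (-1 : ℝ) • (h k).1 x + (g k).1 x ≠ 0 := by
    by_contra! h0
    refine hne (Subtype.ext (funext fun x => ?_))
    ext v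
    have h1 : -1 * (h k).1 x v + (g k).1 x v = 0 := congrArg (fun a => a v) (h0 x)
    linarith
  have := finiteDimensional_fiber n E x
  obtain ⟨b, hb⟩ := exists_wedgeAlt_ne_zero hkl (finrank_fiber n E x) hx
  obtain ⟨β, rfl⟩ := exists_form (m := m) (n := n) x b
  obtain ⟨Y, μ, hR⟩ := s.exists_repAt x
  have hxs := mem_chart_source (EuclideanSpace ℝ (Fin m)) x
  obtain ⟨Z, hZ⟩ := exists_coordFields hxs
  -- `c` is the coordinate density of `S(σ)((g_k - h_k) ∧ β)` near `x`. It is nonzero at `x` by the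
  -- choice of `β` and because `σ` has no zeros.
  let c : Fct m M := revSign n • (((-1 : ℝ) • evalSec (wedge hkl (h k) β) Y +
    evalSec (wedge hkl (g k) β) Y) * evalSec μ Z)
  have hc : c x ≠ 0 := by
    obtain ⟨v, hv⟩ := DFunLike.ne_iff.1 hb
    obtain ⟨μ', hμ'⟩ := exists_alternating_coordField hxs
    have hp := pairL_injective (m := m) (w := fun a => coordField x a x) (μ := μ') (v := v)
      (by rw [hμ', mul_one]; exact hv)
    intro h0
    refine hR.ne_zero (hp ?_)
    rw [map_zero, decomp, pairL_tmul, wedgeAlt_smul_add]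
    have h1 : revSign n ≠ 0 := left_ne_zero_of_mul_eq_one (revSign_mul_self n)
    refine (mul_eq_zero.1 ?_).resolve_left h1
    refine Eq.trans ?_ h0
    simp only [← hZ.self_of_nhds]
    rfl
  obtain ⟨U, hUs, hUo, hxU⟩ := mem_nhds_iff.1
    (Filter.inter_mem ((chartAt (EuclideanSpace ℝ (Fin m)) x).open_source.mem_nhds hxs) hR)
  have hσ : s.IsRep U (decomp Y μ) :=
    ⟨fun y _ => ⟨Y, μ, Filter.Eventually.of_forall fun _ => rfl⟩, fun y hy => (hUs hy).2⟩
  have hU := fun y hy => (hUs (a := y) hy).1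
  have hpos : ∀ᶠ y in 𝓝 x, 0 < c x * c y :=
    (continuous_const.mul c.contMDiff.continuous).continuousAt.eventually
      (lt_mem_nhds (mul_self_pos.2 hc))
  -- The support of `χ` is confined to `U`, to the points where `c` has the sign of `c x`, and to
  -- those where `Z` is the coordinate frame.
  obtain ⟨χ, hχs, hχ1, hχ0, hχc⟩ := exists_bump_one (m := m)
    (Filter.inter_mem (hUo.mem_nhds hxU) (Filter.inter_mem hpos hZ))
  have hKU : tsupport χ ⊆ U := fun y hy => (hχs hy).1
  -- Testing against `c(x) χ β` turns the difference of the two integrands into `c(x) χ c`, which is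
  -- nonnegative and positive at `x`, against the equality of the integrals.
  let δ : Form m n E l := formMul (c x • χ) β
  have hδ : ∀ y ∉ tsupport χ, δ.1 y = 0 := fun y hy => by
    have h0 : χ y = 0 := image_eq_zero_of_notMem_tsupport hy
    change (c x * χ y) • β.1 y = 0
    rw [h0, mul_zero, zero_smul]
  have hw : ∀ α : Form m n E k, ∀ y ∉ tsupport χ, (wedge hkl α δ).1 y = 0 := fun α y hy => by
    rw [wedge_apply, hδ y hy, wedgeAlt_zero_right]
  have hint := hg.chartIntegral_superMul hh hUo hU hσ (f := ofDegree l δ)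
    ⟨tsupport χ, hχc, hKU, fun y hy j => by
      rcases eq_or_ne j l with rfl | hj
      · rw [ofDegree_self, hδ y hy]
      · rw [ofDegree_of_ne hj]; rfl⟩
  rw [superMul_ofDegree_right hkl, superMul_ofDegree_right hkl, chartIntegral_eq, chartIntegral_eq,
    ← sub_eq_zero, ← MeasureTheory.integral_sub
      (integrable_chartFn_berForm hU hχc hKU hσ.1 (hw _))
      (integrable_chartFn_berForm hU hχc hKU hσ.1 (hw _))] at hint
  have hval : ∀ y ∈ tsupport χ,
      chartFn x (berForm (decomp Y μ) (wedge hkl (g k) δ))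
        (chartAt (EuclideanSpace ℝ (Fin m)) x y) -
      chartFn x (berForm (decomp Y μ) (wedge hkl (h k) δ))
        (chartAt (EuclideanSpace ℝ (Fin m)) x y) = χ y * (c x * c y) := fun y hy => by
    have hys := hU y (hKU hy)
    have hw' : ∀ α : Form m n E k,
        (wedge hkl α δ).1 y = (c x * χ y) • (wedge hkl α β).1 y := fun α =>
      wedgeAlt_smul_right hkl (c x * χ y) (α.1 y) (β.1 y)
    rw [chartFn_apply _ hys, chartFn_apply _ hys, berForm_of_eq rfl, berForm_of_eq rfl, hw', hw']
    simp only [← (hχs hy).2.2 _]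
    change revSign n * (c x * χ y * evalSec (wedge hkl (g k) β) Y y) * evalSec μ Z y -
      revSign n * (c x * χ y * evalSec (wedge hkl (h k) β) Y y) * evalSec μ Z y =
      χ y * (c x * (revSign n * ((-1 * evalSec (wedge hkl (h k) β) Y y +
        evalSec (wedge hkl (g k) β) Y y) * evalSec μ Z y)))
    ring
  have hsm := fun α : Form m n E k => contDiff_chartFn_berForm hU hχc hKU hσ.1 (hw α)
  have hxK : x ∈ tsupport χ := subset_tsupport _ (by
    rw [mem_support, hχ1.self_of_nhds]; exact one_ne_zero)
  refine (Continuous.integral_pos_of_hasCompactSupport_nonneg_nonzero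
    (μ := MeasureTheory.volume) (x := chartAt (EuclideanSpace ℝ (Fin m)) x x)
    ((hsm (g k)).1.continuous.sub (hsm (h k)).1.continuous)
    ((hsm (g k)).2.sub (hsm (h k)).2) (fun u => ?_) ?_).ne' hint
  · by_cases hu : u ∈ chartAt (EuclideanSpace ℝ (Fin m)) x '' tsupport χ
    · obtain ⟨y, hy, rfl⟩ := hu
      refine (mul_nonneg (hχ0 y) (hχs hy).2.1.le).trans_eq (hval y hy).symm
    · refine ge_of_eq ?_
      change chartFn x (berForm (decomp Y μ) (wedge hkl (g k) δ)) u -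
        chartFn x (berForm (decomp Y μ) (wedge hkl (h k) δ)) u = 0
      rw [chartFn_of_notMem (fun y hy => berForm_of_eq_zero (hw _ y hy)) hu,
        chartFn_of_notMem (fun y hy => berForm_of_eq_zero (hw _ y hy)) hu, sub_zero]
  · refine ne_of_eq_of_ne (hval x hxK) ?_
    rw [hχ1.self_of_nhds, one_mul]
    exact mul_self_ne_zero.2 hc

end Uniqueness

end SkewAlg

end

/-! ### The modular class and the superdivergence of the de Rham vector field -/

theorem mainTheorem4 {m n : ℕ} {M : Type*} [TopologicalSpace M]
    [ChartedSpace (EuclideanSpace ℝ (Fin m)) M] [IsManifold (𝓡 m) ∞ M] [T2Space M]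
    [SigmaCompactSpace M]
    {E : M → Type*} [∀ x, AddCommGroup (E x)] [∀ x, Module ℝ (E x)] [∀ x, TopologicalSpace (E x)]
    [TopologicalSpace (Bundle.TotalSpace (EuclideanSpace ℝ (Fin n)) E)]
    [FiberBundle (EuclideanSpace ℝ (Fin n)) E] [VectorBundle ℝ (EuclideanSpace ℝ (Fin n)) E]
    [ContMDiffVectorBundle ∞ (EuclideanSpace ℝ (Fin n)) E (𝓡 m)]
    (A : SkewAlg.SkewAlgebroid m n E) :
    ∃ c : A.FormClass, (∀ c' : A.FormClass, A.IsModularClass c' ↔ c' = c) ∧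
      ∀ s : SkewAlg.AbsSection m n E, ∃ g : SkewAlg.Form m n E 1,
        (∀ h : SkewAlg.SuperFn m n E,
          SkewAlg.IsSuperdiv s 1 A.deRhamField h ↔ h = SkewAlg.ofDegree 1 g) ∧
        A.toClass g = c := by
  obtain ⟨s₀⟩ := SkewAlg.nonempty_absSection m n E
  refine ⟨A.toClass (A.modularForm s₀), fun c' => ⟨?_, ?_⟩, fun s => ⟨A.modularForm s,
    fun h => ⟨fun hh => hh.unique (A.isSuperdiv_modularForm s), ?_⟩,
    A.toClass_modularForm_eq s s₀⟩⟩
  · rintro ⟨s, φ, hφ, rfl⟩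
    rw [A.eq_modularForm hφ, A.toClass_modularForm_eq s s₀]
  · rintro rfl
    exact ⟨s₀, _, A.isModularForm_modularForm s₀, rfl⟩
  · rintro rfl
    exact A.isSuperdiv_modularForm s
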